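/- **Conventions.** $\mathcal{C}at$ is the 2-category of small categories and $\mathcal{CAT}$ that of not necessarily small categories. A *prederivator* is a (strict) 2-functor $\mathscr D\colon \mathcal{C}at^{\mathrm{op}}\to\mathcal{CAT}$ (reversing functors only); we write $u^*\colon\mathscr D(B)\to\mathscr D(A)$ for the value at $u\colon A\to B$. Morphisms of prederivators are pseudo-natural transformations and 2-cells are modifications. A prederivator is a *derivator* if (Der1) $\mathscr D(\coprod_i A_i)\to\prod_i\mathscr D(A_i)$ is an equivalence for every small family; (Der2) a morphism of $\mathscr D(A)$ is an isomorphism if and only if its evaluations at all $a\in A$ are; (Der3) every $u^*$ has a left adjoint $u_!$ and a right adjoint $u_*$; (Der4) for all $u\colon A\to B$ and $b\in B$ the canonical mates $\pi_!p^*\to b^*u_!$ and $b^*u_*\to\pi_*q^*$ of the slice squares of $(u/b)$ and $(b/u)$ are isomorphisms. Let $\square=[1]\times[1]$, and let $\ulcorner,\lrcorner\subset\square$ be the full subcategories obtained by removing the final, respectively the initial, object. A square $X\in\mathscr D(\square)$ is *cocartesian* if it lies in the essential image of $(i_\ulcorner)_!$ and *cartesian* if it lies in that of $(i_\lrcorner)_*$.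 A derivator is *stable* if $\mathscr D(\mathbb 1)$ has a zero object and a square is cartesian if and only if it is cocartesian. A morphism is *exact* if it preserves initial and terminal objects (of the underlying categories) and cocartesian and cartesian squares. For a small category $B$, $\mathscr D^B$ denotes the derivator $A\mapsto\mathscr D(B\times A)$; this gives a 2-functor $(-)^B\colon\mathcal{DER}_{\mathrm{St,ex}}\to\mathcal{DER}$ from stable derivators, exact morphisms and all modifications to derivators. Small categories $A$ and $A'$ are *strongly stably equivalent* if there is a pseudo-natural equivalence $\Phi\colon(-)^A\simeq(-)^{A'}$ of 2-functors $\mathcal{DER}_{\mathrm{St,ex}}\to\mathcal{DER}$, that is, a pseudo-natural transformation whose component $\Phi_{\mathscr D}\colon\mathscr D^A\to\mathscr D^{A'}$ is an equivalence of derivators for every stable derivator $\mathscr D$. **Theorem.** Let $C$ be a small category, let $n\ge 0$, and let $y_1,\dots,y_n$ be objects of $C$, not necessarily distinct. Let $(n\cdot\mathbb 1)^{\lhd}$ and $(n\cdot\mathbb 1)^{\rhd}$ be the categories obtained from the discrete category on objects $x_1,\dots,x_n$ by adjoining an initial object (the source of valence $n$), respectively a terminal object (the sink of valence $n$). Let $D^-$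 and $D^+$ be the small categories defined by the pushouts in $\mathcal{C}at$ $$D^-=\Big(\coprod_{k=1}^n[1]\Big)\sqcup_{\coprod_{k=1}^n(\mathbb 1\sqcup\mathbb 1)}\big((n\cdot\mathbb 1)^{\lhd}\sqcup C\big),\qquad D^+=\Big(\coprod_{k=1}^n[1]\Big)\sqcup_{\coprod_{k=1}^n(\mathbb 1\sqcup\mathbb 1)}\big((n\cdot\mathbb 1)^{\rhd}\sqcup C\big),$$ where in the $k$-th summand $\mathbb 1\sqcup\mathbb 1\to[1]$ classifies $(0,1)$ and the other functor classifies $x_k$ and $y_k$; in other words, one freely adds a new morphism $x_k\to y_k$ for each $k$. Then $D^-$ and $D^+$ are strongly stably equivalent. -/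

import Mathlib

set_option linter.checkUnivs false

open CategoryTheory Bicategory Opposite Limits
open scoped CategoryTheory.Pseudofunctor.StrongTrans

universe w v u

/-! ### Prederivators

`Cat.{w, w}` is the strict 2-category of small categories, `Cat.{v, u}` that of possibly large
ones. The 1-cell dual `(Cat.{w, w})ᵒᵖ` reverses functors and keeps natural transformations. -/

/-- A prederivator: a (strict) 2-functor `Catᵒᵖ → CAT`. -/
abbrev Prederivator := StrictPseudofunctor (Cat.{w, w})ᵒᵖ Cat.{v, u}

namespace Prederivator

/-- Pseudofunctors `Catᵒᵖ → CAT`, among which prederivators are the strict ones. -/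
abbrev Psd := Pseudofunctor (Cat.{w, w})ᵒᵖ Cat.{v, u}

/-- The 2-category of prederivators: 1-cells are pseudo-natural transformations,
2-cells are modifications. -/
instance bicategory : Bicategory Prederivator.{w, v, u} where
  Hom D E := D.toPseudofunctor ⟶ E.toPseudofunctor
  id D := 𝟙 D.toPseudofunctor
  comp f g := CategoryStruct.comp (obj := Psd.{w, v, u}) f g
  homCategory D E := inferInstanceAs (Category (D.toPseudofunctor ⟶ E.toPseudofunctor))
  whiskerLeft f _ _ η := Bicategory.whiskerLeft (B := Psd.{w, v, u}) f η
  whiskerRight η f := Bicategory.whiskerRight (B := Psd.{w, v, u}) η f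
  associator f g h := Bicategory.associator (B := Psd.{w, v, u}) f g h
  leftUnitor f := Bicategory.leftUnitor (B := Psd.{w, v, u}) f
  rightUnitor f := Bicategory.rightUnitor (B := Psd.{w, v, u}) f
  whiskerLeft_id _ _ := Bicategory.whiskerLeft_id (B := Psd.{w, v, u}) _ _
  whiskerLeft_comp _ _ _ _ _ _ := Bicategory.whiskerLeft_comp (B := Psd.{w, v, u}) _ _ _
  id_whiskerLeft _ := Bicategory.id_whiskerLeft (B := Psd.{w, v, u}) _
  comp_whiskerLeft _ _ _ _ _ := Bicategory.comp_whiskerLeft (B := Psd.{w, v, u}) _ _ _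
  id_whiskerRight _ _ := Bicategory.id_whiskerRight (B := Psd.{w, v, u}) _ _
  comp_whiskerRight _ _ _ := Bicategory.comp_whiskerRight (B := Psd.{w, v, u}) _ _ _
  whiskerRight_id _ := Bicategory.whiskerRight_id (B := Psd.{w, v, u}) _
  whiskerRight_comp _ _ _ := Bicategory.whiskerRight_comp (B := Psd.{w, v, u}) _ _ _
  whisker_assoc _ _ _ _ _ := Bicategory.whisker_assoc (B := Psd.{w, v, u}) _ _ _
  whisker_exchange _ _ := Bicategory.whisker_exchange (B := Psd.{w, v, u}) _ _
  pentagon _ _ _ _ := Bicategory.pentagon (B := Psd.{w, v, u}) _ _ _ _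
  triangle _ _ := Bicategory.triangle (B := Psd.{w, v, u}) _ _

/-- The category `D(A)` of coherent diagrams of shape `A`. -/
abbrev Diag (D : Prederivator.{w, v, u}) (A : Type w) [SmallCategory A] : Type u :=
  D.obj (op (Cat.of A))

section Restriction

variable (D : Prederivator.{w, v, u})
variable {A : Type w} [SmallCategory A] {B : Type w} [SmallCategory B]
variable {A' : Type w} [SmallCategory A']

/-- The restriction functor `u^* : D(B) ⥤ D(A)`. -/
def res (u : A ⥤ B) : D.Diag B ⥤ D.Diag A :=
  (D.map u.toCatHom.op).toFunctor

/-- The natural transformation `u^* ⟶ u'^*` induced by `α : u ⟶ u'`. -/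
def res₂ {u u' : A ⥤ B} (α : u ⟶ u') : D.res u ⟶ D.res u' :=
  (D.map₂ (Bicategory.Opposite.op2 α.toCatHom₂)).toNatTrans

/-- The equality `(u ⋙ u')^* = u'^* ⋙ u^*`, as an isomorphism. -/
def resComp (u : A ⥤ B) (u' : B ⥤ A') : D.res (u ⋙ u') ≅ D.res u' ⋙ D.res u :=
  Cat.Hom.toNatIso (D.mapComp u'.toCatHom.op u.toCatHom.op)

end Restriction

/-- The terminal category. -/
abbrev Pt := Discrete PUnit.{w + 1}

/-- The functor `1 ⥤ B` which classifies the object `b`. -/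
abbrev pt {B : Type w} [SmallCategory B] (b : B) : Pt.{w} ⥤ B := Functor.fromPUnit b

/-- The evaluation functor `b^* : D(B) ⥤ D(1)`. -/
abbrev eval (D : Prederivator.{w, v, u}) {B : Type w} [SmallCategory B] (b : B) :
    D.Diag B ⥤ D.Diag Pt.{w} :=
  D.res (pt b)

section Slice

variable {A : Type w} [SmallCategory A] {B : Type w} [SmallCategory B]

/-- The 2-cell `u ∘ p ⟶ b ∘ π` of the slice square of `(u/b)`. -/
def sliceLeft (u : A ⥤ B) (b : B) :
    CostructuredArrow.proj u b ⋙ u ⟶ Functor.star.{w} (CostructuredArrow u b) ⋙ pt b where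
  app x := x.hom
  naturality _ _ f := (CostructuredArrow.w f).trans (Category.comp_id _).symm

/-- The 2-cell `b ∘ π ⟶ u ∘ q` of the slice square of `(b/u)`. -/
def sliceRight (u : A ⥤ B) (b : B) :
    Functor.star.{w} (StructuredArrow b u) ⋙ pt b ⟶ StructuredArrow.proj b u ⋙ u where
  app x := x.hom
  naturality _ _ f := (Category.id_comp _).trans (StructuredArrow.w f).symm

/-- The 2-cell `p^* u^* ⟶ π^* b^*` obtained by applying `D` to the slice square of `(u/b)`. -/
def sliceLeftRes (D : Prederivator.{w, v, u}) (u : A ⥤ B) (b : B) :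
    D.res u ⋙ D.res (CostructuredArrow.proj u b) ⟶
      D.eval b ⋙ D.res (Functor.star.{w} (CostructuredArrow u b)) :=
  (D.resComp _ _).inv ≫ D.res₂ (sliceLeft u b) ≫ (D.resComp _ _).hom

/-- The 2-cell `π^* b^* ⟶ q^* u^*` obtained by applying `D` to the slice square of `(b/u)`. -/
def sliceRightRes (D : Prederivator.{w, v, u}) (u : A ⥤ B) (b : B) :
    D.eval b ⋙ D.res (Functor.star.{w} (StructuredArrow b u)) ⟶
      D.res u ⋙ D.res (StructuredArrow.proj b u) :=
  (D.resComp _ _).inv ≫ D.res₂ (sliceRight u b) ≫ (D.resComp _ _).hom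

end Slice

/-! ### Derivators -/

/-- The axioms of a derivator. In (Der4) the canonical mates are formed with respect to arbitrary
choices of the adjoints, which exist by (Der3) and are unique up to isomorphism. -/
class IsDerivator (D : Prederivator.{w, v, u}) : Prop where
  /-- (Der1) `D(∐ Aᵢ) ⥤ ∏ D(Aᵢ)` is an equivalence for every small family. -/
  der1 (I : Type w) (A : I → Type w) [∀ i, SmallCategory (A i)] :
    (Functor.pi' fun i => D.res (Sigma.incl (C := A) i)).IsEquivalence
  /-- (Der2) A morphism which is pointwise an isomorphism is an isomorphism. -/
  der2 (A : Type w) [SmallCategory A] {X Y : D.Diag A} (f : X ⟶ Y) :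
    (∀ a : A, IsIso ((D.eval a).map f)) → IsIso f
  /-- (Der3) Left Kan extensions exist. -/
  der3_left {A B : Type w} [SmallCategory A] [SmallCategory B] (u : A ⥤ B) :
    (D.res u).IsRightAdjoint
  /-- (Der3) Right Kan extensions exist. -/
  der3_right {A B : Type w} [SmallCategory A] [SmallCategory B] (u : A ⥤ B) :
    (D.res u).IsLeftAdjoint
  /-- (Der4) The canonical mate `π_! p^* ⟶ b^* u_!` is an isomorphism. -/
  der4_left {A B : Type w} [SmallCategory A] [SmallCategory B] (u : A ⥤ B) (b : B)
    {lu : D.Diag A ⥤ D.Diag B} {lπ : D.Diag (CostructuredArrow u b) ⥤ D.Diag Pt.{w}}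
    (adj : lu ⊣ D.res u) (adj' : lπ ⊣ D.res (Functor.star.{w} (CostructuredArrow u b))) :
    IsIso ((CategoryTheory.mateEquiv adj adj').symm (TwoSquare.mk _ _ _ _ (D.sliceLeftRes u b))).natTrans
  /-- (Der4) The canonical mate `b^* u_* ⟶ π_* q^*` is an isomorphism. -/
  der4_right {A B : Type w} [SmallCategory A] [SmallCategory B] (u : A ⥤ B) (b : B)
    {ru : D.Diag A ⥤ D.Diag B} {rπ : D.Diag (StructuredArrow b u) ⥤ D.Diag Pt.{w}}
    (adj : D.res u ⊣ ru) (adj' : D.res (Functor.star.{w} (StructuredArrow b u)) ⊣ rπ) :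
    IsIso (CategoryTheory.mateEquiv adj adj' (TwoSquare.mk _ _ _ _ (D.sliceRightRes u b))).natTrans

attribute [instance] IsDerivator.der3_left IsDerivator.der3_right

section Kan

variable (D : Prederivator.{w, v, u}) [D.IsDerivator]
variable {A : Type w} [SmallCategory A] {B : Type w} [SmallCategory B]

/-- The left Kan extension functor `u_!`. -/
noncomputable def lan (u : A ⥤ B) : D.Diag A ⥤ D.Diag B := (D.res u).leftAdjoint

/-- The right Kan extension functor `u_*`. -/
noncomputable def ran (u : A ⥤ B) : D.Diag A ⥤ D.Diag B := (D.res u).rightAdjoint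

end Kan

/-! ### Stable derivators and exact morphisms -/

/-- The poset `[1] = (0 < 1)` as a small category. -/
abbrev Arr := AsSmall.{w} (Fin 2)

/-- The object `0` of `[1]`. -/
abbrev arr0 : Arr.{w} := AsSmall.up.obj 0

/-- The object `1` of `[1]`. -/
abbrev arr1 : Arr.{w} := AsSmall.up.obj 1

/-- The commutative square `[1] × [1]`. -/
abbrev Square := Arr.{w} × Arr.{w}

/-- The full subcategory of the square obtained by removing the final object. -/
abbrev Ulcorner := ObjectProperty.FullSubcategory fun x : Square.{w} => x ≠ (arr1, arr1)

/-- The full subcategory of the square obtained by removing the initial object. -/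
abbrev Lrcorner := ObjectProperty.FullSubcategory fun x : Square.{w} => x ≠ (arr0, arr0)

/-- The inclusion of `⌜` in the square. -/
abbrev ulInc : Ulcorner.{w} ⥤ Square.{w} :=
  ObjectProperty.ι fun x : Square.{w} => x ≠ (arr1, arr1)

/-- The inclusion of `⌟` in the square. -/
abbrev lrInc : Lrcorner.{w} ⥤ Square.{w} :=
  ObjectProperty.ι fun x : Square.{w} => x ≠ (arr0, arr0)

/-- A square is cocartesian if it lies in the essential image of `(i_⌜)_!`. -/
def IsCocartesian (D : Prederivator.{w, v, u}) [D.IsDerivator] (X : D.Diag Square.{w}) : Prop :=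
  (D.lan ulInc).essImage X

/-- A square is cartesian if it lies in the essential image of `(i_⌟)_*`. -/
def IsCartesian (D : Prederivator.{w, v, u}) [D.IsDerivator] (X : D.Diag Square.{w}) : Prop :=
  (D.ran lrInc).essImage X

/-- A derivator is stable if its underlying category has a zero object (that is, it is pointed)
and a square is cartesian if and only if it is cocartesian. -/
class IsStable (D : Prederivator.{w, v, u}) : Prop extends D.IsDerivator where
  hasZeroObject : HasZeroObject (D.Diag Pt.{w})
  cartesian_iff_cocartesian (X : D.Diag Square.{w}) : D.IsCartesian X ↔ D.IsCocartesian X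

/-- The component `F_A : D(A) ⥤ E(A)` of a morphism `F : D ⟶ E`. -/
abbrev component {D E : Prederivator.{w, v, u}} (F : D ⟶ E) (A : Type w) [SmallCategory A] :
    D.Diag A ⥤ E.Diag A :=
  (Pseudofunctor.StrongTrans.app F (op (Cat.of A))).toFunctor

/-- A morphism of derivators is exact if it is right exact (it preserves initial objects and
cocartesian squares) and left exact (it preserves terminal objects and cartesian squares). -/
structure IsExact {D E : Prederivator.{w, v, u}} [D.IsDerivator] [E.IsDerivator]
    (F : D ⟶ E) : Prop where
  initial (X : D.Diag Pt.{w}) : Nonempty (IsInitial X) → Nonempty (IsInitial ((component F _).obj X))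
  cocartesian (X : D.Diag Square.{w}) : D.IsCocartesian X → E.IsCocartesian ((component F _).obj X)
  terminal (X : D.Diag Pt.{w}) : Nonempty (IsTerminal X) → Nonempty (IsTerminal ((component F _).obj X))
  cartesian (X : D.Diag Square.{w}) : D.IsCartesian X → E.IsCartesian ((component F _).obj X)

/-! ### The shift `D^B` -/

section Shift

variable (B : Type w) [SmallCategory B]

/-- The 2-functor `B × -` on objects. -/
abbrev timesObj (A : (Cat.{w, w})ᵒᵖ) : (Cat.{w, w})ᵒᵖ :=
  op (Cat.of (B × A.unop))

/-- The 2-functor `B × -` on functors. -/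
abbrev timesMap {A A' : (Cat.{w, w})ᵒᵖ} (f : A ⟶ A') : timesObj B A ⟶ timesObj B A' :=
  ((𝟭 B).prod f.unop.toFunctor).toCatHom.op

/-- The 2-functor `B × -` on natural transformations. -/
abbrev timesMap₂ {A A' : (Cat.{w, w})ᵒᵖ} {f g : A ⟶ A'} (η : f ⟶ g) :
    timesMap B f ⟶ timesMap B g :=
  Bicategory.Opposite.op2 (NatTrans.prod (𝟙 (𝟭 B)) η.unop2.toNatTrans).toCatHom₂

theorem timesMap₂_comp {A A' : (Cat.{w, w})ᵒᵖ} {f g h : A ⟶ A'} (η : f ⟶ g) (θ : g ⟶ h) :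
    timesMap₂ B (η ≫ θ) = timesMap₂ B η ≫ timesMap₂ B θ := by
  apply congrArg Bicategory.Opposite.op2
  apply Cat.Hom₂.ext
  apply NatTrans.ext
  funext x
  exact Prod.ext (Category.comp_id (𝟙 x.1)).symm rfl

/-- The prederivator `D^B : A ↦ D(B × A)` of coherent diagrams of shape `B` in `D`. -/
def shift (D : Prederivator.{w, v, u}) : Prederivator.{w, v, u} where
  obj A := D.obj (timesObj B A)
  map f := D.map (timesMap B f)
  map₂ η := D.map₂ (timesMap₂ B η)
  map₂_id f := D.map₂_id (timesMap B f)
  map₂_comp η θ := (congrArg D.map₂ (timesMap₂_comp B η θ)).trans (D.map₂_comp _ _)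
  mapId A := D.mapId (timesObj B A)
  mapComp f g := D.mapComp (timesMap B f) (timesMap B g)
  map₂_whisker_left f _ _ η := D.map₂_whisker_left (timesMap B f) (timesMap₂ B η)
  map₂_whisker_right η g := D.map₂_whisker_right (timesMap₂ B η) (timesMap B g)
  map₂_left_unitor f := D.map₂_left_unitor (timesMap B f)
  map₂_right_unitor f := D.map₂_right_unitor (timesMap B f)
  map₂_associator f g h := D.map₂_associator (timesMap B f) (timesMap B g) (timesMap B h)
  map_id A := D.map_id (timesObj B A)
  mapId_eq_eqToIso A := D.mapId_eq_eqToIso (timesObj B A)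
  map_comp f g := D.map_comp (timesMap B f) (timesMap B g)
  mapComp_eq_eqToIso f g := D.mapComp_eq_eqToIso (timesMap B f) (timesMap B g)

/-- The morphism `F^B : D^B ⟶ E^B`, with components `F_{B × A}`. -/
def shiftMap {D E : Prederivator.{w, v, u}} (F : D ⟶ E) : D.shift B ⟶ E.shift B where
  app A := Pseudofunctor.StrongTrans.app F (timesObj B A)
  naturality f := Pseudofunctor.StrongTrans.naturality F (timesMap B f)
  naturality_naturality η := Pseudofunctor.StrongTrans.naturality_naturality F (timesMap₂ B η)
  naturality_id A := Pseudofunctor.StrongTrans.naturality_id F (timesObj B A)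
  naturality_comp f g := Pseudofunctor.StrongTrans.naturality_comp F (timesMap B f) (timesMap B g)

/-- The modification `η^B : F^B ⟶ G^B`, with components `η_{B × A}`. -/
def shiftMap₂ {D E : Prederivator.{w, v, u}} {F G : D ⟶ E} (η : F ⟶ G) :
    shiftMap B F ⟶ shiftMap B G :=
  Pseudofunctor.StrongTrans.Hom.of
    { app := fun A => (Pseudofunctor.StrongTrans.Hom.as η).app (timesObj B A)
      naturality := fun f => (Pseudofunctor.StrongTrans.Hom.as η).naturality (timesMap B f) }

end Shift

end Prederivator

open Prederivator

/-! ### The 2-category of stable derivators and exact morphisms -/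

/-- A stable derivator. -/
structure StableDerivator where
  /-- The underlying prederivator. -/
  toPrederivator : Prederivator.{w, v, u}
  /-- It is a stable derivator. -/
  [isStable : toPrederivator.IsStable]

namespace StableDerivator

attribute [instance] StableDerivator.isStable

/-- An exact morphism of stable derivators. -/
structure Hom (D E : StableDerivator.{w, v, u}) where
  /-- The underlying morphism of prederivators. -/
  hom : D.toPrederivator ⟶ E.toPrederivator
  /-- It is exact. -/
  exact : IsExact hom

/-- All modifications between exact morphisms. -/
instance homCategory (D E : StableDerivator.{w, v, u}) : Category (Hom D E) where
  Hom F G := F.hom ⟶ G.hom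
  id F := 𝟙 F.hom
  comp η θ := CategoryStruct.comp (obj := D.toPrederivator ⟶ E.toPrederivator) η θ
  id_comp η := Category.id_comp (obj := D.toPrederivator ⟶ E.toPrederivator) η
  comp_id η := Category.comp_id (obj := D.toPrederivator ⟶ E.toPrederivator) η
  assoc η θ ι := Category.assoc (obj := D.toPrederivator ⟶ E.toPrederivator) η θ ι

/-- The identity morphism is exact. -/
def Hom.id (D : StableDerivator.{w, v, u}) : Hom D D where
  hom := 𝟙 D.toPrederivator
  exact := ⟨fun _ h => h, fun _ h => h, fun _ h => h, fun _ h => h⟩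

/-- Exact morphisms compose. -/
def Hom.comp {D E F : StableDerivator.{w, v, u}} (f : Hom D E) (g : Hom E F) : Hom D F where
  hom := f.hom ≫ g.hom
  exact :=
    ⟨fun _ h => g.exact.initial _ (f.exact.initial _ h),
     fun _ h => g.exact.cocartesian _ (f.exact.cocartesian _ h),
     fun _ h => g.exact.terminal _ (f.exact.terminal _ h),
     fun _ h => g.exact.cartesian _ (f.exact.cartesian _ h)⟩

/-- A 2-isomorphism of underlying morphisms is a 2-isomorphism of exact morphisms. -/
def isoMk {D E : StableDerivator.{w, v, u}} {f g : Hom D E} (e : f.hom ≅ g.hom) : f ≅ g where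
  hom := e.hom
  inv := e.inv
  hom_inv_id := e.hom_inv_id
  inv_hom_id := e.inv_hom_id

/-- The 2-category of stable derivators, exact morphisms and all modifications. -/
instance bicategory : Bicategory StableDerivator.{w, v, u} where
  Hom D E := Hom D E
  id D := Hom.id D
  comp f g := Hom.comp f g
  homCategory D E := homCategory D E
  whiskerLeft f _ _ η := Bicategory.whiskerLeft (B := Prederivator.{w, v, u}) f.hom η
  whiskerRight η f := Bicategory.whiskerRight (B := Prederivator.{w, v, u}) η f.hom
  associator f g h := isoMk (Bicategory.associator f.hom g.hom h.hom)
  leftUnitor f := isoMk (Bicategory.leftUnitor f.hom)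
  rightUnitor f := isoMk (Bicategory.rightUnitor f.hom)
  whiskerLeft_id f g := Bicategory.whiskerLeft_id f.hom g.hom
  whiskerLeft_comp f _ _ _ η θ :=
    Bicategory.whiskerLeft_comp (B := Prederivator.{w, v, u}) f.hom η θ
  id_whiskerLeft η := Bicategory.id_whiskerLeft (B := Prederivator.{w, v, u}) η
  comp_whiskerLeft f g _ _ η :=
    Bicategory.comp_whiskerLeft (B := Prederivator.{w, v, u}) f.hom g.hom η
  id_whiskerRight f g := Bicategory.id_whiskerRight f.hom g.hom
  comp_whiskerRight η θ f :=
    Bicategory.comp_whiskerRight (B := Prederivator.{w, v, u}) η θ f.hom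
  whiskerRight_id η := Bicategory.whiskerRight_id (B := Prederivator.{w, v, u}) η
  whiskerRight_comp η g h :=
    Bicategory.whiskerRight_comp (B := Prederivator.{w, v, u}) η g.hom h.hom
  whisker_assoc f _ _ η h :=
    Bicategory.whisker_assoc (B := Prederivator.{w, v, u}) f.hom η h.hom
  whisker_exchange η θ := Bicategory.whisker_exchange (B := Prederivator.{w, v, u}) η θ
  pentagon f g h i := Bicategory.pentagon f.hom g.hom h.hom i.hom
  triangle f g := Bicategory.triangle f.hom g.hom

end StableDerivator

/-- The 2-functor `(-)^B` from stable derivators and exact morphisms to prederivators. -/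
def StableDerivator.shift (B : Type w) [SmallCategory B] :
    StrictPseudofunctor StableDerivator.{w, v, u} Prederivator.{w, v, u} where
  obj D := D.toPrederivator.shift B
  map F := shiftMap B F.hom
  map₂ η := shiftMap₂ B η
  map_id D := rfl
  map_comp F G := rfl
  mapId D := Iso.refl _
  mapId_eq_eqToIso D := rfl
  mapComp F G := Iso.refl _
  mapComp_eq_eqToIso F G := rfl
  map₂_id F := rfl
  map₂_comp η θ := rfl
  map₂_whisker_left F _ _ η := by
    refine Eq.symm ((Category.id_comp _).trans ?_)
    exact Category.comp_id _
  map₂_whisker_right η F := by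
    refine Eq.symm ((Category.id_comp _).trans ?_)
    exact Category.comp_id _
  map₂_left_unitor {D E} F := by
    refine Eq.symm ((Category.id_comp _).trans ?_)
    refine Eq.trans (congrArg (· ≫ _) (Bicategory.id_whiskerRight _ _)) ?_
    exact Category.id_comp _
  map₂_right_unitor F := by
    refine Eq.symm ((Category.id_comp _).trans ?_)
    refine Eq.trans (congrArg (· ≫ _) (Bicategory.whiskerLeft_id _ _)) ?_
    exact Category.id_comp _
  map₂_associator F G H := by
    refine Eq.symm ((Category.id_comp _).trans ?_)
    refine Eq.trans (congrArg (· ≫ _) (Bicategory.id_whiskerRight _ _)) ?_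
    refine (Category.id_comp _).trans ?_
    refine Eq.trans (congrArg (_ ≫ ·) (Category.comp_id _)) ?_
    refine Eq.trans (congrArg (_ ≫ ·) (Bicategory.whiskerLeft_id _ _)) ?_
    exact Category.comp_id _

/-! ### Strong stable equivalence -/

/-- Two small categories `A` and `A'` are strongly stably equivalent if there is a pseudo-natural
equivalence `(-)^A ≃ (-)^A'`: a pseudo-natural transformation all of whose components
`D^A ⟶ D^A'` are equivalences of derivators. Derivators form a full sub-2-category of
prederivators, so the components and their inverses are taken there. The derivators range over all
those with values in categories with objects in `Type u` and morphisms in `Type v`. -/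
def StronglyStablyEquivalent (A A' : Type w) [SmallCategory A] [SmallCategory A'] : Prop :=
  ∃ Φ : (StableDerivator.shift.{w, v, u} A).toPseudofunctor ⟶
      (StableDerivator.shift.{w, v, u} A').toPseudofunctor,
    ∀ D : StableDerivator.{w, v, u}, ∃ e : Bicategory.Equivalence
      (D.toPrederivator.shift A) (D.toPrederivator.shift A'), e.hom = Φ.app D

/-! ### Free oriented gluing -/

section Glue

variable (n : ℕ)

/-- The functor `s ⊔ t : ∐ₖ (1 ⊔ 1) ⥤ A₁ ⊔ A₂`. -/
def glueEnds {A₁ A₂ : Type w} [SmallCategory A₁] [SmallCategory A₂]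
    (s : Fin n → A₁) (t : Fin n → A₂) :
    (Σ _ : Fin n, Pt.{w} ⊕ Pt.{w}) ⥤ A₁ ⊕ A₂ :=
  Sigma.desc fun k => (pt (s k)).sum (pt (t k))

/-- The functor `∐ₖ (1 ⊔ 1) ⥤ ∐ₖ [1]` which is `(0, 1)` on each summand. -/
def glueEdges : (Σ _ : Fin n, Pt.{w} ⊕ Pt.{w}) ⥤ (Σ _ : Fin n, Arr.{w}) :=
  Sigma.Functor.sigma fun _ => (pt arr0).sum' (pt arr1)

/-- `A`, with its functors `i = (i₁, i₂) : A₁ ⊔ A₂ ⥤ A` and `β : ∐ₖ [1] ⥤ A`, is the free oriented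
gluing of `A₁` and `A₂` along new morphisms `βₖ : s k ⟶ t k`: it is the pushout of the functors
above in the category of small categories. -/
def IsFreeGluing {A₁ A₂ A : Type w} [SmallCategory A₁] [SmallCategory A₂] [SmallCategory A]
    (s : Fin n → A₁) (t : Fin n → A₂) (i : A₁ ⊕ A₂ ⥤ A) (β : (Σ _ : Fin n, Arr.{w}) ⥤ A) : Prop :=
  IsPushout (glueEnds n s t).toCatHom (glueEdges.{w} n).toCatHom i.toCatHom β.toCatHom

/-- The discrete category `n · 1` on `n` objects. -/
abbrev Points := Σ _ : Fin n, Pt.{w}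

/-- The source of valence `n`: a new initial object is added to `n · 1`. -/
abbrev SourceCat := WithInitial (Points.{w} n)

/-- The sink of valence `n`: a new terminal object is added to `n · 1`. -/
abbrev SinkCat := WithTerminal (Points.{w} n)

/-- The objects of the source of valence `n` other than the source. -/
abbrev sourceInc (k : Fin n) : SourceCat.{w} n := WithInitial.of ⟨k, ⟨PUnit.unit⟩⟩

/-- The objects of the sink of valence `n` other than the sink. -/
abbrev sinkInc (k : Fin n) : SinkCat.{w} n := WithTerminal.of ⟨k, ⟨PUnit.unit⟩⟩

end Glue

/-!
The categories `D⁻` and `D⁺` are compared through a third category. Let `Vert n` be the poset with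
elements `src`, `zero`, `mid`, `p k`, `q k`, `o k` for `k : Fin n` and `c T` for `T ⊆ Fin n`. Glue
it with `C` along free new morphisms `p k ⟶ y k` to a category `E`, and consider, in a stable
derivator, the diagrams of shape `E` which vanish at `zero`, `mid` and all `o k` and in which the
following squares are bicartesian:
```
  src ---> zero       src ---> p k       p k ---> c {k}ᶜ       q k ---> c T
   |        |          |        |         |         |           |        |
   v        v          v        v         v         v           v        v
  mid --> c univ      zero -> c {k}ᶜ     mid ---> c univ       o k -> c (insert k T)    (k ∉ T)
```
The elements `src` and `p k` form a source of valence `n`, and the elements `q k` and `c ∅` form a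
sink. As the elements of the source below `p k` are `src` and `p k`, and the only element of the
sink below `p k` is `q k`, both `D⁻` and `D⁺` are full subcategories of `E`, the new morphism
`q k ⟶ y k` of the second being the composite `q k ⟶ p k ⟶ y k`. The theorem follows once
restriction is an equivalence from the diagrams above both to `𝒟(D⁻)` and to `𝒟(D⁺)`, in a way
which is natural in `𝒟`. Morally this is a reflection functor: the value at `q k` is the one at
`p k`, and the value at `c ∅` is the cofibre of the map from `src` to the sum of all `p k`, with the
induced maps from the summands. The objects in between express this by squares alone.

For the equivalences, the missing objects are added in stages, and every stage is a left or right
Kan extension along a fully faithful functor (`RestrictsTo.of_isLim`, `RestrictsTo.of_isColim`). By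
(Der4) its essential image is described by limits or colimits at the new objects, and these are
computed in `Vert n` alone (`isLim_part_iff`, `isColim_part_iff`): an object of `C` under an element
`d` of the poset is reached through some `p k` above `d`, so it is irrelevant for the limit when the
`p k` are already present, and there are no morphisms from `C` to the poset. The lemmas `condOn_*`
show, stage by stage, that being such a limit or colimit amounts to the vanishing of some values and
bicartesianness of some squares. This uses that cartesian and cocartesian squares agree, so that
bicartesian squares can be pasted and cancelled on both sides (`biCart_paste_left`,
`biCart_paste_right`). Starting from the source the stages are: `zero` and `mid`; `c univ`, the
suspension of `src`; the cofibres `c {k}ᶜ`; the `o k`; the `q k`; and the other `c T`, in `n` stages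
(`step_source`). Starting from the sink they are: the `o k`; the `c T`, in `n` stages; `mid`; the
`p k`; `zero`; and `src` (`step_sink`).

Exact morphisms preserve the vanishing conditions and the bicartesian squares, so the diagrams which
satisfy them form a sub-2-functor of `(-)^E`, and restriction to `D⁻` and `D⁺` is a pseudo-natural
transformation on it (`Conditions.res`). A pseudo-natural transformation whose components are
equivalences is an equivalence (`StrongTrans.exists_equivalence`), so that the restriction to `D⁻`
can be inverted and composed with the restriction to `D⁺`.
-/

/-! ### Inverting componentwise equivalences of pseudofunctors -/

namespace CategoryTheory.Pseudofunctor.StrongTrans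

open CategoryTheory.Bicategory

universe w₁ w₂ v₁ v₂ u₁ u₂

variable {B : Type u₁} [Bicategory.{w₁, v₁} B] {C : Type u₂} [Bicategory.{w₂, v₂} C]

/-- Whiskering with an equivalence is injective on 2-morphisms: a 2-morphism is recovered from
its whiskering with the help of the unit. -/
theorem whiskerRight_injective_of_equivalence {a b c : C} (e : a ≌ b) {f g : c ⟶ a} {γ δ : f ⟶ g}
    (h : γ ▷ e.hom = δ ▷ e.hom) : γ = δ := by
  have key : ∀ γ : f ⟶ g, γ = 𝟙 _ ⊗≫ f ◁ e.unit.hom ⊗≫ (γ ▷ e.hom) ▷ e.inv ⊗≫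
      g ◁ e.unit.inv ⊗≫ 𝟙 _ := by
    intro γ
    calc γ = 𝟙 _ ⊗≫ γ ▷ 𝟙 a ⊗≫ g ◁ (e.unit.hom ≫ e.unit.inv) ⊗≫ 𝟙 _ := by
          rw [Iso.hom_inv_id]; bicategory
      _ = 𝟙 _ ⊗≫ (γ ▷ 𝟙 a ≫ g ◁ e.unit.hom) ⊗≫ g ◁ e.unit.inv ⊗≫ 𝟙 _ := by bicategory
      _ = _ := by rw [← whisker_exchange]; bicategory
  rw [key γ, key δ, h]

/-- A form of the triangle identity. -/
theorem unit_inv_whiskerRight {a b : C} (e : a ≌ b) :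
    e.unit.inv ▷ e.hom = 𝟙 _ ⊗≫ e.hom ◁ e.counit.hom ⊗≫ 𝟙 _ := by
  rw [← cancel_epi (e.unit.hom ▷ e.hom), ← comp_whiskerRight, Iso.hom_inv_id]
  calc _ = (λ_ e.hom).hom ≫ (ρ_ e.hom).inv ⊗≫ 𝟙 _ := by bicategory
    _ = 𝟙 _ ⊗≫ leftZigzag e.unit.hom e.counit.hom ⊗≫ 𝟙 _ := by
        rw [e.left_triangle_hom]; bicategory
    _ = _ := by dsimp only [leftZigzag]; bicategory

variable {F G : Pseudofunctor B C}

/-- The naturality square of the componentwise inverse of `η`: the mate of that of `η`. -/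
def invNat (η : ∀ b, (F.obj b ≌ G.obj b)) {a b : B} (f : a ⟶ b)
    (n : F.map f ≫ (η b).hom ≅ (η a).hom ≫ G.map f) :
    G.map f ≫ (η b).inv ≅ (η a).inv ≫ F.map f :=
  (λ_ _).symm ≪≫ whiskerRightIso (η a).counit.symm (G.map f ≫ (η b).inv) ≪⊗≫
    whiskerLeftIso (η a).inv (whiskerRightIso n.symm (η b).inv) ≪⊗≫
    whiskerLeftIso ((η a).inv ≫ F.map f) (η b).unit.symm ≪≫ ρ_ _

/-- The characteristic equation of the mate: pasted with the naturality square of `η` it is the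
counit. It determines the mate, by `ext_of_naturality`, and all coherence laws are deduced from it.
-/
theorem invNat_spec (η : ∀ b, (F.obj b ≌ G.obj b)) {a b : B} (f : a ⟶ b)
    (n : F.map f ≫ (η b).hom ≅ (η a).hom ≫ G.map f) :
    (invNat η f n).hom ▷ (η b).hom ⊗≫ (η a).inv ◁ n.hom ⊗≫ (η a).counit.hom ▷ G.map f =
      𝟙 _ ⊗≫ G.map f ◁ (η b).counit.hom ⊗≫ 𝟙 _ := by
  have h1 : (invNat η f n).hom = 𝟙 _ ⊗≫ (η a).counit.inv ▷ (G.map f ≫ (η b).inv) ⊗≫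
      (η a).inv ◁ n.inv ▷ (η b).inv ⊗≫ ((η a).inv ≫ F.map f) ◁ (η b).unit.inv ⊗≫ 𝟙 _ := by
    simp [invNat, bicategoricalComp, bicategoricalIsoComp]
  rw [h1]
  calc _ = 𝟙 _ ⊗≫ (η a).counit.inv ▷ (G.map f ≫ (η b).inv ≫ (η b).hom) ⊗≫
      (η a).inv ◁ n.inv ▷ ((η b).inv ≫ (η b).hom) ⊗≫
        ((η a).inv ≫ F.map f) ◁ ((η b).unit.inv ▷ (η b).hom) ⊗≫
        (η a).inv ◁ n.hom ⊗≫ (η a).counit.hom ▷ G.map f := by bicategory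
    _ = 𝟙 _ ⊗≫ (η a).counit.inv ▷ (G.map f ≫ (η b).inv ≫ (η b).hom) ⊗≫
      (η a).inv ◁ (n.inv ▷ ((η b).inv ≫ (η b).hom) ≫ (F.map f ≫ (η b).hom) ◁ (η b).counit.hom) ⊗≫
        (η a).inv ◁ n.hom ⊗≫ (η a).counit.hom ▷ G.map f := by
          rw [unit_inv_whiskerRight]; bicategory
    _ = 𝟙 _ ⊗≫ ((η a).counit.inv ▷ (G.map f ≫ (η b).inv ≫ (η b).hom) ≫
          ((η a).inv ≫ (η a).hom) ◁ (G.map f ◁ (η b).counit.hom)) ⊗≫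
        (η a).inv ◁ (n.inv ≫ n.hom) ⊗≫ (η a).counit.hom ▷ G.map f := by
          rw [← whisker_exchange]; bicategory
    _ = 𝟙 _ ⊗≫ G.map f ◁ (η b).counit.hom ⊗≫ ((η a).counit.inv ≫ (η a).counit.hom) ▷ G.map f ⊗≫
        𝟙 _ := by
          rw [← whisker_exchange, Iso.inv_hom_id]; bicategory
    _ = _ := by rw [Iso.inv_hom_id]; bicategory

/-- The data which make a 1-morphism `f` an adjoint equivalence. -/
structure EquivData {a b : C} (f : a ⟶ b) where
  /-- The inverse. -/
  inv : b ⟶ a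
  /-- The unit. -/
  unit : 𝟙 a ≅ f ≫ inv
  /-- The counit. -/
  counit : inv ≫ f ≅ 𝟙 b
  left_triangle : leftZigzagIso unit counit = λ_ f ≪≫ (ρ_ f).symm

/-- The equivalence given by `EquivData`. -/
abbrev EquivData.equiv {a b : C} {f : a ⟶ b} (d : EquivData f) : a ≌ b :=
  ⟨f, d.inv, d.unit, d.counit, d.left_triangle⟩

theorem EquivData.nonempty {a b : C} {f : a ⟶ b} (h : ∃ e : a ≌ b, e.hom = f) :
    Nonempty (EquivData f) := by
  obtain ⟨e, rfl⟩ := h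
  exact ⟨⟨e.inv, e.unit, e.counit, e.left_triangle⟩⟩

variable (η : F ⟶ G) (d : ∀ b, EquivData (η.app b))

/-- The naturality square of the componentwise inverse of a strong transformation `η`. -/
abbrev invNatMate {a b : B} (f : a ⟶ b) : G.map f ≫ (d b).inv ≅ (d a).inv ≫ F.map f :=
  invNat (fun b => (d b).equiv) f (η.naturality f)

theorem invNatMate_spec {a b : B} (f : a ⟶ b) :
    (invNatMate η d f).hom ▷ η.app b ⊗≫ (d a).inv ◁ (η.naturality f).hom ⊗≫
      (d a).counit.hom ▷ G.map f =
      𝟙 _ ⊗≫ G.map f ◁ (d b).counit.hom ⊗≫ 𝟙 _ :=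
  invNat_spec (fun b => (d b).equiv) f (η.naturality f)

/-- To compare 2-morphisms into `inv ≫ F.map f`, it suffices to compare them after composition with
the naturality of `η`. -/
theorem ext_of_naturality {a b : B} (f : a ⟶ b) {h : G.obj a ⟶ F.obj b}
    {γ δ : h ⟶ (d a).inv ≫ F.map f}
    (H : γ ▷ η.app b ⊗≫ (d a).inv ◁ (η.naturality f).hom ⊗≫ (d a).counit.hom ▷ G.map f =
      δ ▷ η.app b ⊗≫ (d a).inv ◁ (η.naturality f).hom ⊗≫ (d a).counit.hom ▷ G.map f) :
    γ = δ := by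
  apply whiskerRight_injective_of_equivalence (d b).equiv
  simp only [bicategoricalComp] at H
  exact (cancel_mono _).1 H

/-- The componentwise inverse of a strong transformation all of whose components are
equivalences. -/
def componentwiseInv : G ⟶ F where
  app b := (d b).inv
  naturality f := invNatMate η d f
  naturality_naturality {a b f g} σ := by
    apply ext_of_naturality η d
    calc _ = 𝟙 _ ⊗≫ G.map₂ σ ▷ ((d b).inv ≫ η.app b) ⊗≫ ((invNatMate η d g).hom ▷ η.app b ⊗≫
              (d a).inv ◁ (η.naturality g).hom ⊗≫ (d a).counit.hom ▷ G.map g) := by bicategory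
      _ = 𝟙 _ ⊗≫ (G.map₂ σ ▷ ((d b).inv ≫ η.app b) ≫ G.map g ◁ (d b).counit.hom) ⊗≫ 𝟙 _ := by
            rw [invNatMate_spec]; bicategory
      _ = (𝟙 ((G.map f ≫ (d b).inv) ≫ η.app b) ⊗≫ G.map f ◁ (d b).counit.hom ⊗≫
            𝟙 (𝟙 (G.obj a) ≫ G.map f)) ⊗≫ G.map₂ σ ⊗≫ 𝟙 _ := by
            rw [← whisker_exchange]; bicategory
      _ = 𝟙 _ ⊗≫ (invNatMate η d f).hom ▷ η.app b ⊗≫ (d a).inv ◁ (η.naturality f).hom ⊗≫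
              ((d a).counit.hom ▷ G.map f ≫ 𝟙 _ ◁ G.map₂ σ) ⊗≫ 𝟙 _ := by
            rw [← invNatMate_spec η d f]; bicategory
      _ = 𝟙 _ ⊗≫ (invNatMate η d f).hom ▷ η.app b ⊗≫ (d a).inv ◁ ((η.naturality f).hom ≫
              η.app a ◁ G.map₂ σ) ⊗≫ (d a).counit.hom ▷ G.map g := by
            rw [← whisker_exchange]; bicategory
      _ = _ := by
            rw [← StrongTrans.naturality_naturality]; bicategory
  naturality_id a := by
    rw [← cancel_mono ((d a).inv ◁ (F.mapId a).inv)]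
    apply ext_of_naturality η d
    calc _ = 𝟙 _ ⊗≫ ((invNatMate η d (𝟙 a)).hom ▷ η.app a ⊗≫
              (d a).inv ◁ (((F.mapId a).hom ≫ (F.mapId a).inv) ▷ η.app a) ⊗≫
              (d a).inv ◁ (η.naturality (𝟙 a)).hom ⊗≫ (d a).counit.hom ▷ G.map (𝟙 a)) := by
            bicategory
      _ = 𝟙 _ ⊗≫ ((invNatMate η d (𝟙 a)).hom ▷ η.app a ⊗≫
              (d a).inv ◁ (η.naturality (𝟙 a)).hom ⊗≫ (d a).counit.hom ▷ G.map (𝟙 a)) := by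
            rw [Iso.hom_inv_id]; bicategory
      _ = 𝟙 _ ⊗≫ G.map (𝟙 a) ◁ (d a).counit.hom ⊗≫
            ((G.mapId a).hom ≫ (G.mapId a).inv) ⊗≫ 𝟙 _ := by
            rw [invNatMate_spec, Iso.hom_inv_id]; bicategory
      _ = 𝟙 _ ⊗≫ (G.map (𝟙 a) ◁ (d a).counit.hom ≫ (G.mapId a).hom ▷ _) ⊗≫
            (G.mapId a).inv ⊗≫ 𝟙 _ := by bicategory
      _ = 𝟙 _ ⊗≫ (G.mapId a).hom ▷ ((d a).inv ≫ η.app a) ⊗≫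
            ((d a).counit.hom ▷ _ ≫ _ ◁ (G.mapId a).inv) ⊗≫ 𝟙 _ := by
            rw [whisker_exchange]; bicategory
      _ = 𝟙 _ ⊗≫ (G.mapId a).hom ▷ ((d a).inv ≫ η.app a) ⊗≫
            (d a).inv ◁ ((F.mapId a).inv ▷ η.app a ≫ (F.mapId a).hom ▷ η.app a ≫
              (λ_ (η.app a)).hom ≫ (ρ_ (η.app a)).inv ≫ η.app a ◁ (G.mapId a).inv) ⊗≫
              (d a).counit.hom ▷ G.map (𝟙 a) := by
            rw [← whisker_exchange, ← comp_whiskerRight_assoc, Iso.inv_hom_id]; bicategory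
      _ = _ := by
            rw [← StrongTrans.naturality_id_hom]; bicategory
  naturality_comp {a b c} f g := by
    rw [← cancel_mono ((d a).inv ◁ (F.mapComp f g).inv)]
    apply ext_of_naturality η d
    calc _ = 𝟙 _ ⊗≫ ((invNatMate η d (f ≫ g)).hom ▷ η.app c ⊗≫
              (d a).inv ◁ (((F.mapComp f g).hom ≫ (F.mapComp f g).inv) ▷ η.app c) ⊗≫
              (d a).inv ◁ (η.naturality (f ≫ g)).hom ⊗≫ (d a).counit.hom ▷ G.map (f ≫ g)) := by
            bicategory
      _ = 𝟙 _ ⊗≫ ((invNatMate η d (f ≫ g)).hom ▷ η.app c ⊗≫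
              (d a).inv ◁ (η.naturality (f ≫ g)).hom ⊗≫ (d a).counit.hom ▷ G.map (f ≫ g)) := by
            rw [Iso.hom_inv_id]; bicategory
      _ = 𝟙 _ ⊗≫ G.map (f ≫ g) ◁ (d c).counit.hom ⊗≫
            ((G.mapComp f g).hom ≫ (G.mapComp f g).inv) ⊗≫ 𝟙 _ := by
            rw [invNatMate_spec, Iso.hom_inv_id]; bicategory
      _ = 𝟙 _ ⊗≫ (G.map (f ≫ g) ◁ (d c).counit.hom ≫ (G.mapComp f g).hom ▷ _) ⊗≫
            (G.mapComp f g).inv ⊗≫ 𝟙 _ := by bicategory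
      _ = 𝟙 _ ⊗≫ (G.mapComp f g).hom ▷ ((d c).inv ≫ η.app c) ⊗≫ G.map f ◁
            (𝟙 ((G.map g ≫ (d c).inv) ≫ η.app c) ⊗≫ G.map g ◁ (d c).counit.hom ⊗≫
            𝟙 (𝟙 (G.obj b) ≫ G.map g)) ⊗≫ (G.mapComp f g).inv ⊗≫ 𝟙 _ := by
            rw [whisker_exchange]; bicategory
      _ = 𝟙 _ ⊗≫ (G.mapComp f g).hom ▷ ((d c).inv ≫ η.app c) ⊗≫ G.map f ◁
            ((invNatMate η d g).hom ▷ η.app c ⊗≫ (d b).inv ◁ (η.naturality g).hom) ⊗≫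
            (𝟙 ((G.map f ≫ (d b).inv) ≫ η.app b) ⊗≫ G.map f ◁ (d b).counit.hom ⊗≫
            𝟙 (𝟙 (G.obj a) ≫ G.map f)) ▷ G.map g ⊗≫
            (G.mapComp f g).inv ⊗≫ 𝟙 _ := by
            rw [← invNatMate_spec η d g]; bicategory
      _ = 𝟙 _ ⊗≫ (G.mapComp f g).hom ▷ ((d c).inv ≫ η.app c) ⊗≫ G.map f ◁
            (invNatMate η d g).hom ▷ η.app c ⊗≫
            ((G.map f ≫ (d b).inv) ◁ (η.naturality g).hom ≫
            (invNatMate η d f).hom ▷ (η.app b ≫ G.map g)) ⊗≫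
              (d a).inv ◁ (η.naturality f).hom ▷ G.map g ⊗≫
            ((d a).counit.hom ▷ (G.map f ≫ G.map g) ≫
            𝟙 _ ◁ (G.mapComp f g).inv) ⊗≫ 𝟙 _ := by
            rw [← invNatMate_spec η d f]; bicategory
      _ = 𝟙 _ ⊗≫ (G.mapComp f g).hom ▷ ((d c).inv ≫ η.app c) ⊗≫ G.map f ◁
            (invNatMate η d g).hom ▷ η.app c ⊗≫
            (invNatMate η d f).hom ▷ (F.map g ≫ η.app c) ⊗≫
            (d a).inv ◁ ((F.mapComp f g).inv ▷ η.app c ≫ (F.mapComp f g).hom ▷ η.app c ≫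
              (α_ _ _ _).hom ≫ F.map f ◁ (η.naturality g).hom ≫
              (α_ _ _ _).inv ≫ (η.naturality f).hom ▷ G.map g ≫ (α_ _ _ _).hom ≫
              η.app a ◁ (G.mapComp f g).inv) ⊗≫
            (d a).counit.hom ▷ G.map (f ≫ g) := by
            rw [whisker_exchange (invNatMate η d f).hom, ← whisker_exchange (d a).counit.hom,
              ← comp_whiskerRight_assoc, Iso.inv_hom_id]
            bicategory
      _ = _ := by
            rw [← StrongTrans.naturality_comp_hom]; bicategory

/-- The counit of `componentwiseInv`. -/
def componentwiseCounit : componentwiseInv η d ≫ η ≅ 𝟙 G :=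
  isoMk (fun b => (d b).counit) (fun {a b} f => by
    change G.map f ◁ (d b).counit.hom ≫ (ρ_ (G.map f)).hom ≫ (λ_ (G.map f)).inv =
      ((α_ _ _ _).inv ≫ (invNatMate η d f).hom ▷ η.app b ≫ (α_ _ _ _).hom ≫
        (d a).inv ◁ (η.naturality f).hom ≫ (α_ _ _ _).inv) ≫ (d a).counit.hom ▷ G.map f
    calc _ = (α_ _ _ _).inv ≫ (𝟙 _ ⊗≫ G.map f ◁ (d b).counit.hom ⊗≫ 𝟙 _) := by bicategory
      _ = _ := by rw [← invNatMate_spec η d f]; bicategory)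

/-- A strong transformation whose components are equivalences is itself an equivalence. -/
theorem exists_equivalence (h : ∀ b, ∃ e : F.obj b ≌ G.obj b, e.hom = η.app b) :
    ∃ E : F ≌ G, E.hom = η := by
  let d := fun b => (EquivData.nonempty (h b)).some
  -- The inverse `θ` is a componentwise equivalence as well, so it also has an inverse on the other
  -- side, which is isomorphic to `η`.
  let θ := componentwiseInv η d
  let c : θ ≫ η ≅ 𝟙 G := componentwiseCounit η d
  have h' : ∀ b, ∃ e : G.obj b ≌ F.obj b, e.hom = θ.app b := fun b =>
    ⟨Bicategory.Equivalence.mkOfAdjointifyCounit (d b).counit.symm (d b).unit.symm, rfl⟩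
  let d' := fun b => (EquivData.nonempty (h' b)).some
  let ζ := componentwiseInv θ d'
  let c' : ζ ≫ θ ≅ 𝟙 F := componentwiseCounit θ d'
  let i : η ≅ ζ := (λ_ η).symm ≪≫ whiskerRightIso c'.symm η ≪≫ α_ _ _ _ ≪≫
    whiskerLeftIso ζ c ≪≫ ρ_ ζ
  exact ⟨Bicategory.Equivalence.mkOfAdjointifyCounit (whiskerRightIso i θ ≪≫ c').symm c, rfl⟩

end CategoryTheory.Pseudofunctor.StrongTrans

namespace Prederivator

/-! ### Prederivators as strict 2-functors, on objects -/

section Strict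

variable (D : Prederivator.{w, v, u}) {A B C : (Cat.{w, w})ᵒᵖ}

theorem map_id_obj (X : D.obj A) : (D.map (𝟙 A)).toFunctor.obj X = X := by
  rw [D.map_id]; rfl

theorem map_comp_obj (f : A ⟶ B) (g : B ⟶ C) (X : D.obj A) :
    (D.map (f ≫ g)).toFunctor.obj X = (D.map g).toFunctor.obj ((D.map f).toFunctor.obj X) := by
  rw [D.map_comp]; rfl

theorem mapId_hom_app (X : D.obj A) :
    (D.mapId A).hom.toNatTrans.app X = eqToHom (D.map_id_obj X) := by
  rw [D.mapId_eq_eqToIso]; exact Cat.eqToHom_app _ _ (D.map_id A) X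

theorem mapComp_hom_app (f : A ⟶ B) (g : B ⟶ C) (X : D.obj A) :
    (D.mapComp f g).hom.toNatTrans.app X = eqToHom (D.map_comp_obj f g X) := by
  rw [D.mapComp_eq_eqToIso]; exact Cat.eqToHom_app _ _ (D.map_comp f g) X

theorem mapComp_inv_app (f : A ⟶ B) (g : B ⟶ C) (X : D.obj A) :
    (D.mapComp f g).inv.toNatTrans.app X = eqToHom (D.map_comp_obj f g X).symm := by
  rw [D.mapComp_eq_eqToIso]; exact Cat.eqToHom_app _ _ (D.map_comp f g).symm X

theorem map₂_whiskerLeft_app (f : A ⟶ B) {g h : B ⟶ C} (η : g ⟶ h) (X : D.obj A) :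
    (D.map₂ (f ◁ η)).toNatTrans.app X = eqToHom (D.map_comp_obj f g X) ≫
      (D.map₂ η).toNatTrans.app ((D.map f).toFunctor.obj X) ≫
        eqToHom (D.map_comp_obj f h X).symm := by
  rw [D.map₂_whisker_left, ← D.mapComp_hom_app, ← D.mapComp_inv_app]; rfl

theorem map₂_whiskerRight_app {f g : A ⟶ B} (η : f ⟶ g) (h : B ⟶ C) (X : D.obj A) :
    (D.map₂ (η ▷ h)).toNatTrans.app X = eqToHom (D.map_comp_obj f h X) ≫
      (D.map h).toFunctor.map ((D.map₂ η).toNatTrans.app X) ≫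
        eqToHom (D.map_comp_obj g h X).symm := by
  rw [D.map₂_whisker_right, ← D.mapComp_hom_app, ← D.mapComp_inv_app]; rfl

end Strict

/-! ### Restriction along a functor, as a morphism of shifts -/

section ShiftRes

variable (D : Prederivator.{w, v, u}) {K L : Type w} [SmallCategory K] [SmallCategory L] (p : L ⥤ K)

/-- The 1-cell `p × A` of `Catᵒᵖ`. -/
abbrev timesLeft (A : (Cat.{w, w})ᵒᵖ) : timesObj K A ⟶ timesObj L A :=
  (p.prod (𝟭 A.unop)).toCatHom.op

theorem timesMap₂_timesLeft {A A' : (Cat.{w, w})ᵒᵖ} {f g : A ⟶ A'} (σ : f ⟶ g) :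
    timesMap₂ K σ ▷ timesLeft p A' = timesLeft p A ◁ timesMap₂ L σ := by
  apply congrArg Bicategory.Opposite.op2
  apply Cat.Hom₂.ext
  apply NatTrans.ext
  funext x
  exact Prod.ext (p.map_id _).symm rfl

/-- The morphism `p^* : D^K ⟶ D^L`. -/
def shiftRes : D.shift K ⟶ D.shift L where
  app A := D.map (timesLeft p A)
  naturality {A A'} f := (D.mapComp (timesMap K f) (timesLeft p A')).symm ≪≫
    D.mapComp (timesLeft p A) (timesMap L f)
  naturality_naturality {A A' f g} σ := by
    refine Cat.Hom₂.ext (NatTrans.ext (funext fun (X : D.obj (timesObj K A)) => ?_))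
    have h := congrArg (fun t => (D.map₂ t).toNatTrans.app X) (timesMap₂_timesLeft p σ)
    beta_reduce at h
    rw [map₂_whiskerLeft_app, map₂_whiskerRight_app] at h
    change (D.map (timesLeft p A')).toFunctor.map ((D.map₂ (timesMap₂ K σ)).toNatTrans.app X) ≫
      (D.mapComp (timesMap K g) (timesLeft p A')).inv.toNatTrans.app X ≫
        (D.mapComp (timesLeft p A) (timesMap L g)).hom.toNatTrans.app X =
      ((D.mapComp (timesMap K f) (timesLeft p A')).inv.toNatTrans.app X ≫
        (D.mapComp (timesLeft p A) (timesMap L f)).hom.toNatTrans.app X) ≫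
      (D.map₂ (timesMap₂ L σ)).toNatTrans.app _
    simp only [mapComp_hom_app, mapComp_inv_app]
    rw [eqToHom_comp_iff] at h
    simp only [← Category.assoc] at h
    rw [comp_eqToHom_iff] at h
    rw [← Category.assoc, comp_eqToHom_iff, comp_eqToHom_iff, h]
  naturality_id A := by
    refine Cat.Hom₂.ext (NatTrans.ext (funext fun (X : D.obj (timesObj K A)) => ?_))
    change ((D.mapComp (timesMap K (𝟙 A)) (timesLeft p A)).inv.toNatTrans.app X ≫
      (D.mapComp (timesLeft p A) (timesMap L (𝟙 A))).hom.toNatTrans.app X) ≫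
        (D.mapId (timesObj L A)).hom.toNatTrans.app ((D.map (timesLeft p A)).toFunctor.obj X) =
      (D.map (timesLeft p A)).toFunctor.map ((D.mapId (timesObj K A)).hom.toNatTrans.app X) ≫
        𝟙 _ ≫ 𝟙 _
    simp only [mapComp_hom_app, mapComp_inv_app, mapId_hom_app, eqToHom_map, Category.comp_id,
      eqToHom_trans]
    exact eqToHom_trans _ _
  naturality_comp {A A' A''} f g := by
    refine Cat.Hom₂.ext (NatTrans.ext (funext fun (X : D.obj (timesObj K A)) => ?_))
    change ((D.mapComp (timesMap K (f ≫ g)) (timesLeft p A'')).inv.toNatTrans.app X ≫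
      (D.mapComp (timesLeft p A) (timesMap L (f ≫ g))).hom.toNatTrans.app X) ≫
        (D.mapComp (timesMap L f) (timesMap L g)).hom.toNatTrans.app
          ((D.map (timesLeft p A)).toFunctor.obj X) =
      (D.map (timesLeft p A'')).toFunctor.map
          ((D.mapComp (timesMap K f) (timesMap K g)).hom.toNatTrans.app X) ≫ 𝟙 _ ≫
      ((D.mapComp (timesMap K g) (timesLeft p A'')).inv.toNatTrans.app
        ((D.map (timesMap K f)).toFunctor.obj X) ≫
      (D.mapComp (timesLeft p A') (timesMap L g)).hom.toNatTrans.app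
        ((D.map (timesMap K f)).toFunctor.obj X)) ≫ 𝟙 _ ≫
      (D.map (timesMap L g)).toFunctor.map
        ((D.mapComp (timesMap K f) (timesLeft p A')).inv.toNatTrans.app X ≫
      (D.mapComp (timesLeft p A) (timesMap L f)).hom.toNatTrans.app X) ≫ 𝟙 _
    simp only [mapComp_hom_app, mapComp_inv_app, eqToHom_map, Category.comp_id, Category.id_comp,
      eqToHom_trans]
    exact eqToHom_trans _ _

end ShiftRes

section StrongTransApp

variable {D E : Prederivator.{w, v, u}} (F : D ⟶ E) {A B C : (Cat.{w, w})ᵒᵖ}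

/-- The naturality isomorphism of a morphism of prederivators, on objects. -/
def natIso (f : A ⟶ B) (X : D.obj A) :
    (F.app B).toFunctor.obj ((D.map f).toFunctor.obj X) ≅
      (E.map f).toFunctor.obj ((F.app A).toFunctor.obj X) :=
  (Cat.Hom.toNatIso (F.naturality f)).app X

theorem natIso_naturality (f : A ⟶ B) {X Y : D.obj A} (g : X ⟶ Y) :
    (F.app B).toFunctor.map ((D.map f).toFunctor.map g) ≫ (natIso F f Y).hom =
      (natIso F f X).hom ≫ (E.map f).toFunctor.map ((F.app A).toFunctor.map g) :=
  (F.naturality f).hom.toNatTrans.naturality g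

theorem natIso_map₂ {f g : A ⟶ B} (σ : f ⟶ g) (X : D.obj A) :
    (F.app B).toFunctor.map ((D.map₂ σ).toNatTrans.app X) ≫ (natIso F g X).hom =
      (natIso F f X).hom ≫ (E.map₂ σ).toNatTrans.app ((F.app A).toFunctor.obj X) :=
  congrArg (fun t => t.toNatTrans.app X) (F.naturality_naturality σ)

theorem natIso_comp (f : A ⟶ B) (g : B ⟶ C) (X : D.obj A) :
    (natIso F (f ≫ g) X).hom ≫ eqToHom (E.map_comp_obj f g _) =
      (F.app C).toFunctor.map (eqToHom (D.map_comp_obj f g X)) ≫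
        (natIso F g ((D.map f).toFunctor.obj X)).hom ≫
          (E.map g).toFunctor.map (natIso F f X).hom := by
  have h := congrArg (fun t => t.toNatTrans.app X) (F.naturality_comp f g)
  change (natIso F (f ≫ g) X).hom ≫ (E.mapComp f g).hom.toNatTrans.app _ =
    (F.app C).toFunctor.map ((D.mapComp f g).hom.toNatTrans.app X) ≫ 𝟙 _ ≫
      (natIso F g ((D.map f).toFunctor.obj X)).hom ≫ 𝟙 _ ≫
          (E.map g).toFunctor.map (natIso F f X).hom ≫ 𝟙 _ at h
  simpa only [mapComp_hom_app, Category.comp_id, Category.id_comp] using h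

end StrongTransApp

section ShiftResNat

variable {D E : Prederivator.{w, v, u}} {K L : Type w} [SmallCategory K] [SmallCategory L]
  (p : L ⥤ K)

theorem square_of_factorizations {𝒳 : Type u} [Category.{v} 𝒳] {P Q P₁ P₂ P₁' P₂' R₁ R₂ : 𝒳}
    {n : P ⟶ Q} (i₁ : P ≅ P₁) (a : P₁ ≅ P₂) {b : P₂ ⟶ R₁} (i₂ : P ≅ P₁') {c : P₁' ⟶ P₂'}
    (d : P₂' ≅ R₂) (e₁ : Q ≅ R₁) (e₂ : Q ≅ R₂) (h₁ : n ≫ e₁.hom = i₁.hom ≫ a.hom ≫ b)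
    (h₂ : n ≫ e₂.hom = i₂.hom ≫ c ≫ d.hom) :
    a.inv ≫ (i₁.inv ≫ i₂.hom) ≫ c = (b ≫ e₁.inv ≫ e₂.hom) ≫ d.inv := by
  have h₃ : n = i₁.hom ≫ a.hom ≫ b ≫ e₁.inv := by
    rw [← cancel_mono e₁.hom, h₁]; simp
  have h₄ : i₂.hom ≫ c = n ≫ e₂.hom ≫ d.inv := by
    rw [reassoc_of% h₂]; simp
  rw [Category.assoc, h₄, h₃]
  simp

/-- The compatibility of `p^*` with a morphism of prederivators. -/
def shiftResNat (F : D ⟶ E) : shiftMap K F ≫ E.shiftRes p ≅ D.shiftRes p ≫ shiftMap L F :=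
  Pseudofunctor.StrongTrans.isoMk
    (fun A => (Pseudofunctor.StrongTrans.naturality F (timesLeft p A)).symm) (fun {A A'} f => by
      refine Cat.Hom₂.ext (NatTrans.ext (funext fun (X : D.obj (timesObj K A)) => ?_))
      have h1 := natIso_comp F (timesMap K f) (timesLeft p A') X
      have h2 := natIso_comp F (timesLeft p A) (timesMap L f) X
      change (natIso F (timesLeft p A') ((D.map (timesMap K f)).toFunctor.obj X)).inv ≫
          (𝟙 _ ≫ (F.app (timesObj L A')).toFunctor.map
          ((D.mapComp (timesMap K f) (timesLeft p A')).inv.toNatTrans.app X ≫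
            (D.mapComp (timesLeft p A) (timesMap L f)).hom.toNatTrans.app X) ≫ 𝟙 _ ≫
        (natIso F (timesMap L f) ((D.map (timesLeft p A)).toFunctor.obj X)).hom ≫ 𝟙 _) =
        (𝟙 _ ≫ (E.map (timesLeft p A')).toFunctor.map (natIso F (timesMap K f) X).hom ≫ 𝟙 _ ≫
          ((E.mapComp (timesMap K f) (timesLeft p A')).inv.toNatTrans.app
            ((F.app (timesObj K A)).toFunctor.obj X) ≫
            (E.mapComp (timesLeft p A) (timesMap L f)).hom.toNatTrans.app
              ((F.app (timesObj K A)).toFunctor.obj X)) ≫ 𝟙 _) ≫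
          (E.map (timesMap L f)).toFunctor.map (natIso F (timesLeft p A) X).inv
      rw [mapComp_inv_app, mapComp_hom_app, mapComp_inv_app, mapComp_hom_app]
      simp only [Category.id_comp, Category.comp_id]
      rw [Functor.map_comp]
      refine square_of_factorizations (n := (natIso F (timesMap K f ≫ timesLeft p A') X).hom)
        (b := (E.map (timesLeft p A')).toFunctor.map (natIso F (timesMap K f) X).hom) ((F.app _).toFunctor.mapIso
          (eqToIso (D.map_comp_obj (timesMap K f) (timesLeft p A') X)))
        (natIso F (timesLeft p A') ((D.map (timesMap K f)).toFunctor.obj X))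
        ((F.app _).toFunctor.mapIso (eqToIso (D.map_comp_obj (timesLeft p A) (timesMap L f) X)))
        ((E.map (timesMap L f)).toFunctor.mapIso (natIso F (timesLeft p A) X))
        (eqToIso (E.map_comp_obj (timesMap K f) (timesLeft p A') _))
        (eqToIso (E.map_comp_obj (timesLeft p A) (timesMap L f) _)) h1 h2)

end ShiftResNat

end Prederivator

namespace CategoryTheory.Pseudofunctor.ObjectProperty

theorem lift_congr {𝒞 𝒟 : Type*} [Category* 𝒞] [Category* 𝒟]
    (P : CategoryTheory.ObjectProperty 𝒟) {F G : 𝒞 ⥤ 𝒟}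
    (h : F = G) (hF : ∀ X, P (F.obj X)) (hG : ∀ X, P (G.obj X)) : P.lift F hF = P.lift G hG := by
  subst h; rfl

theorem eqToIso_hom_app {𝒞 𝒟 : Cat.{v, u}} {P : CategoryTheory.ObjectProperty 𝒟}
    (F G : 𝒞 ⟶ Cat.of P.FullSubcategory) (h : F = G) (X : 𝒞) :
    ((eqToIso h).hom.toNatTrans.app X).hom =
      eqToHom (congrArg (fun t : 𝒞 ⟶ Cat.of P.FullSubcategory => (t.toFunctor.obj X).obj) h) := by
  subst h; rfl

universe w₁ v₁ u₁

/-- The full sub-2-functor of a strict 2-functor to `Cat` given by a property of objects. -/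
def strictFullsubcategory {B : Type u₁} [Bicategory.{w₁, v₁} B]
    (F : StrictPseudofunctor B Cat.{v, u}) (P : F.toPseudofunctor.ObjectProperty)
    [P.IsClosedUnderMapObj] : StrictPseudofunctor B Cat.{v, u} where
  toPseudofunctor := P.fullsubcategory
  map_id A := Cat.ext (lift_congr _
    (F := CategoryTheory.ObjectProperty.ι _ ⋙ (F.map (𝟙 A)).toFunctor)
    (G := CategoryTheory.ObjectProperty.ι _) (by rw [F.map_id]; rfl) _ (fun X => X.property))
  mapId_eq_eqToIso A := by
    refine Iso.ext (Cat.Hom₂.ext (NatTrans.ext (funext fun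
      (X : (P.prop A).FullSubcategory) => CategoryTheory.ObjectProperty.hom_ext _ ?_)))
    refine Eq.trans ?_ (eqToIso_hom_app (P.fullsubcategory.map (𝟙 A))
      (𝟙 (Cat.of (P.prop A).FullSubcategory)) _ X).symm
    change (F.mapId A).hom.toNatTrans.app X.obj = _
    rw [F.mapId_eq_eqToIso]
    exact Cat.eqToHom_app _ _ (F.map_id A) X.obj
  map_comp {A B C} f g := Cat.ext (lift_congr _
    (F := CategoryTheory.ObjectProperty.ι _ ⋙ (F.map (f ≫ g)).toFunctor)
    (G := CategoryTheory.ObjectProperty.ι _ ⋙ (F.map f).toFunctor ⋙ (F.map g).toFunctor)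
    (by rw [F.map_comp]; rfl) _ (fun X => P.map_obj (P.map_obj X.2 f) g))
  mapComp_eq_eqToIso {A B C} f g := by
    refine Iso.ext (Cat.Hom₂.ext (NatTrans.ext (funext fun
      (X : (P.prop A).FullSubcategory) => CategoryTheory.ObjectProperty.hom_ext _ ?_)))
    refine Eq.trans ?_ (eqToIso_hom_app (P.fullsubcategory.map (f ≫ g))
      ((P.fullsubcategory.map f ≫ P.fullsubcategory.map g :
        P.fullsubcategory.obj A ⟶ Cat.of (P.prop C).FullSubcategory)) _ X).symm
    change (F.mapComp f g).hom.toNatTrans.app X.obj = _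
    rw [F.mapComp_eq_eqToIso]
    exact Cat.eqToHom_app _ _ (F.map_comp f g) X.obj

end CategoryTheory.Pseudofunctor.ObjectProperty

namespace Prederivator

/-! ### The sub-2-functors of `(-)^K` defined by exactness conditions -/

/-- The functor `K ⥤ K × A` given by an object of `A`. -/
abbrev slot (K : Type w) [SmallCategory K] {A : Type w} [SmallCategory A] (a : A) : K ⥤ K × A :=
  CategoryTheory.Prod.sectL K a

section Sub

variable (D : Prederivator.{w, v, u}) {K : Type w} [SmallCategory K]
  (T : ObjectProperty (D.Diag K))

/-- The objects of `D^K` whose values at all objects satisfy `T`. -/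
def subProp : (D.shift K).toPseudofunctor.ObjectProperty where
  prop A X := ∀ a : A.unop, T ((D.res (slot K a)).obj X)

theorem res_timesMap {A B : (Cat.{w, w})ᵒᵖ} (f : A ⟶ B) (b : B.unop) (X : D.obj (timesObj K A)) :
    (D.res (slot K b)).obj ((D.map (timesMap K f)).toFunctor.obj X) =
      (D.res (slot K (f.unop.toFunctor.obj b))).obj X := by
  have h : slot K b ⋙ (𝟭 K).prod f.unop.toFunctor = slot K (f.unop.toFunctor.obj b) :=
    Functor.hext (fun _ => rfl) (fun k k' g =>
      heq_of_eq (Prod.ext rfl (f.unop.toFunctor.map_id b)))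
  rw [← h]
  exact (D.map_comp_obj (timesMap K f) (slot K b).toCatHom.op X).symm

instance : (subProp D T).IsClosedUnderMapObj where
  map_obj {A B X} hX f b := by
    exact (congrArg T (D.res_timesMap f b X)).mpr (hX _)

/-- The prederivator of objects of `D^K` whose values at all objects satisfy `T`. -/
def sub : Prederivator.{w, v, u} :=
  Pseudofunctor.ObjectProperty.strictFullsubcategory (D.shift K) (subProp D T)

/-- The inclusion in `D^K`. -/
def subInc : D.sub T ⟶ D.shift K := (subProp D T).ι

variable {D} {T} {E : Prederivator.{w, v, u}} {T' : ObjectProperty (E.Diag K)}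
  [T'.IsClosedUnderIsomorphisms]

theorem sub_map_obj (F : D ⟶ E) (hF : ∀ X, T X → T' ((component F K).obj X))
    (A : (Cat.{w, w})ᵒᵖ) (X : D.obj (timesObj K A)) (hX : (subProp D T).prop A X) :
    (subProp E T').prop A ((F.app (timesObj K A)).toFunctor.obj X) := fun a =>
  T'.prop_of_iso (natIso F (slot K a).toCatHom.op X) (hF _ (hX a))

/-- The morphism of sub-prederivators induced by a morphism which preserves the conditions. -/
def subMap (F : D ⟶ E) (hF : ∀ X, T X → T' ((component F K).obj X)) : D.sub T ⟶ E.sub T' where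
  app A := Cat.Hom.ofFunctor (((subProp E T').prop A).lift
    (((subProp D T).prop A).ι ⋙ (F.app (timesObj K A)).toFunctor)
    (fun X => sub_map_obj F hF A X.obj X.property))
  naturality {A B} f := Cat.Hom.isoMk (NatIso.ofComponents
    (fun X => ((subProp E T').prop B).isoMk (natIso F (timesMap K f) X.obj))
    (fun {X Y} g => ObjectProperty.hom_ext _ (natIso_naturality F (timesMap K f) g.hom)))
  naturality_naturality {A B f g} σ := by
    refine Cat.Hom₂.ext (NatTrans.ext (funext fun
      (X : ((subProp D T).prop A).FullSubcategory) => ObjectProperty.hom_ext _ ?_))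
    exact natIso_map₂ F (timesMap₂ K σ) X.obj
  naturality_id A := by
    refine Cat.Hom₂.ext (NatTrans.ext (funext fun
      (X : ((subProp D T).prop A).FullSubcategory) => ObjectProperty.hom_ext _ ?_))
    exact congrArg (fun t => t.toNatTrans.app X.obj) (F.naturality_id (timesObj K A))
  naturality_comp {A B C} f g := by
    refine Cat.Hom₂.ext (NatTrans.ext (funext fun
      (X : ((subProp D T).prop A).FullSubcategory) => ObjectProperty.hom_ext _ ?_))
    exact congrArg (fun t => t.toNatTrans.app X.obj) (F.naturality_comp (timesMap K f) (timesMap K g))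

/-- The modification of morphisms of sub-prederivators induced by a modification. -/
def subMap₂ {F G : D ⟶ E} (hF : ∀ X, T X → T' ((component F K).obj X))
    (hG : ∀ X, T X → T' ((component G K).obj X)) (σ : F ⟶ G) : subMap F hF ⟶ subMap G hG :=
  Pseudofunctor.StrongTrans.Hom.of
    { app := fun A => NatTrans.toCatHom₂
        { app := fun X => ObjectProperty.homMk
            (((Pseudofunctor.StrongTrans.Hom.as σ).app (timesObj K A)).toNatTrans.app X.obj)
          naturality := fun X Y g => ObjectProperty.hom_ext _
            (((Pseudofunctor.StrongTrans.Hom.as σ).app (timesObj K A)).toNatTrans.naturality g.hom) }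
      naturality := fun {A B} f => by
        refine Cat.Hom₂.ext (NatTrans.ext (funext fun
          (X : ((subProp D T).prop A).FullSubcategory) => ObjectProperty.hom_ext _ ?_))
        exact congrArg (fun t => t.toNatTrans.app X.obj)
          ((Pseudofunctor.StrongTrans.Hom.as σ).naturality (timesMap K f)) }

end Sub

end Prederivator

namespace StableDerivator

/-- A family of conditions on the objects of `D(K)`, for all stable derivators `D`, which is
invariant under isomorphisms and under exact morphisms. -/
structure Conditions (K : Type w) [SmallCategory K] where
  /-- The conditions. -/
  prop (D : StableDerivator.{w, v, u}) : ObjectProperty (D.toPrederivator.Diag K)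
  iso (D : StableDerivator.{w, v, u}) : (prop D).IsClosedUnderIsomorphisms
  map {D E : StableDerivator.{w, v, u}} (F : D ⟶ E) (X : D.toPrederivator.Diag K) :
    prop D X → prop E ((component F.hom K).obj X)

attribute [instance] Conditions.iso

variable {K : Type w} [SmallCategory K] (T : Conditions.{w, v, u} K)

/-- The sub-2-functor of `(-)^K` given by a family of conditions. -/
def Conditions.sub : Pseudofunctor StableDerivator.{w, v, u} Prederivator.{w, v, u} where
  obj D := D.toPrederivator.sub (T.prop D)
  map F := subMap F.hom (T.map F)
  map₂ {D E F G} σ := subMap₂ (T.map F) (T.map G) σ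
  mapId D := Iso.refl (𝟙 (D.toPrederivator.sub (T.prop D)))
  mapComp F G := Iso.refl (subMap F.hom (T.map F) ≫ subMap G.hom (T.map G))
  map₂_id F := rfl
  map₂_comp σ τ := rfl
  map₂_whisker_left F _ _ η := by
    refine Eq.symm ((Category.id_comp _).trans ?_)
    exact Category.comp_id _
  map₂_whisker_right η F := by
    refine Eq.symm ((Category.id_comp _).trans ?_)
    exact Category.comp_id _
  map₂_left_unitor {D E} F := by
    refine Eq.symm ((Category.id_comp _).trans ?_)
    refine Eq.trans (congrArg (· ≫ _) (Bicategory.id_whiskerRight _ _)) ?_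
    exact Category.id_comp _
  map₂_right_unitor F := by
    refine Eq.symm ((Category.id_comp _).trans ?_)
    refine Eq.trans (congrArg (· ≫ _) (Bicategory.whiskerLeft_id _ _)) ?_
    exact Category.id_comp _
  map₂_associator F G H := by
    refine Eq.symm ((Category.id_comp _).trans ?_)
    refine Eq.trans (congrArg (· ≫ _) (Bicategory.id_whiskerRight _ _)) ?_
    refine (Category.id_comp _).trans ?_
    refine Eq.trans (congrArg (_ ≫ ·) (Category.comp_id _)) ?_
    refine Eq.trans (congrArg (_ ≫ ·) (Bicategory.whiskerLeft_id _ _)) ?_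
    exact Category.comp_id _

/-- The inclusion of the sub-2-functor in `(-)^K`. -/
def Conditions.inc : T.sub ⟶ (StableDerivator.shift.{w, v, u} K).toPseudofunctor where
  app D := subInc D.toPrederivator (T.prop D)
  naturality {D E} F := Pseudofunctor.StrongTrans.isoMk (fun A => Iso.refl _) (fun {A B} f => by
    refine Cat.Hom₂.ext (NatTrans.ext (funext fun
      (X : ((subProp D.toPrederivator (T.prop D)).prop A).FullSubcategory) => ?_))
    change 𝟙 _ ≫ (𝟙 _ ≫ (F.hom.app (timesObj K B)).toFunctor.map (𝟙 _) ≫ 𝟙 _ ≫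
      (natIso F.hom (timesMap K f) X.obj).hom ≫ 𝟙 _) =
      (𝟙 _ ≫ (natIso F.hom (timesMap K f) X.obj).hom ≫ 𝟙 _ ≫ 𝟙 _ ≫ 𝟙 _) ≫
        (E.toPrederivator.map (timesMap K f)).toFunctor.map (𝟙 _)
    simp only [CategoryTheory.Functor.map_id, Category.id_comp, Category.comp_id])
  naturality_naturality {D E F G} σ := by
    refine Pseudofunctor.StrongTrans.homCategory.ext (fun A => ?_)
    refine Cat.Hom₂.ext (NatTrans.ext (funext fun
      (X : ((subProp D.toPrederivator (T.prop D)).prop A).FullSubcategory) => ?_))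
    exact (Category.comp_id _).trans (Category.id_comp _).symm
  naturality_id D := by
    refine Pseudofunctor.StrongTrans.homCategory.ext (fun A => ?_)
    refine Cat.Hom₂.ext (NatTrans.ext (funext fun
      (X : ((subProp D.toPrederivator (T.prop D)).prop A).FullSubcategory) => ?_))
    exact congrArg (𝟙 _ ≫ ·) (Category.id_comp _).symm
  naturality_comp {D E E'} F G := by
    refine Pseudofunctor.StrongTrans.homCategory.ext (fun A => ?_)
    refine Cat.Hom₂.ext (NatTrans.ext (funext fun
      (X : ((subProp D.toPrederivator (T.prop D)).prop A).FullSubcategory) => ?_))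
    change 𝟙 _ ≫ 𝟙 _ = 𝟙 _ ≫ 𝟙 _ ≫ 𝟙 _ ≫ 𝟙 _ ≫ (G.hom.app (timesObj K A)).toFunctor.map (𝟙 _) ≫ 𝟙 _
    simp only [Category.id_comp, Category.comp_id]
    exact ((G.hom.app (timesObj K A)).toFunctor.map_id _).symm

theorem natIso_comp_hom {D E E' : Prederivator.{w, v, u}} (F : D ⟶ E) (G : E ⟶ E')
    {A B : (Cat.{w, w})ᵒᵖ} (f : A ⟶ B) (X : D.obj A) :
    (natIso (F ≫ G) f X).hom = (G.app B).toFunctor.map (natIso F f X).hom ≫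
      (natIso G f ((F.app A).toFunctor.obj X)).hom := by
  change 𝟙 _ ≫ (G.app B).toFunctor.map (natIso F f X).hom ≫ 𝟙 _ ≫
      (natIso G f ((F.app A).toFunctor.obj X)).hom ≫ 𝟙 _ = _
  simp only [Category.id_comp, Category.comp_id]

theorem square_inv {𝒳 : Type*} [Category* 𝒳] {X X' Y Y' : 𝒳} (a : X ≅ Y) (b : X' ≅ Y')
    {f : X ⟶ X'} {g : Y ⟶ Y'} (h : f ≫ b.hom = a.hom ≫ g) : g ≫ b.inv = a.inv ≫ f := by
  rw [Iso.comp_inv_eq, Category.assoc, h, Iso.inv_hom_id_assoc]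

theorem inv_of_comp {𝒳 : Type*} [Category* 𝒳] {X Y Z : 𝒳} (a : X ≅ Z) (b : X ≅ Y) (c : Y ≅ Z)
    (h : a.hom = b.hom ≫ c.hom) : a.inv = c.inv ≫ b.inv := by
  have : a = b ≪≫ c := Iso.ext h
  rw [this, Iso.trans_inv]

/-- Restriction along `p : L ⥤ K`, as a transformation `(-)^K ⟶ (-)^L`. -/
def resTrans {L : Type w} [SmallCategory L] (p : L ⥤ K) :
    (StableDerivator.shift.{w, v, u} K).toPseudofunctor ⟶
      (StableDerivator.shift.{w, v, u} L).toPseudofunctor where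
  app D := D.toPrederivator.shiftRes p
  naturality F := shiftResNat p F.hom
  naturality_naturality {D E F G} σ := by
    refine Pseudofunctor.StrongTrans.homCategory.ext (fun A => ?_)
    refine Cat.Hom₂.ext (NatTrans.ext (funext fun
      (X : D.toPrederivator.obj (timesObj K A)) => ?_))
    have h : ((Pseudofunctor.StrongTrans.Hom.as σ).app (timesObj L A)).toNatTrans.app
          ((D.toPrederivator.map (timesLeft p A)).toFunctor.obj X) ≫
        (natIso G.hom (timesLeft p A) X).hom = (natIso F.hom (timesLeft p A) X).hom ≫
          (E.toPrederivator.map (timesLeft p A)).toFunctor.map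
            (((Pseudofunctor.StrongTrans.Hom.as σ).app (timesObj K A)).toNatTrans.app X) :=
      congrArg (fun t => t.toNatTrans.app X)
        ((Pseudofunctor.StrongTrans.Hom.as σ).naturality (timesLeft p A))
    exact square_inv (natIso F.hom (timesLeft p A) X) (natIso G.hom (timesLeft p A) X) h
  naturality_id D := by
    refine Pseudofunctor.StrongTrans.homCategory.ext (fun A => ?_)
    refine Cat.Hom₂.ext (NatTrans.ext (funext fun
      (X : D.toPrederivator.obj (timesObj K A)) => ?_))
    change (𝟙 _ ≫ 𝟙 _) ≫ 𝟙 _ =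
      (D.toPrederivator.map (timesLeft p A)).toFunctor.map (𝟙 _) ≫ 𝟙 _ ≫ 𝟙 _
    simp only [Category.comp_id]
    exact ((D.toPrederivator.map (timesLeft p A)).toFunctor.map_id _).symm
  naturality_comp {D E E'} F G := by
    refine Pseudofunctor.StrongTrans.homCategory.ext (fun A => ?_)
    refine Cat.Hom₂.ext (NatTrans.ext (funext fun
      (X : D.toPrederivator.obj (timesObj K A)) => ?_))
    change (natIso (F.hom ≫ G.hom) (timesLeft p A) X).inv ≫ 𝟙 _ =
      (E'.toPrederivator.map (timesLeft p A)).toFunctor.map (𝟙 _) ≫ 𝟙 _ ≫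
      (natIso G.hom (timesLeft p A) ((F.hom.app (timesObj K A)).toFunctor.obj X)).inv ≫ 𝟙 _ ≫
        (G.hom.app _).toFunctor.map (natIso F.hom (timesLeft p A) X).inv ≫ 𝟙 _
    simp only [Category.id_comp, Category.comp_id]
    refine Eq.trans ?_ ((congrArg (· ≫ _)
      ((E'.toPrederivator.map (timesLeft p A)).toFunctor.map_id _)).trans
        (Category.id_comp _)).symm
    exact inv_of_comp (natIso (F.hom ≫ G.hom) (timesLeft p A) X)
      ((G.hom.app _).toFunctor.mapIso (natIso F.hom (timesLeft p A) X))
      (natIso G.hom (timesLeft p A) ((F.hom.app (timesObj K A)).toFunctor.obj X))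
      (natIso_comp_hom F.hom G.hom (timesLeft p A) X)

/-- Restriction to `D^L` of the objects of `D^K` which satisfy the conditions. -/
def Conditions.res {L : Type w} [SmallCategory L] (p : L ⥤ K) :
    T.sub ⟶ (StableDerivator.shift.{w, v, u} L).toPseudofunctor :=
  T.inc ≫ resTrans p

end StableDerivator

namespace Prederivator

/-! ### Morphisms between restrictions of coherent diagrams -/

section Pull

variable (D : Prederivator.{w, v, u})
variable {J J' J'' K L M : Type w} [SmallCategory J] [SmallCategory J'] [SmallCategory J'']
  [SmallCategory K] [SmallCategory L] [SmallCategory M]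

theorem res_id_obj (X : D.Diag J) : (D.res (𝟭 J)).obj X = X :=
  D.map_id_obj X

theorem res_comp_obj (u : J' ⥤ J) (u' : J ⥤ K) (X : D.Diag K) :
    (D.res (u ⋙ u')).obj X = (D.res u).obj ((D.res u').obj X) :=
  D.map_comp_obj u'.toCatHom.op u.toCatHom.op X

theorem resComp_hom_app (u : J' ⥤ J) (u' : J ⥤ K) (X : D.Diag K) :
    (D.resComp u u').hom.app X = eqToHom (D.res_comp_obj u u' X) :=
  D.mapComp_hom_app u'.toCatHom.op u.toCatHom.op X

theorem resComp_inv_app (u : J' ⥤ J) (u' : J ⥤ K) (X : D.Diag K) :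
    (D.resComp u u').inv.app X = eqToHom (D.res_comp_obj u u' X).symm :=
  D.mapComp_inv_app u'.toCatHom.op u.toCatHom.op X

theorem res_id_map {X Y : D.Diag J} (f : X ⟶ Y) :
    (D.res (𝟭 J)).map f = eqToHom (D.res_id_obj X) ≫ f ≫ eqToHom (D.res_id_obj Y).symm := by
  have h := (D.mapId (op (Cat.of J))).hom.toNatTrans.naturality f
  rw [mapId_hom_app, mapId_hom_app] at h
  rw [← Category.assoc]
  exact (comp_eqToHom_iff _ _ _).1 h

theorem res_comp_map (u : J' ⥤ J) (u' : J ⥤ K) {X Y : D.Diag K} (f : X ⟶ Y) :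
    (D.res (u ⋙ u')).map f = eqToHom (D.res_comp_obj u u' X) ≫
      (D.res u).map ((D.res u').map f) ≫ eqToHom (D.res_comp_obj u u' Y).symm := by
  have h := (D.resComp u u').hom.naturality f
  rw [resComp_hom_app, resComp_hom_app] at h
  rw [← Category.assoc]
  exact (comp_eqToHom_iff _ _ _).1 h

theorem res₂_id_app (u : J ⥤ K) (X : D.Diag K) : (D.res₂ (𝟙 u)).app X = 𝟙 _ :=
  congrArg (fun t => t.toNatTrans.app X) (D.map₂_id u.toCatHom.op)

theorem res₂_comp_app {u u' u'' : J ⥤ K} (α : u ⟶ u') (β : u' ⟶ u'') (X : D.Diag K) :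
    (D.res₂ (α ≫ β)).app X = (D.res₂ α).app X ≫ (D.res₂ β).app X :=
  congrArg (fun t => t.toNatTrans.app X) (D.map₂_comp
    (Bicategory.Opposite.op2 α.toCatHom₂) (Bicategory.Opposite.op2 β.toCatHom₂))

theorem res₂_whiskerLeft_app (u : J' ⥤ J) {c c' : J ⥤ K} (α : c ⟶ c') (X : D.Diag K) :
    (D.res₂ (Functor.whiskerLeft u α)).app X = eqToHom (D.res_comp_obj u c X) ≫
      (D.res u).map ((D.res₂ α).app X) ≫ eqToHom (D.res_comp_obj u c' X).symm :=
  D.map₂_whiskerRight_app (Bicategory.Opposite.op2 α.toCatHom₂) u.toCatHom.op X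

theorem res₂_whiskerRight_app {u u' : J' ⥤ J} (ρ : u ⟶ u') (c : J ⥤ K) (X : D.Diag K) :
    (D.res₂ (Functor.whiskerRight ρ c)).app X = eqToHom (D.res_comp_obj u c X) ≫
      (D.res₂ ρ).app ((D.res c).obj X) ≫ eqToHom (D.res_comp_obj u' c X).symm :=
  D.map₂_whiskerLeft_app c.toCatHom.op (Bicategory.Opposite.op2 ρ.toCatHom₂) X

/-- The restriction along `i` of a morphism `a^* Z ⟶ c^* X`. The equalities `(i ⋙ a)^* = i^* a^*`
are built in, so that no identification of objects is visible in what follows. -/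
def pull (i : J' ⥤ J) {a : J ⥤ L} {c : J ⥤ K} {Z : D.Diag L} {X : D.Diag K}
    (f : (D.res a).obj Z ⟶ (D.res c).obj X) :
    (D.res (i ⋙ a)).obj Z ⟶ (D.res (i ⋙ c)).obj X :=
  eqToHom (D.res_comp_obj i a Z) ≫ (D.res i).map f ≫ eqToHom (D.res_comp_obj i c X).symm

variable {D}
variable (i : J' ⥤ J) {a : J ⥤ L} {c : J ⥤ K} {Z : D.Diag L} {X : D.Diag K}

theorem pull_comp {b : J ⥤ M} {Y : D.Diag M} (f : (D.res a).obj Z ⟶ (D.res b).obj Y)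
    (g : (D.res b).obj Y ⟶ (D.res c).obj X) : D.pull i (f ≫ g) = D.pull i f ≫ D.pull i g := by
  simp [pull]

theorem pull_id : D.pull i (𝟙 ((D.res c).obj X)) = 𝟙 _ := by
  simp [pull]

theorem pull_res₂ {c' : J ⥤ K} (α : c ⟶ c') :
    D.pull i ((D.res₂ α).app X) = (D.res₂ (Functor.whiskerLeft i α)).app X :=
  (res₂_whiskerLeft_app D i α X).symm

theorem pull_pull (j : J'' ⥤ J') (f : (D.res a).obj Z ⟶ (D.res c).obj X) :
    D.pull j (D.pull i f) = (D.pull (j ⋙ i) f : _) := by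
  unfold pull
  rw [D.res_comp_map j i]
  simp only [Functor.map_comp, eqToHom_map, eqToHom_trans, Category.assoc, eqToHom_trans_assoc]

theorem pull_idFunctor (f : (D.res a).obj Z ⟶ (D.res c).obj X) : D.pull (𝟭 J) f = f := by
  unfold pull
  rw [D.res_id_map]
  simp only [eqToHom_trans, Category.assoc, eqToHom_trans_assoc]
  exact (Category.id_comp _).trans (Category.comp_id _)

/-- The interchange law for restriction along functors and 2-cells. -/
theorem res₂_comp_pull {i i' : J' ⥤ J} (ρ : i ⟶ i') (f : (D.res a).obj Z ⟶ (D.res c).obj X) :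
    (D.res₂ (Functor.whiskerRight ρ a)).app Z ≫ D.pull i' f =
      D.pull i f ≫ (D.res₂ (Functor.whiskerRight ρ c)).app X := by
  rw [res₂_whiskerRight_app, res₂_whiskerRight_app]
  simp only [pull, Category.assoc, eqToHom_trans_assoc, eqToHom_refl, Category.id_comp,
    NatTrans.naturality_assoc]

theorem pull_map {Z' : D.Diag L} (g : Z ⟶ Z') : D.pull i ((D.res a).map g) = (D.res (i ⋙ a)).map g :=
  (D.res_comp_map i a g).symm

theorem res₂_naturality {c' : J ⥤ K} (α : c ⟶ c') {Y : D.Diag K} (g : X ⟶ Y) :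
    (D.res c).map g ≫ (D.res₂ α).app Y = (D.res₂ α).app X ≫ (D.res c').map g :=
  (D.res₂ α).naturality g

/-- The identification `(a ⋙ g)^* X ≅ a^* (g^* X)`. -/
def rebase (a : J ⥤ L) (g : L ⥤ K) (X : D.Diag K) :
    (D.res (a ⋙ g)).obj X ≅ (D.res a).obj ((D.res g).obj X) :=
  (D.resComp a g).app X

theorem pull_rebase_hom (a : J ⥤ L) (g : L ⥤ K) (X : D.Diag K) :
    D.pull i (rebase a g X).hom = (rebase (i ⋙ a) g X).hom := by
  simp only [pull, rebase, Iso.app_hom, resComp_hom_app, eqToHom_map, eqToHom_trans]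

theorem pull_rebase_inv (a : J ⥤ L) (g : L ⥤ K) (X : D.Diag K) :
    D.pull i (rebase a g X).inv = (rebase (i ⋙ a) g X).inv := by
  simp only [pull, rebase, Iso.app_inv, resComp_inv_app, eqToHom_map, eqToHom_trans]

theorem rebase_hom_res₂ {a a' : J ⥤ L} (α : a ⟶ a') (g : L ⥤ K) (X : D.Diag K) :
    (rebase a g X).hom ≫ (D.res₂ α).app ((D.res g).obj X) =
      (D.res₂ (Functor.whiskerRight α g)).app X ≫ (rebase a' g X).hom := by
  rw [res₂_whiskerRight_app]
  simp [rebase, resComp_hom_app]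

end Pull

/-- An isomorphism of functors induces isomorphisms of restrictions. -/
def res₂Iso (D : Prederivator.{w, v, u}) {J K : Type w} [SmallCategory J] [SmallCategory K]
    {a c : J ⥤ K} (α : a ≅ c) (X : D.Diag K) : (D.res a).obj X ≅ (D.res c).obj X where
  hom := (D.res₂ α.hom).app X
  inv := (D.res₂ α.inv).app X
  hom_inv_id := by rw [← res₂_comp_app, α.hom_inv_id, res₂_id_app]
  inv_hom_id := by rw [← res₂_comp_app, α.inv_hom_id, res₂_id_app]

/-! ### Kan extensions in a derivator and their pointwise description -/

section Couniversal

variable {𝒱 𝒥 : Type u} [Category.{v} 𝒱] [Category.{v} 𝒥] {L : 𝒱 ⥤ 𝒥} {R : 𝒥 ⥤ 𝒱}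

/-- A morphism `L V ⟶ Y` is couniversal from `L` to `Y` if and only if its transpose is an
isomorphism. -/
theorem bijective_map_comp_iff (adj : L ⊣ R) {V : 𝒱} {Y : 𝒥} (φ : L.obj V ⟶ Y) :
    (∀ Z, Function.Bijective fun f : Z ⟶ V => L.map f ≫ φ) ↔ IsIso (adj.homEquiv V Y φ) := by
  rw [isIso_iff_yoneda_map_bijective]
  refine forall_congr' fun Z => ?_
  rw [← Function.Bijective.of_comp_iff' (adj.homEquiv Z Y).bijective]
  refine Eq.to_iff (congrArg _ (funext fun f => ?_))
  exact adj.homEquiv_naturality_left f φ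

theorem bijective_comp_map_iff (adj : L ⊣ R) {V : 𝒥} {Y : 𝒱} (φ : Y ⟶ R.obj V) :
    (∀ Z, Function.Bijective fun f : V ⟶ Z => φ ≫ R.map f) ↔
      IsIso ((adj.homEquiv Y V).symm φ) := by
  rw [isIso_iff_coyoneda_map_bijective]
  refine forall_congr' fun Z => ?_
  rw [← Function.Bijective.of_comp_iff' (adj.homEquiv Y Z).symm.bijective]
  refine Eq.to_iff (congrArg _ (funext fun f => ?_))
  exact adj.homEquiv_naturality_right_symm φ f

theorem isIso_unit_app_iff_bijective (adj : L ⊣ R) (V : 𝒱) : IsIso (adj.unit.app V) ↔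
    ∀ Z, Function.Bijective fun f : Z ⟶ V => L.map f ≫ 𝟙 (L.obj V) := by
  rw [bijective_map_comp_iff adj, adj.homEquiv_id]

theorem isIso_counit_app_iff_bijective (adj : L ⊣ R) (V : 𝒥) : IsIso (adj.counit.app V) ↔
    ∀ Z, Function.Bijective fun f : V ⟶ Z => 𝟙 (R.obj V) ≫ R.map f := by
  rw [bijective_comp_map_iff adj, adj.homEquiv_symm_id]

theorem bijective_map_comp_congr {V V' : 𝒱} {Y Y' : 𝒥} (a : V' ≅ V) (b : Y ≅ Y')
    {φ : L.obj V ⟶ Y} {φ' : L.obj V' ⟶ Y'} (h : φ' = L.map a.hom ≫ φ ≫ b.hom) :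
    (∀ Z, Function.Bijective fun f : Z ⟶ V => L.map f ≫ φ) ↔
      ∀ Z, Function.Bijective fun f : Z ⟶ V' => L.map f ≫ φ' := by
  refine forall_congr' fun Z => ?_
  rw [← Function.Bijective.of_comp_iff _ a.homToEquiv.bijective,
    ← Function.Bijective.of_comp_iff' b.homToEquiv.bijective]
  refine Eq.to_iff (congrArg _ (funext fun f => ?_))
  simp [h]

theorem bijective_comp_map_congr {V V' : 𝒥} {Y Y' : 𝒱} (a : V' ≅ V) (b : Y ≅ Y')
    {φ : Y ⟶ R.obj V} {φ' : Y' ⟶ R.obj V'} (h : φ = b.hom ≫ φ' ≫ R.map a.hom) :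
    (∀ Z, Function.Bijective fun f : V ⟶ Z => φ ≫ R.map f) ↔
      ∀ Z, Function.Bijective fun f : V' ⟶ Z => φ' ≫ R.map f := by
  refine forall_congr' fun Z => ?_
  rw [← Function.Bijective.of_comp_iff _ a.homFromEquiv.bijective,
    ← Function.Bijective.of_comp_iff' b.homFromEquiv.bijective]
  refine Eq.to_iff (congrArg _ (funext fun f => ?_))
  simp [h]

variable {𝒮 𝒬 : Type u} [Category.{v} 𝒮] [Category.{v} 𝒬] {L' : 𝒮 ⥤ 𝒬} {R' : 𝒬 ⥤ 𝒮}

theorem isIso_map_homEquiv_iff (adj : L ⊣ R) (adj' : L' ⊣ R') {E : 𝒱 ⥤ 𝒮} {Q : 𝒥 ⥤ 𝒬}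
    (α : TwoSquare E L L' Q) [IsIso (CategoryTheory.mateEquiv adj adj' α).natTrans] {V : 𝒱} {Y : 𝒥}
    (φ : L.obj V ⟶ Y) : IsIso (E.map (adj.homEquiv V Y φ)) ↔
      ∀ Z, Function.Bijective fun f : Z ⟶ E.obj V => L'.map f ≫ α.app V ≫ Q.map φ := by
  rw [bijective_map_comp_iff adj']
  have h : IsIso ((CategoryTheory.mateEquiv adj adj' α).app Y) :=
    inferInstanceAs (IsIso ((CategoryTheory.mateEquiv adj adj' α).natTrans.app Y))
  have key : adj'.homEquiv _ _ (α.app V ≫ Q.map φ) =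
      E.map (adj.homEquiv V Y φ) ≫ (CategoryTheory.mateEquiv adj adj' α).app Y := by
    have hn := α.naturality (adj.homEquiv V Y φ)
    rw [← Equiv.eq_symm_apply, adj'.homEquiv_counit, Functor.map_comp, Category.assoc,
 CategoryTheory.mateEquiv_counit]
    refine Eq.trans ?_ (Category.assoc _ _ _)
    refine Eq.trans ?_ (congrArg (· ≫ _) hn.symm)
    refine Eq.trans ?_ (Category.assoc _ _ _).symm
    refine congrArg (α.app V ≫ ·) ?_
    change Q.map φ = Q.map (L.map _) ≫ _
    rw [← Q.map_comp]
    exact congrArg Q.map ((Equiv.symm_apply_apply _ φ).symm.trans (adj.homEquiv_counit V Y _))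
  rw [key]
  exact (isIso_comp_right_iff _ _).symm

theorem isIso_map_homEquiv_symm_iff (adj : L ⊣ R) (adj' : L' ⊣ R') {E : 𝒥 ⥤ 𝒬} {Q : 𝒱 ⥤ 𝒮}
    (α : TwoSquare R E Q R') [IsIso ((CategoryTheory.mateEquiv adj adj').symm α).natTrans] {V : 𝒥} {Y : 𝒱}
    (φ : Y ⟶ R.obj V) : IsIso (E.map ((adj.homEquiv Y V).symm φ)) ↔
      ∀ Z, Function.Bijective fun f : E.obj V ⟶ Z => (Q.map φ ≫ α.app V) ≫ R'.map f := by
  rw [bijective_comp_map_iff adj']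
  have h : IsIso (((CategoryTheory.mateEquiv adj adj').symm α).app Y) :=
    inferInstanceAs (IsIso (((CategoryTheory.mateEquiv adj adj').symm α).natTrans.app Y))
  have key : (adj'.homEquiv _ _).symm (Q.map φ ≫ α.app V) =
      ((CategoryTheory.mateEquiv adj adj').symm α).app Y ≫ E.map ((adj.homEquiv Y V).symm φ) := by
    have hn := α.naturality ((adj.homEquiv Y V).symm φ)
    rw [Equiv.symm_apply_eq, adj'.homEquiv_unit, Functor.map_comp, ← Category.assoc]
    refine Eq.trans ?_ (congrArg (· ≫ _) (CategoryTheory.unit_mateEquiv_symm adj adj' α Y))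
    refine Eq.trans ?_ (Category.assoc _ _ _).symm
    refine Eq.trans ?_ (congrArg (_ ≫ ·) hn)
    refine Eq.trans ?_ (Category.assoc _ _ _)
    refine congrArg (· ≫ α.app V) ?_
    change Q.map φ = _ ≫ Q.map (R.map _)
    rw [← Q.map_comp]
    exact congrArg Q.map ((Equiv.apply_symm_apply _ φ).symm.trans (adj.homEquiv_unit Y V _))
  rw [key]
  exact (isIso_comp_left_iff _ _).symm

end Couniversal

section Kan

variable (D : Prederivator.{w, v, u})
variable {J J' V K K' L : Type w} [SmallCategory J] [SmallCategory J'] [SmallCategory V]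
  [SmallCategory K] [SmallCategory K'] [SmallCategory L]

/-- A morphism `v^* d^* X ⟶ c^* Y` exhibits `d^* X` as the right Kan extension of `c^* Y`
along `v`. -/
def IsRan (v : J ⥤ V) {d : V ⥤ K} {c : J ⥤ K'} {X : D.Diag K} {Y : D.Diag K'}
    (φ : (D.res (v ⋙ d)).obj X ⟶ (D.res c).obj Y) : Prop :=
  ∀ Z : D.Diag V, Function.Bijective fun f : (D.res (𝟭 V)).obj Z ⟶ (D.res d).obj X =>
    (D.pull v f ≫ φ : (D.res v).obj Z ⟶ (D.res c).obj Y)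

/-- A morphism `c^* Y ⟶ v^* d^* X` exhibits `d^* X` as the left Kan extension of `c^* Y`
along `v`. -/
def IsLan (v : J ⥤ V) {d : V ⥤ K} {c : J ⥤ K'} {X : D.Diag K} {Y : D.Diag K'}
    (φ : (D.res c).obj Y ⟶ (D.res (v ⋙ d)).obj X) : Prop :=
  ∀ Z : D.Diag V, Function.Bijective fun f : (D.res d).obj X ⟶ (D.res (𝟭 V)).obj Z =>
    (φ ≫ D.pull v f : (D.res c).obj Y ⟶ (D.res v).obj Z)

variable {D}
variable {v : J ⥤ V} {d : V ⥤ K} {c : J ⥤ K'} {X : D.Diag K} {Y : D.Diag K'}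

theorem isRan_iff_bijective (φ : (D.res (v ⋙ d)).obj X ⟶ (D.res c).obj Y) :
    D.IsRan v φ ↔ ∀ Z : D.Diag V, Function.Bijective fun f : Z ⟶ (D.res d).obj X =>
      (D.res v).map f ≫ (rebase v d X).inv ≫ φ := by
  refine forall_congr' fun Z => ?_
  let e : ((D.res (𝟭 V)).obj Z ⟶ (D.res d).obj X) ≃ (Z ⟶ (D.res d).obj X) :=
    (eqToIso (D.res_id_obj Z)).homFromEquiv
  rw [← Function.Bijective.of_comp_iff _ e.bijective]
  refine Eq.to_iff (congrArg _ (funext fun f => ?_))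
  simp only [e, Function.comp_apply, pull, rebase, Iso.app_inv, resComp_inv_app, Category.assoc,
    Iso.homFromEquiv_apply, eqToIso.inv, Functor.map_comp, eqToHom_map]

theorem isLan_iff_bijective (φ : (D.res c).obj Y ⟶ (D.res (v ⋙ d)).obj X) :
    D.IsLan v φ ↔ ∀ Z : D.Diag V, Function.Bijective fun f : (D.res d).obj X ⟶ Z =>
      (φ ≫ (rebase v d X).hom) ≫ (D.res v).map f := by
  refine forall_congr' fun Z => ?_
  let e : ((D.res d).obj X ⟶ (D.res (𝟭 V)).obj Z) ≃ ((D.res d).obj X ⟶ Z) :=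
    (eqToIso (D.res_id_obj Z)).homToEquiv
  rw [← Function.Bijective.of_comp_iff _ e.bijective]
  refine Eq.to_iff (congrArg _ (funext fun f => ?_))
  simp only [e, Function.comp_apply, pull, rebase, Iso.app_hom, resComp_hom_app, Category.assoc,
    Iso.homToEquiv_apply, eqToIso.hom, Functor.map_comp, eqToHom_map]

variable [D.IsDerivator]

/-- The pointwise form of the universal property of right Kan extensions, which is (Der4). -/
theorem isRan_iff_pointwise (φ : (D.res (v ⋙ d)).obj X ⟶ (D.res c).obj Y) :
    D.IsRan v φ ↔ ∀ b : V, D.IsRan (Functor.star.{w} (StructuredArrow b v)) (d := pt b ⋙ d)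
      (c := StructuredArrow.proj b v ⋙ c)
      ((D.res₂ (Functor.whiskerRight (sliceRight v b) d)).app X ≫
        D.pull (StructuredArrow.proj b v) φ) := by
  have adj := Adjunction.ofIsLeftAdjoint (D.res v)
  rw [isRan_iff_bijective, bijective_map_comp_iff adj]
  refine Iff.trans (b := ∀ b : V, IsIso ((D.eval b).map (adj.homEquiv _ _
    ((rebase v d X).inv ≫ φ)))) ⟨fun _ b => inferInstance, IsDerivator.der2 V _⟩ ?_
  refine forall_congr' fun b => ?_
  have adj' := Adjunction.ofIsLeftAdjoint (D.res (Functor.star.{w} (StructuredArrow b v)))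
  have := IsDerivator.der4_right (D := D) v b adj adj'
  rw [isRan_iff_bijective, isIso_map_homEquiv_iff adj adj' (TwoSquare.mk _ _ _ _ (D.sliceRightRes v b))]
  refine bijective_map_comp_congr (rebase (pt b) d X) (rebase (StructuredArrow.proj b v) c Y).symm ?_
  rw [res₂_whiskerRight_app]
  change _ = _ ≫ (((D.resComp _ _).inv.app _ ≫ (D.res₂ (sliceRight v b)).app _ ≫
    (D.resComp _ _).hom.app _) ≫ (D.res _).map _) ≫ _
  simp only [pull, rebase, Iso.app_hom, resComp_hom_app, Category.assoc, Iso.symm_hom,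
    Iso.app_inv, resComp_inv_app, Functor.map_comp, eqToHom_map, eqToHom_trans_assoc]

/-- The pointwise form of the universal property of left Kan extensions, which is (Der4). -/
theorem isLan_iff_pointwise (φ : (D.res c).obj Y ⟶ (D.res (v ⋙ d)).obj X) :
    D.IsLan v φ ↔ ∀ b : V, D.IsLan (Functor.star.{w} (CostructuredArrow v b)) (d := pt b ⋙ d)
      (c := CostructuredArrow.proj v b ⋙ c)
      (D.pull (CostructuredArrow.proj v b) φ ≫
        (D.res₂ (Functor.whiskerRight (sliceLeft v b) d)).app X) := by
  have adj := Adjunction.ofIsRightAdjoint (D.res v)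
  rw [isLan_iff_bijective, bijective_comp_map_iff adj]
  refine Iff.trans (b := ∀ b : V, IsIso ((D.eval b).map ((adj.homEquiv _ _).symm
    (φ ≫ (rebase v d X).hom)))) ⟨fun _ b => inferInstance, IsDerivator.der2 V _⟩ ?_
  refine forall_congr' fun b => ?_
  have adj' := Adjunction.ofIsRightAdjoint (D.res (Functor.star.{w} (CostructuredArrow v b)))
  have := IsDerivator.der4_left (D := D) v b adj adj'
  rw [isLan_iff_bijective, isIso_map_homEquiv_symm_iff adj adj'
    (TwoSquare.mk _ _ _ _ (D.sliceLeftRes v b))]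
  refine bijective_comp_map_congr (rebase (pt b) d X)
    (rebase (CostructuredArrow.proj v b) c Y).symm ?_
  rw [res₂_whiskerRight_app]
  change (D.res _).map _ ≫ ((D.resComp _ _).inv.app _ ≫ (D.res₂ (sliceLeft v b)).app _ ≫
    (D.resComp _ _).hom.app _) = _
  simp only [pull, rebase, Iso.app_hom, resComp_hom_app, Category.assoc, Iso.symm_hom,
    Iso.app_inv, resComp_inv_app, Functor.map_comp, eqToHom_map, eqToHom_trans_assoc, eqToHom_trans,
    eqToHom_refl, Category.id_comp]

end Kan

/-! ### Changing the shape of a Kan extension -/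

section Change

variable {D : Prederivator.{w, v, u}}
variable {J J' V K K' L : Type w} [SmallCategory J] [SmallCategory J'] [SmallCategory V]
  [SmallCategory K] [SmallCategory K'] [SmallCategory L]
variable {v : J ⥤ V} {d : V ⥤ K} {c : J ⥤ K'} {X : D.Diag K} {Y : D.Diag K'}

section Congr

variable {L' : Type w} [SmallCategory L'] {d' : V ⥤ L} {c' : J ⥤ L'} {X' : D.Diag L} {Y' : D.Diag L'}

/-- Being a right Kan extension is invariant under isomorphisms of the two diagrams. -/
theorem isRan_congr (a : (D.res d').obj X' ≅ (D.res d).obj X)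
    (b : (D.res c).obj Y ≅ (D.res c').obj Y') {φ : (D.res (v ⋙ d)).obj X ⟶ (D.res c).obj Y}
    {φ' : (D.res (v ⋙ d')).obj X' ⟶ (D.res c').obj Y'}
    (h : φ' = D.pull v a.hom ≫ φ ≫ b.hom) : D.IsRan v φ ↔ D.IsRan v φ' := by
  refine forall_congr' fun Z => ?_
  rw [← Function.Bijective.of_comp_iff _ a.homToEquiv.bijective]
  refine Iff.trans (Function.Bijective.of_comp_iff' b.homToEquiv.bijective _).symm ?_
  refine Eq.to_iff (congrArg _ (funext fun f => ?_))
  simp only [Function.comp_apply, Iso.homToEquiv_apply, h]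
  rw [pull_comp, Category.assoc, Category.assoc]

/-- Being a left Kan extension is invariant under isomorphisms of the two diagrams. -/
theorem isLan_congr (a : (D.res d).obj X ≅ (D.res d').obj X')
    (b : (D.res c').obj Y' ≅ (D.res c).obj Y) {φ : (D.res c).obj Y ⟶ (D.res (v ⋙ d)).obj X}
    {φ' : (D.res c').obj Y' ⟶ (D.res (v ⋙ d')).obj X'}
    (h : φ' = b.hom ≫ φ ≫ D.pull v a.hom) : D.IsLan v φ ↔ D.IsLan v φ' := by
  refine forall_congr' fun Z => ?_
  rw [← Function.Bijective.of_comp_iff _ a.symm.homFromEquiv.bijective]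
  refine Iff.trans (Function.Bijective.of_comp_iff' b.symm.homFromEquiv.bijective _).symm ?_
  refine Eq.to_iff (congrArg _ (funext fun f => ?_))
  simp only [Function.comp_apply, Iso.homFromEquiv_apply, Iso.symm_inv, h]
  rw [pull_comp, Category.assoc, Category.assoc]

end Congr

/-- Restriction of the shape along `i` does not change right Kan extensions if it does not change
the cones. -/
theorem isRan_pull_iff (i : J' ⥤ J) (φ : (D.res (v ⋙ d)).obj X ⟶ (D.res c).obj Y)
    (h : ∀ Z : D.Diag V, Function.Bijective
      fun f : (D.res v).obj Z ⟶ (D.res c).obj Y => D.pull i f) :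
    D.IsRan v φ ↔ D.IsRan (i ⋙ v) (D.pull i φ) := by
  refine forall_congr' fun Z => ?_
  rw [← Function.Bijective.of_comp_iff' (h Z)]
  refine Eq.to_iff (congrArg _ (funext fun f => ?_))
  exact (pull_comp i (D.pull v f) φ).trans (congrArg (· ≫ D.pull i φ) (pull_pull v i f))

/-- Restriction of the shape along `i` does not change left Kan extensions if it does not change
the cocones. -/
theorem isLan_pull_iff (i : J' ⥤ J) (φ : (D.res c).obj Y ⟶ (D.res (v ⋙ d)).obj X)
    (h : ∀ Z : D.Diag V, Function.Bijective
      fun f : (D.res c).obj Y ⟶ (D.res v).obj Z => D.pull i f) :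
    D.IsLan v φ ↔ D.IsLan (i ⋙ v) (D.pull i φ) := by
  refine forall_congr' fun Z => ?_
  rw [← Function.Bijective.of_comp_iff' (h Z)]
  refine Eq.to_iff (congrArg _ (funext fun f => ?_))
  exact (pull_comp i φ (D.pull v f)).trans (congrArg (D.pull i φ ≫ ·) (pull_pull v i f))

instance (a b : J ⥤ Pt.{w}) : Subsingleton (a ⟶ b) :=
  ⟨fun _ _ => NatTrans.ext (funext fun _ => Subsingleton.elim _ _)⟩

/-- The unique natural transformation between functors to the terminal category. -/
def toPt (a b : J ⥤ Pt.{w}) : a ⟶ b where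
  app _ := Discrete.eqToHom (Subsingleton.elim _ _)
  naturality _ _ _ := Subsingleton.elim _ _

theorem res₂_pt_eq_id {a : J ⥤ Pt.{w}} (κ : a ⟶ a) (Z : D.Diag Pt.{w}) :
    (D.res₂ κ).app Z = 𝟙 _ := by
  rw [Subsingleton.elim κ (𝟙 a), res₂_id_app]

/-- A left adjoint is initial: restriction along it does not change cones. -/
theorem pull_bijective_of_leftAdjoint {i : J' ⥤ J} {r : J ⥤ J'} (adj : i ⊣ r) (a : J ⥤ Pt.{w})
    (c : J ⥤ K) (Z : D.Diag Pt.{w}) (X : D.Diag K) :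
    Function.Bijective fun f : (D.res a).obj Z ⟶ (D.res c).obj X => D.pull i f := by
  refine Function.bijective_iff_has_inverse.2 ⟨fun g => (D.res₂ (toPt a ((r ⋙ i) ⋙ a))).app Z ≫
    D.pull r g ≫ (D.res₂ (Functor.whiskerRight adj.counit c)).app X, fun f => ?_, fun g => ?_⟩
  · have h := res₂_comp_pull adj.counit f
    rw [pull_idFunctor] at h
    refine (congrArg (fun t => (D.res₂ (toPt a ((r ⋙ i) ⋙ a))).app Z ≫ t ≫
      (D.res₂ (Functor.whiskerRight adj.counit c)).app X) (pull_pull i r f)).trans ?_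
    refine (congrArg ((D.res₂ (toPt a ((r ⋙ i) ⋙ a))).app Z ≫ ·) h.symm).trans ?_
    rw [← Category.assoc]
    refine (congrArg (· ≫ f) ((res₂_comp_app D _ _ Z).symm.trans ?_)).trans (Category.id_comp f)
    exact res₂_pt_eq_id _ _
  · have h := res₂_comp_pull adj.unit g
    rw [pull_idFunctor] at h
    refine (pull_comp i _ _).trans ?_
    rw [pull_comp i, pull_res₂, pull_res₂]
    refine (congrArg (fun t => _ ≫ t ≫ _) (pull_pull r i g)).trans ?_
    rw [← Category.assoc]
    rw [Subsingleton.elim (Functor.whiskerLeft i (toPt a ((r ⋙ i) ⋙ a)))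
      (Functor.whiskerRight adj.unit (i ⋙ a))]
    refine (congrArg (· ≫ _) h).trans ?_
    rw [Category.assoc]
    refine (congrArg (g ≫ ·) ((res₂_comp_app D _ _ X).symm.trans ?_)).trans (Category.comp_id g)
    rw [← res₂_id_app]
    congr 2
    ext j
    exact (c.map_comp _ _).symm.trans ((congrArg c.map (adj.left_triangle_components j)).trans
      (c.map_id _))

/-- A right adjoint is final: restriction along it does not change cocones. -/
theorem pull_bijective_of_rightAdjoint {l : J ⥤ J'} {i : J' ⥤ J} (adj : l ⊣ i) (a : J ⥤ Pt.{w})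
    (c : J ⥤ K) (Z : D.Diag Pt.{w}) (X : D.Diag K) :
    Function.Bijective fun f : (D.res c).obj X ⟶ (D.res a).obj Z => D.pull i f := by
  refine Function.bijective_iff_has_inverse.2 ⟨fun g =>
    (D.res₂ (Functor.whiskerRight adj.unit c)).app X ≫ D.pull l g ≫
      (D.res₂ (toPt ((l ⋙ i) ⋙ a) a)).app Z, fun f => ?_, fun g => ?_⟩
  · have h := res₂_comp_pull adj.unit f
    rw [pull_idFunctor] at h
    refine (congrArg (fun t => (D.res₂ (Functor.whiskerRight adj.unit c)).app X ≫ t ≫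
      (D.res₂ (toPt ((l ⋙ i) ⋙ a) a)).app Z) (pull_pull i l f)).trans ?_
    rw [← Category.assoc]
    refine (congrArg (· ≫ (D.res₂ (toPt ((l ⋙ i) ⋙ a) a)).app Z) h).trans ?_
    rw [Category.assoc]
    refine (congrArg (f ≫ ·) ((res₂_comp_app D _ _ Z).symm.trans ?_)).trans (Category.comp_id f)
    exact res₂_pt_eq_id _ _
  · have h := res₂_comp_pull adj.counit g
    rw [pull_idFunctor] at h
    refine (pull_comp i _ _).trans ?_
    rw [pull_comp i, pull_res₂, pull_res₂]
    refine (congrArg (fun t => _ ≫ t ≫ _) (pull_pull l i g)).trans ?_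
    rw [Subsingleton.elim (Functor.whiskerLeft i (toPt ((l ⋙ i) ⋙ a) a))
      (Functor.whiskerRight adj.counit (i ⋙ a))]
    refine (congrArg (_ ≫ ·) h.symm).trans ?_
    rw [← Category.assoc]
    refine (congrArg (· ≫ g) ((res₂_comp_app D _ _ X).symm.trans ?_)).trans (Category.id_comp g)
    rw [← res₂_id_app]
    congr 2
    ext j
    exact (c.map_comp _ _).symm.trans ((congrArg c.map (adj.right_triangle_components j)).trans
      (c.map_id _))

/-- If a diagram on `J` is a right Kan extension along `i`, its cones may be restricted along
`i`. -/
theorem pull_bijective_of_isRan {i : J' ⥤ J} (c : J ⥤ K) (X : D.Diag K)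
    (h : D.IsRan i (d := c) (c := i ⋙ c) (𝟙 ((D.res (i ⋙ c)).obj X))) (a : J ⥤ L) (Z : D.Diag L) :
    Function.Bijective fun f : (D.res a).obj Z ⟶ (D.res c).obj X => D.pull i f := by
  have h1 := h ((D.res a).obj Z)
  rw [← Function.Bijective.of_comp_iff _ (rebase (𝟭 J) a Z).homFromEquiv.bijective] at h1
  rw [← Function.Bijective.of_comp_iff' (Iso.homFromEquiv (rebase i a Z)).bijective]
  refine (congrArg Function.Bijective (funext fun f => ?_)).mpr h1
  simp only [Function.comp_apply, Iso.homFromEquiv_apply]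
  refine Eq.trans ?_ (Category.comp_id _).symm
  refine Eq.trans ?_ (pull_comp (b := a) (Y := Z) i (rebase (𝟭 J) a Z).inv f).symm
  exact congrArg (· ≫ D.pull i f) (pull_rebase_inv i (𝟭 J) a Z).symm

/-- If a diagram on `J` is a left Kan extension along `i`, its cocones may be restricted along
`i`. -/
theorem pull_bijective_of_isLan {i : J' ⥤ J} (c : J ⥤ K) (X : D.Diag K)
    (h : D.IsLan i (d := c) (c := i ⋙ c) (𝟙 ((D.res (i ⋙ c)).obj X))) (a : J ⥤ L) (Z : D.Diag L) :
    Function.Bijective fun f : (D.res c).obj X ⟶ (D.res a).obj Z => D.pull i f := by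
  have h1 := h ((D.res a).obj Z)
  rw [← Function.Bijective.of_comp_iff _ (rebase (𝟭 J) a Z).homToEquiv.bijective] at h1
  rw [← Function.Bijective.of_comp_iff' (Iso.homToEquiv (rebase i a Z)).bijective]
  refine (congrArg Function.Bijective (funext fun f => ?_)).mpr h1
  simp only [Function.comp_apply, Iso.homToEquiv_apply]
  refine Eq.trans ?_ (Category.id_comp _).symm
  refine Eq.trans ?_ (pull_comp (b := a) (Y := Z) i f (rebase (𝟭 J) a Z).hom).symm
  exact congrArg (D.pull i f ≫ ·) (pull_rebase_hom i (𝟭 J) a Z).symm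

theorem isRan_id_iff {d : V ⥤ K} {c : V ⥤ K'} (φ : (D.res d).obj X ⟶ (D.res c).obj Y) :
    D.IsRan (𝟭 V) φ ↔ IsIso φ := by
  rw [isRan_iff_bijective, isIso_iff_yoneda_map_bijective]
  refine forall_congr' fun Z => ?_
  rw [← Function.Bijective.of_comp_iff' (eqToIso (D.res_id_obj Z)).homFromEquiv.bijective]
  refine Eq.to_iff (congrArg _ (funext fun f => ?_))
  simp only [Function.comp_apply, Iso.homFromEquiv_apply, res_id_map, rebase, Iso.app_inv,
    resComp_inv_app, eqToIso.inv, Category.assoc, eqToHom_trans_assoc, eqToHom_refl,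
    Category.id_comp]

theorem isLan_id_iff {d : V ⥤ K} {c : V ⥤ K'} (φ : (D.res c).obj Y ⟶ (D.res d).obj X) :
    D.IsLan (𝟭 V) φ ↔ IsIso φ := by
  rw [isLan_iff_bijective, isIso_iff_coyoneda_map_bijective]
  refine forall_congr' fun Z => ?_
  rw [← Function.Bijective.of_comp_iff' (eqToIso (D.res_id_obj Z)).homToEquiv.bijective]
  refine Eq.to_iff (congrArg _ (funext fun f => ?_))
  simp only [Function.comp_apply, Iso.homToEquiv_apply, res_id_map, rebase, Iso.app_hom,
    resComp_hom_app, eqToIso.hom, Category.assoc, eqToHom_trans_assoc, eqToHom_trans, eqToHom_refl,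
    Category.id_comp, Category.comp_id]

/-- The limit over a shape with an initial object is the value there. -/
theorem isRan_star_iff {j : J} (hj : IsInitial j) {d : Pt.{w} ⥤ K}
    (φ : (D.res (Functor.star.{w} J ⋙ d)).obj X ⟶ (D.res c).obj Y) :
    D.IsRan (Functor.star.{w} J) φ ↔ IsIso (D.pull (pt j) φ) := by
  have adj : pt j ⊣ Functor.star.{w} J := Adjunction.mkOfUnitCounit
    { unit := toPt _ _
      counit := { app := fun k => hj.to k, naturality := fun _ _ _ => hj.hom_ext _ _ }
      left_triangle := NatTrans.ext (funext fun _ => hj.hom_ext _ _)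
      right_triangle := Subsingleton.elim _ _ }
  rw [isRan_pull_iff (pt j) φ (fun Z => pull_bijective_of_leftAdjoint adj _ _ Z Y)]
  exact isRan_id_iff (D.pull (pt j) φ)

/-- The colimit over a shape with a terminal object is the value there. -/
theorem isLan_star_iff {j : J} (hj : IsTerminal j) {d : Pt.{w} ⥤ K}
    (φ : (D.res c).obj Y ⟶ (D.res (Functor.star.{w} J ⋙ d)).obj X) :
    D.IsLan (Functor.star.{w} J) φ ↔ IsIso (D.pull (pt j) φ) := by
  have adj : Functor.star.{w} J ⊣ pt j := Adjunction.mkOfUnitCounit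
    { unit := { app := fun k => hj.from k, naturality := fun _ _ _ => hj.hom_ext _ _ }
      counit := toPt _ _
      left_triangle := Subsingleton.elim _ _
      right_triangle := NatTrans.ext (funext fun _ => hj.hom_ext _ _) }
  rw [isLan_pull_iff (pt j) φ (fun Z => pull_bijective_of_rightAdjoint adj _ _ Z Y)]
  exact isLan_id_iff (D.pull (pt j) φ)

/-! ### Limits and colimits of coherent diagrams -/

/-- The cone `α` with vertex `b` exhibits the value of `X` at `b` as the limit of `c^* X`. -/
def IsLim (X : D.Diag K) {b : K} {c : J ⥤ K} (α : Functor.star.{w} J ⋙ pt b ⟶ c) : Prop :=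
  D.IsRan (Functor.star.{w} J) (d := pt b) (c := c) ((D.res₂ α).app X)

/-- The cocone `α` with vertex `b` exhibits the value of `X` at `b` as the colimit of `c^* X`. -/
def IsColim (X : D.Diag K) {b : K} {c : J ⥤ K} (α : c ⟶ Functor.star.{w} J ⋙ pt b) : Prop :=
  D.IsLan (Functor.star.{w} J) (d := pt b) (c := c) ((D.res₂ α).app X)

/-- Limits may be computed over a coreflective subcategory. -/
theorem isLim_comp_leftAdjoint {i : J' ⥤ J} {r : J ⥤ J'} (adj : i ⊣ r) (X : D.Diag K) {b : K}
    {c : J ⥤ K} (α : Functor.star.{w} J ⋙ pt b ⟶ c) :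
    IsLim X α ↔ IsLim X (J := J') (c := i ⋙ c) (Functor.whiskerLeft i α) := by
  refine (isRan_pull_iff i _ fun Z => pull_bijective_of_leftAdjoint adj _ _ Z X).trans ?_
  rw [pull_res₂]
  rfl

/-- Colimits may be computed over a reflective subcategory. -/
theorem isColim_comp_rightAdjoint {l : J ⥤ J'} {i : J' ⥤ J} (adj : l ⊣ i) (X : D.Diag K) {b : K}
    {c : J ⥤ K} (α : c ⟶ Functor.star.{w} J ⋙ pt b) :
    IsColim X α ↔ IsColim X (J := J') (c := i ⋙ c) (Functor.whiskerLeft i α) := by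
  refine (isLan_pull_iff i _ fun Z => pull_bijective_of_rightAdjoint adj _ _ Z X).trans ?_
  rw [pull_res₂]
  rfl

/-- If the diagram is a right Kan extension along `i`, its limit may be computed after restriction
along `i`. -/
theorem isLim_comp_of_isRan (i : J' ⥤ J) (X : D.Diag K) {b : K} {c : J ⥤ K}
    (h : D.IsRan i (d := c) (c := i ⋙ c) (𝟙 ((D.res (i ⋙ c)).obj X)))
    (α : Functor.star.{w} J ⋙ pt b ⟶ c) :
    IsLim X α ↔ IsLim X (J := J') (c := i ⋙ c) (Functor.whiskerLeft i α) := by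
  refine (isRan_pull_iff i _ fun Z => pull_bijective_of_isRan c X h _ Z).trans ?_
  rw [pull_res₂]
  rfl

/-- If the diagram is a left Kan extension along `i`, its colimit may be computed after restriction
along `i`. -/
theorem isColim_comp_of_isLan (i : J' ⥤ J) (X : D.Diag K) {b : K} {c : J ⥤ K}
    (h : D.IsLan i (d := c) (c := i ⋙ c) (𝟙 ((D.res (i ⋙ c)).obj X)))
    (α : c ⟶ Functor.star.{w} J ⋙ pt b) :
    IsColim X α ↔ IsColim X (J := J') (c := i ⋙ c) (Functor.whiskerLeft i α) := by
  refine (isLan_pull_iff i _ fun Z => pull_bijective_of_isLan c X h _ Z).trans ?_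
  rw [pull_res₂]
  rfl

/-- Limits in a restricted diagram `g^* X` are limits in `X`; the cones may be changed along
isomorphisms of functors. -/
theorem isLim_res_iff (g : L ⥤ K) (X : D.Diag K) {b : L} {c : J ⥤ L}
    (α : Functor.star.{w} J ⋙ pt b ⟶ c) {b' : K} {c' : J ⥤ K}
    (α' : Functor.star.{w} J ⋙ pt b' ⟶ c') (e : g.obj b ≅ b') (γ : c ⋙ g ≅ c')
    (h : ∀ j, g.map (α.app j) ≫ γ.hom.app j = e.hom ≫ α'.app j) :
    IsLim ((D.res g).obj X) α ↔ IsLim X α' := by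
  let δ : pt b ⋙ g ≅ pt b' := NatIso.ofComponents (fun _ => e) (fun {x y} f => by
    obtain rfl : x = y := Subsingleton.elim _ _
    obtain rfl : f = 𝟙 x := Subsingleton.elim _ _
    simp)
  refine isRan_congr ((D.res₂Iso δ X).symm ≪≫ rebase _ g X)
    ((rebase c g X).symm ≪≫ D.res₂Iso γ X) ?_
  simp only [Iso.trans_hom, Iso.symm_hom]
  rw [pull_comp, pull_rebase_hom]
  change _ = (D.pull (Functor.star.{w} J) ((D.res₂ δ.inv).app X) ≫ _) ≫ _ ≫ _ ≫ (D.res₂ γ.hom).app X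
  have h1 := rebase_hom_res₂ α g X
  rw [pull_res₂, Category.assoc]
  refine Eq.trans ?_ (congrArg (_ ≫ ·) (Category.assoc _ _ _))
  rw [h1, Category.assoc, Iso.hom_inv_id_assoc, ← res₂_comp_app]
  refine Eq.trans ?_ (res₂_comp_app D _ _ X)
  refine congrArg (fun t => (D.res₂ t).app X) (NatTrans.ext (funext fun j => ?_))
  change α'.app j = e.inv ≫ g.map (α.app j) ≫ γ.hom.app j
  rw [h, Iso.inv_hom_id_assoc]

/-- Colimits in a restricted diagram `g^* X` are colimits in `X`; the cocones may be changed along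
isomorphisms of functors. -/
theorem isColim_res_iff (g : L ⥤ K) (X : D.Diag K) {b : L} {c : J ⥤ L}
    (α : c ⟶ Functor.star.{w} J ⋙ pt b) {b' : K} {c' : J ⥤ K}
    (α' : c' ⟶ Functor.star.{w} J ⋙ pt b') (e : g.obj b ≅ b') (γ : c ⋙ g ≅ c')
    (h : ∀ j, g.map (α.app j) ≫ e.hom = γ.hom.app j ≫ α'.app j) :
    IsColim ((D.res g).obj X) α ↔ IsColim X α' := by
  let δ : pt b ⋙ g ≅ pt b' := NatIso.ofComponents (fun _ => e) (fun {x y} f => by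
    obtain rfl : x = y := Subsingleton.elim _ _
    obtain rfl : f = 𝟙 x := Subsingleton.elim _ _
    simp)
  refine isLan_congr ((rebase _ g X).symm ≪≫ D.res₂Iso δ X)
    ((D.res₂Iso γ X).symm ≪≫ rebase c g X) ?_
  simp only [Iso.trans_hom, Iso.symm_hom]
  rw [pull_comp, pull_rebase_inv]
  change _ = ((D.res₂ γ.inv).app X ≫ _) ≫ _ ≫ _ ≫ D.pull (Functor.star.{w} J) ((D.res₂ δ.hom).app X)
  have h1 := rebase_hom_res₂ α g X
  rw [pull_res₂, Category.assoc]
  refine Eq.trans ?_ (congrArg (_ ≫ ·) (Category.assoc _ _ _))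
  rw [h1, Category.assoc]
  refine Eq.trans ?_ (congrArg (fun t => _ ≫ _ ≫ t) (Iso.hom_inv_id_assoc _ _).symm)
  refine Eq.trans ?_ (congrArg (_ ≫ ·) (res₂_comp_app D _ _ X))
  refine Eq.trans ?_ (res₂_comp_app D _ _ X)
  refine congrArg (fun t => (D.res₂ t).app X) (NatTrans.ext (funext fun j => ?_))
  change α'.app j = γ.inv.app j ≫ g.map (α.app j) ≫ e.hom
  rw [h, Iso.inv_hom_id_app_assoc]

/-! ### Fully faithful functors -/

variable [D.IsDerivator]

/-- (Der2): isomorphisms are detected at the objects of the shape. -/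
theorem isIso_of_isIso_pull {d : V ⥤ K} {c : V ⥤ K'} (φ : (D.res d).obj X ⟶ (D.res c).obj Y)
    (h : ∀ b : V, IsIso (D.pull (pt b) φ)) : IsIso φ := by
  refine IsDerivator.der2 V φ fun b => ?_
  have := h b
  have h' : (D.eval b).map φ = (rebase (pt b) d X).inv ≫ D.pull (pt b) φ ≫
      (rebase (pt b) c Y).hom := by
    simp [pull, rebase, resComp_hom_app, resComp_inv_app]
  rw [h']
  infer_instance

instance {a c : J ⥤ K} (α : a ⟶ c) [IsIso α] : IsIso ((D.res₂ α).app X) :=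
  inferInstanceAs (IsIso (D.res₂Iso (asIso α) X).hom)

/-- The object `(b ≅ u j)` is initial in the comma category `b / u` for `u` fully faithful. -/
noncomputable def isInitialMkIso (u : J ⥤ V) [u.Full] [u.Faithful] {b : V} {j : J} (e : b ≅ u.obj j) :
    IsInitial (StructuredArrow.mk (S := b) (T := u) e.hom) :=
  IsInitial.ofUniqueHom (fun x => StructuredArrow.homMk (u.preimage (e.inv ≫ x.hom)) (by simp))
    (fun x m => by
      ext
      apply u.map_injective
      have := StructuredArrow.w m
      simp only [StructuredArrow.homMk_right, Functor.map_preimage]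
      rw [← this]; simp)

/-- The object `(u j ≅ b)` is terminal in the comma category `u / b` for `u` fully faithful. -/
noncomputable def isTerminalMkIso (u : J ⥤ V) [u.Full] [u.Faithful] {b : V} {j : J} (e : u.obj j ≅ b) :
    IsTerminal (CostructuredArrow.mk (S := u) (T := b) e.hom) :=
  IsTerminal.ofUniqueHom (fun x => CostructuredArrow.homMk (u.preimage (x.hom ≫ e.inv)) (by simp))
    (fun x m => by
      ext
      apply u.map_injective
      have := CostructuredArrow.w m
      simp only [CostructuredArrow.homMk_left, Functor.map_preimage]
      rw [← this]; simp)

/-- A right Kan extension along a fully faithful functor extends the given diagram. -/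
theorem isIso_of_isRan (u : J ⥤ V) [u.Full] [u.Faithful]
    (φ : (D.res (u ⋙ d)).obj X ⟶ (D.res c).obj Y) (h : D.IsRan u φ) : IsIso φ := by
  refine isIso_of_isIso_pull φ fun j => ?_
  let j' := StructuredArrow.mk (S := u.obj j) (T := u) (𝟙 (u.obj j))
  have hj' : IsInitial j' := isInitialMkIso u (Iso.refl (u.obj j))
  have h1 := (isRan_star_iff hj' _).1 ((isRan_iff_pointwise φ).1 h (u.obj j))
  rw [pull_comp, pull_res₂] at h1
  have h2 : IsIso (Functor.whiskerLeft (pt j')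
      (Functor.whiskerRight (sliceRight u (u.obj j)) d)) := by
    have : ∀ x, IsIso ((Functor.whiskerLeft (pt j')
        (Functor.whiskerRight (sliceRight u (u.obj j)) d)).app x) := fun x =>
      inferInstanceAs (IsIso (d.map (𝟙 (u.obj j))))
    exact NatIso.isIso_of_isIso_app _
  have h3 := (isIso_comp_left_iff _ _).1 h1
  rw [pull_pull] at h3
  exact h3

/-- A left Kan extension along a fully faithful functor extends the given diagram. -/
theorem isIso_of_isLan (u : J ⥤ V) [u.Full] [u.Faithful]
    (φ : (D.res c).obj Y ⟶ (D.res (u ⋙ d)).obj X) (h : D.IsLan u φ) : IsIso φ := by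
  refine isIso_of_isIso_pull φ fun j => ?_
  let j' := CostructuredArrow.mk (S := u) (T := u.obj j) (𝟙 (u.obj j))
  have hj' : IsTerminal j' := isTerminalMkIso u (Iso.refl (u.obj j))
  have h1 := (isLan_star_iff hj' _).1 ((isLan_iff_pointwise φ).1 h (u.obj j))
  rw [pull_comp, pull_res₂] at h1
  have h2 : IsIso (Functor.whiskerLeft (pt j')
      (Functor.whiskerRight (sliceLeft u (u.obj j)) d)) := by
    have : ∀ x, IsIso ((Functor.whiskerLeft (pt j')
        (Functor.whiskerRight (sliceLeft u (u.obj j)) d)).app x) := fun x =>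
      inferInstanceAs (IsIso (d.map (𝟙 (u.obj j))))
    exact NatIso.isIso_of_isIso_app _
  have h3 := (isIso_comp_right_iff _ _).1 h1
  rw [pull_pull] at h3
  exact h3

theorem isIso_counit (u : J ⥤ V) [u.Full] [u.Faithful] {R : D.Diag J ⥤ D.Diag V}
    (adj : D.res u ⊣ R) : IsIso adj.counit := by
  have (Y : D.Diag J) : IsIso (adj.counit.app Y) := by
    let X := R.obj Y
    let φ : (D.res (u ⋙ 𝟭 V)).obj X ⟶ (D.res (𝟭 J)).obj Y :=
      adj.counit.app Y ≫ eqToHom (D.res_id_obj Y).symm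
    have hφ : D.IsRan u φ := by
      rw [isRan_iff_bijective]
      refine (bijective_map_comp_congr (eqToIso (D.res_id_obj X)) (eqToIso (D.res_id_obj Y)).symm
        ?_).1 ((bijective_map_comp_iff adj (adj.counit.app Y)).2 ?_)
      · simp [φ, rebase, resComp_inv_app, eqToHom_map]
      · have : adj.homEquiv _ _ (adj.counit.app Y) = 𝟙 _ := by simp [Adjunction.homEquiv_unit]
        rw [this]
        infer_instance
    have := isIso_of_isRan u φ hφ
    exact IsIso.of_isIso_comp_right (adj.counit.app Y) (eqToHom (D.res_id_obj Y).symm)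
  exact NatIso.isIso_of_isIso_app _

/-- The essential image of `u_*` consists of the right Kan extensions along `u`. -/
theorem essImage_ran_iff (u : J ⥤ V) [u.Full] [u.Faithful] (X : D.Diag V) :
    (D.ran u).essImage X ↔ D.IsRan u (d := 𝟭 V) (c := u) (𝟙 ((D.res u).obj X)) := by
  have adj : D.res u ⊣ D.ran u := Adjunction.ofIsLeftAdjoint (D.res u)
  have := isIso_counit u adj
  have hff := adj.fullyFaithfulROfIsIsoCounit
  have := hff.full
  have := hff.faithful
  rw [← Adjunction.isIso_unit_app_iff_mem_essImage adj, isRan_iff_bijective]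
  refine (isIso_unit_app_iff_bijective adj X).trans ?_
  refine bijective_map_comp_congr (eqToIso (D.res_id_obj X)) (Iso.refl _) ?_
  simp [rebase, resComp_inv_app, eqToHom_map]
  exact Category.comp_id _

theorem isIso_unit (u : J ⥤ V) [u.Full] [u.Faithful] {L : D.Diag J ⥤ D.Diag V}
    (adj : L ⊣ D.res u) : IsIso adj.unit := by
  have (Y : D.Diag J) : IsIso (adj.unit.app Y) := by
    let X := L.obj Y
    let φ : (D.res (𝟭 J)).obj Y ⟶ (D.res (u ⋙ 𝟭 V)).obj X :=
      eqToHom (D.res_id_obj Y) ≫ adj.unit.app Y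
    have hφ : D.IsLan u φ := by
      rw [isLan_iff_bijective]
      refine (bijective_comp_map_congr (eqToIso (D.res_id_obj X)) (eqToIso (D.res_id_obj Y)).symm
        ?_).1 ((bijective_comp_map_iff adj (adj.unit.app Y)).2 ?_)
      · simp [φ, rebase, resComp_hom_app, eqToHom_map]
      · have : (adj.homEquiv _ _).symm (adj.unit.app Y) = 𝟙 _ := by
          simp [Adjunction.homEquiv_counit]
        rw [this]
        infer_instance
    have := isIso_of_isLan u φ hφ
    exact IsIso.of_isIso_comp_left (eqToHom (D.res_id_obj Y)) (adj.unit.app Y)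
  exact NatIso.isIso_of_isIso_app _

/-- The essential image of `u_!` consists of the left Kan extensions along `u`. -/
theorem essImage_lan_iff (u : J ⥤ V) [u.Full] [u.Faithful] (X : D.Diag V) :
    (D.lan u).essImage X ↔ D.IsLan u (d := 𝟭 V) (c := u) (𝟙 ((D.res u).obj X)) := by
  have adj : D.lan u ⊣ D.res u := Adjunction.ofIsRightAdjoint (D.res u)
  have := isIso_unit u adj
  have hff := adj.fullyFaithfulLOfIsIsoUnit
  have := hff.full
  have := hff.faithful
  rw [← Adjunction.isIso_counit_app_iff_mem_essImage adj, isLan_iff_bijective]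
  refine (isIso_counit_app_iff_bijective adj X).trans ?_
  refine bijective_comp_map_congr (eqToIso (D.res_id_obj X)) (Iso.refl _) ?_
  simp [rebase, resComp_hom_app, eqToHom_map]

/-- Right Kan extensions along fully faithful functors exist and restrict to the given diagram. -/
theorem exists_isRan (u : J ⥤ V) [u.Full] [u.Faithful] (Y : D.Diag J) :
    ∃ X : D.Diag V, Nonempty ((D.res u).obj X ≅ Y) ∧
      D.IsRan u (d := 𝟭 V) (c := u) (𝟙 ((D.res u).obj X)) := by
  have adj : D.res u ⊣ D.ran u := Adjunction.ofIsLeftAdjoint (D.res u)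
  have := isIso_counit u adj
  exact ⟨(D.ran u).obj Y, ⟨asIso (adj.counit.app Y)⟩,
    (essImage_ran_iff u _).1 ((D.ran u).obj_mem_essImage Y)⟩

/-- Left Kan extensions along fully faithful functors exist and restrict to the given diagram. -/
theorem exists_isLan (u : J ⥤ V) [u.Full] [u.Faithful] (Y : D.Diag J) :
    ∃ X : D.Diag V, Nonempty ((D.res u).obj X ≅ Y) ∧
      D.IsLan u (d := 𝟭 V) (c := u) (𝟙 ((D.res u).obj X)) := by
  have adj : D.lan u ⊣ D.res u := Adjunction.ofIsRightAdjoint (D.res u)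
  have := isIso_unit u adj
  exact ⟨(D.lan u).obj Y, ⟨(asIso (adj.unit.app Y)).symm⟩,
    (essImage_lan_iff u _).1 ((D.lan u).obj_mem_essImage Y)⟩

/-- A diagram is a right Kan extension of its restriction along `u` if and only if its values are
limits over the comma categories `b / u`. -/
theorem isRan_id_iff_isLim (u : J ⥤ V) (X : D.Diag V) :
    D.IsRan u (d := 𝟭 V) (c := u) (𝟙 ((D.res u).obj X)) ↔
      ∀ b : V, IsLim X (sliceRight u b) := by
  rw [isRan_iff_pointwise]
  refine forall_congr' fun b => ?_
  exact Eq.to_iff (congrArg _ ((congrArg (_ ≫ ·) (pull_id (StructuredArrow.proj b u))).trans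
    (Category.comp_id _)))

/-- A diagram is a left Kan extension of its restriction along `u` if and only if its values are
colimits over the comma categories `u / b`. -/
theorem isLan_id_iff_isColim (u : J ⥤ V) (X : D.Diag V) :
    D.IsLan u (d := 𝟭 V) (c := u) (𝟙 ((D.res u).obj X)) ↔
      ∀ b : V, IsColim X (sliceLeft u b) := by
  rw [isLan_iff_pointwise]
  refine forall_congr' fun b => ?_
  exact Eq.to_iff (congrArg _ ((congrArg (· ≫ _) (pull_id (CostructuredArrow.proj u b))).trans
    (Category.id_comp _)))

end Change
end Prederivator

namespace Prederivator

/-! ### Kan extensions along products with a category of parameters -/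

section Extension

variable {D : Prederivator.{w, v, u}}
variable {J J' V K L M : Type w} [SmallCategory J] [SmallCategory J'] [SmallCategory V]
  [SmallCategory K] [SmallCategory L] [SmallCategory M]

/-- For `u` fully faithful the limit condition holds automatically at objects in the image of
`u`. -/
theorem isLim_sliceRight_of_iso (u : J ⥤ V) [u.Full] [u.Faithful] {b : V} {j : J} (e : b ≅ u.obj j)
    (X : D.Diag V) : IsLim X (sliceRight u b) := by
  refine (isRan_star_iff (isInitialMkIso u e) _).2 ?_
  rw [pull_res₂]
  have h2 : IsIso (Functor.whiskerLeft (pt (StructuredArrow.mk (S := b) (T := u) e.hom))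
      (sliceRight u b)) := by
    have : ∀ x, IsIso ((Functor.whiskerLeft (pt (StructuredArrow.mk (S := b) (T := u) e.hom))
      (sliceRight u b)).app x) := fun x => inferInstanceAs (IsIso e.hom)
    exact NatIso.isIso_of_isIso_app _
  infer_instance

/-- For `u` fully faithful the colimit condition holds automatically at objects in the image of
`u`. -/
theorem isColim_sliceLeft_of_iso (u : J ⥤ V) [u.Full] [u.Faithful] {b : V} {j : J}
    (e : u.obj j ≅ b) (X : D.Diag V) : IsColim X (sliceLeft u b) := by
  refine (isLan_star_iff (isTerminalMkIso u e) _).2 ?_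
  rw [pull_res₂]
  have h2 : IsIso (Functor.whiskerLeft (pt (CostructuredArrow.mk (S := u) (T := b) e.hom))
      (sliceLeft u b)) := by
    have : ∀ x, IsIso ((Functor.whiskerLeft (pt (CostructuredArrow.mk (S := u) (T := b) e.hom))
      (sliceLeft u b)).app x) := fun x => inferInstanceAs (IsIso e.hom)
    exact NatIso.isIso_of_isIso_app _
  infer_instance

variable (A : Type w) [SmallCategory A]

/-- The inclusion `b / u ⥤ (b, a) / (u × A)`. -/
def structuredArrowProd (u : J ⥤ V) (b : V) (a : A) :
    StructuredArrow b u ⥤ StructuredArrow ((b, a) : V × A) (u.prod (𝟭 A)) where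
  obj x := StructuredArrow.mk (Y := (x.right, a)) (Prod.mkHom x.hom (𝟙 a))
  map f := StructuredArrow.homMk (Prod.mkHom f.right (𝟙 a))
    (Prod.ext (StructuredArrow.w f) (Category.comp_id _))

/-- The retraction `(b, a) / (u × A) ⥤ b / u`. -/
def structuredArrowProdFst (u : J ⥤ V) (b : V) (a : A) :
    StructuredArrow ((b, a) : V × A) (u.prod (𝟭 A)) ⥤ StructuredArrow b u where
  obj x := StructuredArrow.mk (Y := x.right.1) x.hom.1
  map f := StructuredArrow.homMk f.right.1 (congrArg (fun t => t.1) (StructuredArrow.w f))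

/-- The comma category `b / u` is coreflective in `(b, a) / (u × A)`. -/
def structuredArrowProdAdj (u : J ⥤ V) (b : V) (a : A) :
    structuredArrowProd A u b a ⊣ structuredArrowProdFst A u b a :=
  Adjunction.mkOfUnitCounit
    { unit :=
        { app := fun x => StructuredArrow.homMk (𝟙 x.right)
            ((congrArg (x.hom ≫ ·) (u.map_id _)).trans (Category.comp_id _))
          naturality := fun _ _ _ => StructuredArrow.hom_ext _ _
            ((Category.comp_id _).trans (Category.id_comp _).symm) }
      counit :=
        { app := fun x => StructuredArrow.homMk (Prod.mkHom (𝟙 x.right.1) x.hom.2)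
            (Prod.ext ((congrArg (x.hom.1 ≫ ·) (u.map_id _)).trans (Category.comp_id _))
              (Category.id_comp _))
          naturality := fun _ _ f => StructuredArrow.hom_ext _ _
            (Prod.ext ((Category.comp_id _).trans (Category.id_comp _).symm)
              ((Category.id_comp _).trans
                (congrArg (fun t => t.2) (StructuredArrow.w f)).symm)) }
      left_triangle := NatTrans.ext (funext fun _ => StructuredArrow.hom_ext _ _ <|
        Prod.ext ((Category.id_comp _).trans (Category.id_comp _))
          ((Category.id_comp _).trans (Category.id_comp _)))
      right_triangle := NatTrans.ext (funext fun _ => StructuredArrow.hom_ext _ _ <|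
        (Category.id_comp _).trans (Category.id_comp _)) }

/-- The inclusion `u / b ⥤ (u × A) / (b, a)`. -/
def costructuredArrowProd (u : J ⥤ V) (b : V) (a : A) :
    CostructuredArrow u b ⥤ CostructuredArrow (u.prod (𝟭 A)) ((b, a) : V × A) where
  obj x := CostructuredArrow.mk (Y := (x.left, a)) (Prod.mkHom x.hom (𝟙 a))
  map f := CostructuredArrow.homMk (Prod.mkHom f.left (𝟙 a))
    (Prod.ext (CostructuredArrow.w f) (Category.comp_id _))

/-- The retraction `(u × A) / (b, a) ⥤ u / b`. -/
def costructuredArrowProdFst (u : J ⥤ V) (b : V) (a : A) :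
    CostructuredArrow (u.prod (𝟭 A)) ((b, a) : V × A) ⥤ CostructuredArrow u b where
  obj x := CostructuredArrow.mk (Y := x.left.1) x.hom.1
  map f := CostructuredArrow.homMk f.left.1 (congrArg (fun t => t.1) (CostructuredArrow.w f))

/-- The comma category `u / b` is reflective in `(u × A) / (b, a)`. -/
def costructuredArrowProdAdj (u : J ⥤ V) (b : V) (a : A) :
    costructuredArrowProdFst A u b a ⊣ costructuredArrowProd A u b a :=
  Adjunction.mkOfUnitCounit
    { counit :=
        { app := fun x => CostructuredArrow.homMk (𝟙 x.left)
            ((congrArg (· ≫ x.hom) (u.map_id _)).trans (Category.id_comp _))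
          naturality := fun _ _ _ => CostructuredArrow.hom_ext _ _
            ((Category.comp_id _).trans (Category.id_comp _).symm) }
      unit :=
        { app := fun x => CostructuredArrow.homMk (Prod.mkHom (𝟙 x.left.1) x.hom.2)
            (Prod.ext ((congrArg (· ≫ x.hom.1) (u.map_id _)).trans (Category.id_comp _))
              (Category.comp_id _))
          naturality := fun _ _ f => CostructuredArrow.hom_ext _ _
            (Prod.ext ((Category.comp_id _).trans (Category.id_comp _).symm)
              ((congrArg (fun t => t.2) (CostructuredArrow.w f)).trans
                (Category.comp_id _).symm)) }
      left_triangle := NatTrans.ext (funext fun _ => CostructuredArrow.hom_ext _ _ <|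
        (Category.id_comp _).trans (Category.id_comp _))
      right_triangle := NatTrans.ext (funext fun _ => CostructuredArrow.hom_ext _ _ <|
        Prod.ext ((Category.id_comp _).trans (Category.id_comp _))
          ((congrArg (_ ≫ ·) (Category.id_comp _)).trans (Category.comp_id _))) }

/-- Restriction to a full subcategory is fully faithful on right Kan extensions. -/
theorem res_map_bijective_of_isRan {u : J ⥤ V} {X : D.Diag V}
    (h : D.IsRan u (d := 𝟭 V) (c := u) (𝟙 ((D.res u).obj X))) (Z : D.Diag V) :
    Function.Bijective fun f : Z ⟶ X => (D.res u).map f := by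
  have h1 := (isRan_iff_bijective _).1 h Z
  rw [← Function.Bijective.of_comp_iff _ (eqToIso (D.res_id_obj X)).symm.homToEquiv.bijective] at h1
  refine (congrArg Function.Bijective (funext fun f => ?_)).mp h1
  simp [rebase, resComp_inv_app, eqToHom_map]

/-- Restriction to a full subcategory is fully faithful on left Kan extensions. -/
theorem res_map_bijective_of_isLan {u : J ⥤ V} {X : D.Diag V}
    (h : D.IsLan u (d := 𝟭 V) (c := u) (𝟙 ((D.res u).obj X))) (Z : D.Diag V) :
    Function.Bijective fun f : X ⟶ Z => (D.res u).map f := by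
  have h1 := (isLan_iff_bijective _).1 h Z
  rw [← Function.Bijective.of_comp_iff _ (eqToIso (D.res_id_obj X)).symm.homFromEquiv.bijective] at h1
  refine (congrArg Function.Bijective (funext fun f => ?_)).mp h1
  simp [rebase, resComp_hom_app, eqToHom_map]

instance (u : J ⥤ V) [u.Full] : (u.prod (𝟭 A)).Full where
  map_surjective f := ⟨Prod.mkHom (u.preimage f.1) f.2, Prod.ext (u.map_preimage f.1) rfl⟩

instance (u : J ⥤ V) [u.Faithful] : (u.prod (𝟭 A)).Faithful where
  map_injective h := Prod.ext (u.map_injective (congrArg (fun t => t.1) h))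
    (congrArg (fun t => t.2) h)

variable [D.IsDerivator]

/-- A diagram in `D(V × A)` is a right Kan extension from `D(J × A)` if and only if its values in
`D(V)` are pointwise right Kan extensions. -/
theorem isRan_prod_iff (u : J ⥤ V) (X : D.Diag (V × A)) :
    D.IsRan (u.prod (𝟭 A)) (d := 𝟭 _) (c := u.prod (𝟭 A)) (𝟙 ((D.res (u.prod (𝟭 A))).obj X)) ↔
      ∀ (a : A) (b : V), IsLim ((D.res (slot V a)).obj X) (sliceRight u b) := by
  rw [isRan_id_iff_isLim, Prod.forall, forall_comm]
  refine forall_congr' fun a => forall_congr' fun b => ?_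
  rw [isLim_comp_leftAdjoint (structuredArrowProdAdj A u b a)]
  refine (isLim_res_iff (slot V a) X (sliceRight u b) _ (Iso.refl _) (Iso.refl _) fun j => ?_).symm
  exact (Category.comp_id _).trans (Category.id_comp _).symm

/-- A diagram in `D(V × A)` is a left Kan extension from `D(J × A)` if and only if its values in
`D(V)` are pointwise left Kan extensions. -/
theorem isLan_prod_iff (u : J ⥤ V) (X : D.Diag (V × A)) :
    D.IsLan (u.prod (𝟭 A)) (d := 𝟭 _) (c := u.prod (𝟭 A)) (𝟙 ((D.res (u.prod (𝟭 A))).obj X)) ↔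
      ∀ (a : A) (b : V), IsColim ((D.res (slot V a)).obj X) (sliceLeft u b) := by
  rw [isLan_id_iff_isColim, Prod.forall, forall_comm]
  refine forall_congr' fun a => forall_congr' fun b => ?_
  rw [isColim_comp_rightAdjoint (costructuredArrowProdAdj A u b a)]
  refine (isColim_res_iff (slot V a) X (sliceLeft u b) _ (Iso.refl _) (Iso.refl _) fun j => ?_).symm
  exact (Category.comp_id _).trans (Category.id_comp _).symm

end Extension

/-! ### Equivalences between full subcategories of coherent diagrams -/

section RestrictsTo

variable {D : Prederivator.{w, v, u}}
variable {K L M : Type w} [SmallCategory K] [SmallCategory L] [SmallCategory M]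

/-- For all `A`, restriction along `u × A` is an equivalence from the diagrams in `D(K × A)` whose
values satisfy `T` to the diagrams in `D(L × A)` whose values satisfy `T'`. The parameter category
`A` is needed because an equivalence of the derivators `D^K` and `D^L` is sought, not only of their
underlying categories. -/
structure RestrictsTo (u : L ⥤ K) (T : ObjectProperty (D.Diag K)) (T' : ObjectProperty (D.Diag L)) :
    Prop where
  prop (A : Type w) [SmallCategory A] (X : D.Diag (K × A)) (h : ∀ a, T ((D.res (slot K a)).obj X))
    (a : A) : T' ((D.res (slot L a)).obj ((D.res (u.prod (𝟭 A))).obj X))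
  bijective (A : Type w) [SmallCategory A] (X X' : D.Diag (K × A))
    (h : ∀ a, T ((D.res (slot K a)).obj X)) (h' : ∀ a, T ((D.res (slot K a)).obj X')) :
    Function.Bijective fun f : X ⟶ X' => (D.res (u.prod (𝟭 A))).map f
  exists_iso (A : Type w) [SmallCategory A] (Y : D.Diag (L × A))
    (h : ∀ a, T' ((D.res (slot L a)).obj Y)) : ∃ X : D.Diag (K × A),
      (∀ a, T ((D.res (slot K a)).obj X)) ∧ Nonempty ((D.res (u.prod (𝟭 A))).obj X ≅ Y)

theorem slot_res (u : L ⥤ K) {A : Type w} [SmallCategory A] (X : D.Diag (K × A)) (a : A) :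
    (D.res (slot L a)).obj ((D.res (u.prod (𝟭 A))).obj X) =
      (D.res u).obj ((D.res (slot K a)).obj X) :=
  (D.res_comp_obj (slot L a) (u.prod (𝟭 A)) X).symm.trans (D.res_comp_obj u (slot K a) X)

theorem RestrictsTo.comp {u : L ⥤ K} {u' : M ⥤ L} {T : ObjectProperty (D.Diag K)}
    {T' : ObjectProperty (D.Diag L)} {T'' : ObjectProperty (D.Diag M)}
    (h : RestrictsTo u T T') (h' : RestrictsTo u' T' T'') : RestrictsTo (u' ⋙ u) T T'' where
  prop A _ X hX a := by
    have h1 := h'.prop A _ (h.prop A X hX) a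
    rw [slot_res, slot_res, ← res_comp_obj] at h1
    rwa [slot_res]
  bijective A _ X X' hX hX' := by
    have h1 := (h'.bijective A _ _ (h.prop A X hX) (h.prop A X' hX')).comp
      (h.bijective A X X' hX hX')
    let e := (eqToIso (D.res_comp_obj (u'.prod (𝟭 A)) (u.prod (𝟭 A)) X)).homFromEquiv.trans
      (eqToIso (D.res_comp_obj (u'.prod (𝟭 A)) (u.prod (𝟭 A)) X')).homToEquiv
    rw [← Function.Bijective.of_comp_iff' e.bijective]
    refine (congrArg Function.Bijective (funext fun f => ?_)).mp h1
    refine Eq.trans ?_ (congrArg e (D.res_comp_map (u'.prod (𝟭 A)) (u.prod (𝟭 A)) f)).symm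
    simp [e]
  exists_iso A _ Y hY := by
    obtain ⟨X', hX', ⟨e'⟩⟩ := h'.exists_iso A Y hY
    obtain ⟨X, hX, ⟨e⟩⟩ := h.exists_iso A X' hX'
    exact ⟨X, hX, ⟨eqToIso (D.res_comp_obj (u'.prod (𝟭 A)) (u.prod (𝟭 A)) X) ≪≫
      (D.res (u'.prod (𝟭 A))).mapIso e ≪≫ e'⟩⟩

variable [D.IsDerivator] {T : ObjectProperty (D.Diag K)} {T' : ObjectProperty (D.Diag L)}
  [T'.IsClosedUnderIsomorphisms]

/-- The extension principle: if `T` says that the new values are limits and that the restriction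
satisfies `T'`, then right Kan extension is inverse to restriction. -/
theorem RestrictsTo.of_isLim (u : L ⥤ K) [u.Full] [u.Faithful]
    (hT : ∀ Y : D.Diag K, T Y ↔ T' ((D.res u).obj Y) ∧
      ∀ b, ¬ u.essImage b → IsLim Y (sliceRight u b)) : RestrictsTo u T T' := by
  have hran (A : Type w) [SmallCategory A] (X : D.Diag (K × A))
      (h : ∀ a, T ((D.res (slot K a)).obj X)) := (isRan_prod_iff A u X).2 fun a b => by
    by_cases hb : u.essImage b
    · exact isLim_sliceRight_of_iso u (Functor.essImage.getIso hb).symm _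
    · exact ((hT _).1 (h a)).2 b hb
  refine ⟨fun A _ X h a => ?_, fun A _ X X' h h' => ?_, fun A _ Y h => ?_⟩
  · rw [slot_res]
    exact ((hT _).1 (h a)).1
  · exact res_map_bijective_of_isRan (hran A X' h') X
  · obtain ⟨X, ⟨e⟩, hX⟩ := exists_isRan (u.prod (𝟭 A)) Y
    refine ⟨X, fun a => (hT _).2 ⟨?_, fun b _ => (isRan_prod_iff A u X).1 hX a b⟩, ⟨e⟩⟩
    rw [← slot_res]
    exact T'.prop_of_iso ((D.res (slot L a)).mapIso e.symm) (h a)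

/-- The dual extension principle: if `T` says that the new values are colimits and that the
restriction satisfies `T'`, then left Kan extension is inverse to restriction. -/
theorem RestrictsTo.of_isColim (u : L ⥤ K) [u.Full] [u.Faithful]
    (hT : ∀ Y : D.Diag K, T Y ↔ T' ((D.res u).obj Y) ∧
      ∀ b, ¬ u.essImage b → IsColim Y (sliceLeft u b)) : RestrictsTo u T T' := by
  have hlan (A : Type w) [SmallCategory A] (X : D.Diag (K × A))
      (h : ∀ a, T ((D.res (slot K a)).obj X)) := (isLan_prod_iff A u X).2 fun a b => by
    by_cases hb : u.essImage b
    · exact isColim_sliceLeft_of_iso u (Functor.essImage.getIso hb) _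
    · exact ((hT _).1 (h a)).2 b hb
  refine ⟨fun A _ X h a => ?_, fun A _ X X' h h' => ?_, fun A _ Y h => ?_⟩
  · rw [slot_res]
    exact ((hT _).1 (h a)).1
  · exact res_map_bijective_of_isLan (hlan A X h) X'
  · obtain ⟨X, ⟨e⟩, hX⟩ := exists_isLan (u.prod (𝟭 A)) Y
    refine ⟨X, fun a => (hT _).2 ⟨?_, fun b _ => (isLan_prod_iff A u X).1 hX a b⟩, ⟨e⟩⟩
    rw [← slot_res]
    exact T'.prop_of_iso ((D.res (slot L a)).mapIso e.symm) (h a)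

end RestrictsTo

/-! ### Limits of coherent diagrams on preorders -/

section Preorder

variable {D : Prederivator.{w, v, u}}
variable {J J' V K : Type w} [SmallCategory J] [SmallCategory J'] [SmallCategory V] [SmallCategory K]

theorem isRan_id_res_iff (u : J ⥤ V) (g : V ⥤ K) (X : D.Diag K) :
    D.IsRan u (d := 𝟭 V) (c := u) (𝟙 ((D.res u).obj ((D.res g).obj X))) ↔
      D.IsRan u (d := g) (c := u ⋙ g) (𝟙 ((D.res (u ⋙ g)).obj X)) := by
  refine isRan_congr (rebase (𝟭 V) g X) (rebase u g X).symm ?_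
  rw [pull_rebase_hom]
  refine ((congrArg (_ ≫ ·) (Category.id_comp _)).trans ?_).symm
  exact (rebase u g X).hom_inv_id

theorem isLan_id_res_iff (u : J ⥤ V) (g : V ⥤ K) (X : D.Diag K) :
    D.IsLan u (d := 𝟭 V) (c := u) (𝟙 ((D.res u).obj ((D.res g).obj X))) ↔
      D.IsLan u (d := g) (c := u ⋙ g) (𝟙 ((D.res (u ⋙ g)).obj X)) := by
  refine isLan_congr (rebase (𝟭 V) g X).symm (rebase u g X) ?_
  refine Eq.trans ?_ (congrArg (fun t => _ ≫ _ ≫ t) (pull_rebase_inv u (𝟭 V) g X).symm)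
  refine ((congrArg (_ ≫ ·) (Category.id_comp _)).trans ?_).symm
  exact (rebase u g X).hom_inv_id

/-- An adjunction between categories in which all diagrams commute. -/
def thinAdjunction [Quiver.IsThin J] [Quiver.IsThin J'] {F : J ⥤ J'} {G : J' ⥤ J}
    (η : ∀ j, j ⟶ G.obj (F.obj j)) (κ : ∀ j, F.obj (G.obj j) ⟶ j) : F ⊣ G :=
  Adjunction.mkOfUnitCounit
    { unit := { app := η, naturality := fun _ _ _ => Subsingleton.elim _ _ }
      counit := { app := κ, naturality := fun _ _ _ => Subsingleton.elim _ _ }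
      left_triangle := NatTrans.ext (funext fun _ => Subsingleton.elim _ _)
      right_triangle := NatTrans.ext (funext fun _ => Subsingleton.elim _ _) }

variable {U : Type w} [Preorder U]

/-- The natural transformation between functors to a preorder given by inequalities. -/
def natOfLE {F G : J ⥤ U} (h : ∀ j, F.obj j ≤ G.obj j) : F ⟶ G where
  app j := homOfLE (h j)
  naturality _ _ _ := Subsingleton.elim _ _

instance {F G : J ⥤ U} : Subsingleton (F ⟶ G) :=
  ⟨fun _ _ => NatTrans.ext (funext fun _ => Subsingleton.elim _ _)⟩

theorem isIso_of_le {F G : J ⥤ U} (α : F ⟶ G) (h : ∀ j, G.obj j ≤ F.obj j) : IsIso α :=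
  ⟨natOfLE h, Subsingleton.elim _ _, Subsingleton.elim _ _⟩

/-- The value of `X` at `a` is the limit of the values at the elements above `a` which
satisfy `Q`. -/
def LimAt (X : D.Diag U) (Q : U → Prop) (a : U) : Prop :=
  IsLim X (J := {q : U // Q q ∧ a ≤ q}) (b := a) (c := (Subtype.mono_coe _).functor)
    (natOfLE fun q => q.2.2)

/-- The value of `X` at `a` is the colimit of the values at the elements below `a` which
satisfy `Q`. -/
def ColAt (X : D.Diag U) (Q : U → Prop) (a : U) : Prop :=
  IsColim X (J := {q : U // Q q ∧ q ≤ a}) (b := a) (c := (Subtype.mono_coe _).functor)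
    (natOfLE fun q => q.2.2)

variable {X : D.Diag U} {Q Q₀ : U → Prop} {a : U}

/-- The limit may be computed over a coreflective part. -/
theorem limAt_iff_of_greatest (h : ∀ q, Q₀ q → a ≤ q → Q q)
    (hm : ∀ q, Q q → a ≤ q → ∃ m, Q₀ m ∧ a ≤ m ∧ m ≤ q ∧ ∀ m', Q₀ m' → a ≤ m' → m' ≤ q → m' ≤ m) :
    LimAt X Q a ↔ LimAt X Q₀ a := by
  choose m h1 h2 h3 h4 using hm
  let i : {q : U // Q₀ q ∧ a ≤ q} → {q : U // Q q ∧ a ≤ q} := fun q => ⟨q.1, h _ q.2.1 q.2.2, q.2.2⟩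
  let r : {q : U // Q q ∧ a ≤ q} → {q : U // Q₀ q ∧ a ≤ q} := fun q =>
    ⟨m q.1 q.2.1 q.2.2, h1 _ _ _, h2 _ _ _⟩
  have gc : GaloisConnection i r := fun x y =>
    ⟨fun hxy => h4 _ _ _ _ x.2.1 x.2.2 hxy, fun hxy => le_trans (b := (r y).1) hxy (h3 _ _ _)⟩
  exact isLim_comp_leftAdjoint gc.adjunction X _

/-- The colimit may be computed over a reflective part. -/
theorem colAt_iff_of_least (h : ∀ q, Q₀ q → q ≤ a → Q q)
    (hm : ∀ q, Q q → q ≤ a → ∃ m, Q₀ m ∧ m ≤ a ∧ q ≤ m ∧ ∀ m', Q₀ m' → m' ≤ a → q ≤ m' → m ≤ m') :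
    ColAt X Q a ↔ ColAt X Q₀ a := by
  choose m h1 h2 h3 h4 using hm
  let i : {q : U // Q₀ q ∧ q ≤ a} → {q : U // Q q ∧ q ≤ a} := fun q => ⟨q.1, h _ q.2.1 q.2.2, q.2.2⟩
  let r : {q : U // Q q ∧ q ≤ a} → {q : U // Q₀ q ∧ q ≤ a} := fun q =>
    ⟨m q.1 q.2.1 q.2.2, h1 _ _ _, h2 _ _ _⟩
  have gc : GaloisConnection r i := fun x y =>
    ⟨fun hxy => le_trans (b := (r x).1) (h3 _ _ _) hxy, fun hxy => h4 _ _ _ _ y.2.1 y.2.2 hxy⟩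
  exact isColim_comp_rightAdjoint gc.adjunction X _

theorem limAt_congr (h : ∀ q, a ≤ q → (Q q ↔ Q₀ q)) : LimAt X Q a ↔ LimAt X Q₀ a :=
  limAt_iff_of_greatest (fun q hq ha => (h q ha).2 hq)
    fun q hq ha => ⟨q, (h q ha).1 hq, ha, le_rfl, fun _ _ _ h => h⟩

theorem colAt_congr (h : ∀ q, q ≤ a → (Q q ↔ Q₀ q)) : ColAt X Q a ↔ ColAt X Q₀ a :=
  colAt_iff_of_least (fun q hq ha => (h q ha).2 hq)
    fun q hq ha => ⟨q, (h q ha).1 hq, ha, le_rfl, fun _ _ _ h => h⟩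

instance {L : Type w} [SmallCategory L] [Quiver.IsThin L] (b : V) (u : L ⥤ V) :
    Quiver.IsThin (StructuredArrow b u) :=
  fun _ _ => ⟨fun _ _ => StructuredArrow.hom_ext _ _ (Subsingleton.elim _ _)⟩

instance {L : Type w} [SmallCategory L] [Quiver.IsThin L] (b : V) (u : L ⥤ V) :
    Quiver.IsThin (CostructuredArrow u b) :=
  fun _ _ => ⟨fun _ _ => CostructuredArrow.hom_ext _ _ (Subsingleton.elim _ _)⟩

section Singleton

variable {a b : U}

theorem limAt_self (h : Q a) : LimAt X Q a := by
  refine (isRan_star_iff (J := {q : U // Q q ∧ a ≤ q}) (j := ⟨a, h, le_rfl⟩)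
    (IsInitial.ofUniqueHom (fun x => homOfLE x.2.2) (fun _ _ => Subsingleton.elim _ _)) _).2 ?_
  rw [pull_res₂]
  have := isIso_of_le (Functor.whiskerLeft (pt (⟨a, h, le_rfl⟩ : {q : U // Q q ∧ a ≤ q}))
    (natOfLE (F := Functor.star.{w} _ ⋙ pt a) (G := (Subtype.mono_coe _).functor)
      fun q => q.2.2)) (fun _ => le_rfl)
  infer_instance

theorem colAt_self (h : Q a) : ColAt X Q a := by
  refine (isLan_star_iff (J := {q : U // Q q ∧ q ≤ a}) (j := ⟨a, h, le_rfl⟩)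
    (IsTerminal.ofUniqueHom (fun x => homOfLE x.2.2) (fun _ _ => Subsingleton.elim _ _)) _).2 ?_
  rw [pull_res₂]
  have := isIso_of_le (Functor.whiskerLeft (pt (⟨a, h, le_rfl⟩ : {q : U // Q q ∧ q ≤ a}))
    (natOfLE (G := Functor.star.{w} _ ⋙ pt a) (F := (Subtype.mono_coe _).functor)
      fun q => q.2.2)) (fun _ => le_rfl)
  infer_instance

/-- The limit over a single element is the value there. -/
theorem limAt_singleton_iff (h : a ≤ b) : LimAt X (· = b) a ↔
    IsIso ((D.res₂ (natOfLE (F := pt a) (G := pt b) fun _ => h)).app X) := by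
  refine (isRan_star_iff (J := {q : U // q = b ∧ a ≤ q}) (j := ⟨b, rfl, h⟩)
    (IsInitial.ofUniqueHom (fun x => homOfLE x.2.1.ge) (fun _ _ => Subsingleton.elim _ _)) _).trans ?_
  rw [pull_res₂]
  rfl

/-- The colimit over a single element is the value there. -/
theorem colAt_singleton_iff (h : a ≤ b) : ColAt X (· = a) b ↔
    IsIso ((D.res₂ (natOfLE (F := pt a) (G := pt b) fun _ => h)).app X) := by
  refine (isLan_star_iff (J := {q : U // q = a ∧ q ≤ b}) (j := ⟨a, rfl, h⟩)
    (IsTerminal.ofUniqueHom (fun x => homOfLE x.2.1.le) (fun _ _ => Subsingleton.elim _ _)) _).trans ?_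
  rw [pull_res₂]
  rfl

end Singleton

variable [D.IsDerivator]

/-- Transitivity of limits: elements at which the diagram is itself the limit over `Q₀` may be
omitted. -/
theorem limAt_iff_of_limAt (h : ∀ q, Q₀ q → a ≤ q → Q q)
    (hq : ∀ q, Q q → a ≤ q → ¬ Q₀ q → LimAt X Q₀ q) : LimAt X Q a ↔ LimAt X Q₀ a := by
  let J := {q : U // Q q ∧ a ≤ q}
  let J₀ := {q : U // Q₀ q ∧ a ≤ q}
  let i' : J₀ → J := fun q => ⟨q.1, h _ q.2.1 q.2.2, q.2.2⟩
  have hi' : Monotone i' := fun _ _ h => h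
  let i : J₀ ⥤ J := hi'.functor
  let c : J ⥤ U := (Subtype.mono_coe _).functor
  refine isLim_comp_of_isRan i X ?_ _
  refine (isRan_id_res_iff i c X).1 ((isRan_id_iff_isLim i _).2 fun q => ?_)
  refine (isLim_res_iff c X (sliceRight i q) (b' := q.1) (c' := StructuredArrow.proj q i ⋙ i ⋙ c)
    (natOfLE fun x => leOfHom x.hom) (Iso.refl _) (Iso.refl _)
    (fun _ => Subsingleton.elim _ _)).2 ?_
  let F' : StructuredArrow q i → {q' : U // Q₀ q' ∧ q.1 ≤ q'} :=
    fun x => ⟨x.right.1, x.right.2.1, leOfHom x.hom⟩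
  let F : StructuredArrow q i ⥤ {q' : U // Q₀ q' ∧ q.1 ≤ q'} :=
    { obj := F', map := fun f => homOfLE (leOfHom f.right) }
  let G : {q' : U // Q₀ q' ∧ q.1 ≤ q'} ⥤ StructuredArrow q i :=
    { obj := fun x => StructuredArrow.mk (Y := (⟨x.1, x.2.1, q.2.2.trans x.2.2⟩ : J₀))
        (homOfLE (show q.1 ≤ x.1 from x.2.2))
      map := fun f => StructuredArrow.homMk (homOfLE (leOfHom f)) (Subsingleton.elim _ _) }
  have adj : F ⊣ G := thinAdjunction (fun x => StructuredArrow.homMk (𝟙 x.right)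
    (Subsingleton.elim _ _)) (fun x => 𝟙 x)
  have hlim : LimAt X Q₀ q.1 := by
    by_cases hq₀ : Q₀ q.1
    · exact limAt_self hq₀
    · exact hq _ q.2.1 q.2.2 hq₀
  exact (isLim_comp_leftAdjoint adj X _).1 hlim

/-- Transitivity of colimits: elements at which the diagram is itself the colimit over `Q₀` may be
omitted. -/
theorem colAt_iff_of_colAt (h : ∀ q, Q₀ q → q ≤ a → Q q)
    (hq : ∀ q, Q q → q ≤ a → ¬ Q₀ q → ColAt X Q₀ q) : ColAt X Q a ↔ ColAt X Q₀ a := by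
  let J := {q : U // Q q ∧ q ≤ a}
  let J₀ := {q : U // Q₀ q ∧ q ≤ a}
  let i' : J₀ → J := fun q => ⟨q.1, h _ q.2.1 q.2.2, q.2.2⟩
  have hi' : Monotone i' := fun _ _ h => h
  let i : J₀ ⥤ J := hi'.functor
  let c : J ⥤ U := (Subtype.mono_coe _).functor
  refine isColim_comp_of_isLan i X ?_ _
  refine (isLan_id_res_iff i c X).1 ((isLan_id_iff_isColim i _).2 fun q => ?_)
  refine (isColim_res_iff c X (sliceLeft i q) (b' := q.1) (c' := CostructuredArrow.proj i q ⋙ i ⋙ c)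
    (natOfLE fun x => leOfHom x.hom) (Iso.refl _) (Iso.refl _)
    (fun _ => Subsingleton.elim _ _)).2 ?_
  let F' : CostructuredArrow i q → {q' : U // Q₀ q' ∧ q' ≤ q.1} :=
    fun x => ⟨x.left.1, x.left.2.1, leOfHom x.hom⟩
  let F : CostructuredArrow i q ⥤ {q' : U // Q₀ q' ∧ q' ≤ q.1} :=
    { obj := F', map := fun f => homOfLE (leOfHom f.left) }
  let G : {q' : U // Q₀ q' ∧ q' ≤ q.1} ⥤ CostructuredArrow i q :=
    { obj := fun x => CostructuredArrow.mk (Y := (⟨x.1, x.2.1, x.2.2.trans q.2.2⟩ : J₀))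
        (homOfLE (show x.1 ≤ q.1 from x.2.2))
      map := fun f => CostructuredArrow.homMk (homOfLE (leOfHom f)) (Subsingleton.elim _ _) }
  have adj : G ⊣ F := thinAdjunction (fun x => 𝟙 x) (fun x => CostructuredArrow.homMk (𝟙 x.left)
    (Subsingleton.elim _ _))
  have hlim : ColAt X Q₀ q.1 := by
    by_cases hq₀ : Q₀ q.1
    · exact colAt_self hq₀
    · exact hq _ q.2.1 q.2.2 hq₀
  exact (isColim_comp_rightAdjoint adj X _).1 hlim

/-- In a pointed derivator, there is exactly one morphism between any two diagrams of empty
shape. -/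
theorem nonempty_unique_of_isEmpty [IsEmpty J] [HasZeroObject (D.Diag Pt.{w})] (W W' : D.Diag J) :
    Nonempty (Unique (W ⟶ W')) := by
  open ZeroObject in
  let W₀ : D.Diag J := (D.res (Functor.star.{w} J)).obj 0
  have adj := Adjunction.ofIsLeftAdjoint (D.res (Functor.star.{w} J))
  have h (W : D.Diag J) : Nonempty (Unique (W₀ ⟶ W)) :=
    ⟨(adj.homEquiv _ _).unique (β := (0 ⟶ (D.res (Functor.star.{w} J)).rightAdjoint.obj W))⟩
  have hW : IsIso (h W).some.default := IsDerivator.der2 J _ fun a => isEmptyElim a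
  have := (h W').some
  exact ⟨(asIso (h W).some.default).homFromEquiv.symm.unique⟩

omit [D.IsDerivator] in
theorem isZero_of_bijective_to {V : D.Diag Pt.{w}} [HasZeroObject (D.Diag Pt.{w})]
    (h : ∀ Z : D.Diag Pt.{w}, Nonempty (Unique ((D.res (𝟭 Pt.{w})).obj Z ⟶ V))) : IsZero V := by
  open ZeroObject in
  have hV : IsTerminal V := IsTerminal.ofUniqueHom
    (fun Z => eqToHom (D.res_id_obj Z).symm ≫ (h Z).some.default)
    (fun Z m => by
      have := (h Z).some.uniq (eqToHom (D.res_id_obj Z) ≫ m)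
      rw [← this]; simp)
  exact (isZero_zero _).of_iso (hV.uniqueUpToIso HasZeroObject.zeroIsTerminal)

omit [D.IsDerivator] in
theorem isZero_of_bijective_from {V : D.Diag Pt.{w}} [HasZeroObject (D.Diag Pt.{w})]
    (h : ∀ Z : D.Diag Pt.{w}, Nonempty (Unique (V ⟶ (D.res (𝟭 Pt.{w})).obj Z))) : IsZero V := by
  open ZeroObject in
  have hV : IsInitial V := IsInitial.ofUniqueHom
    (fun Z => (h Z).some.default ≫ eqToHom (D.res_id_obj Z))
    (fun Z m => by
      have := (h Z).some.uniq (m ≫ eqToHom (D.res_id_obj Z).symm)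
      rw [← this]; simp)
  exact (isZero_zero _).of_iso (hV.uniqueUpToIso HasZeroObject.zeroIsInitial)

/-- The limit of the empty diagram is the zero object. -/
theorem limAt_iff_isZero [HasZeroObject (D.Diag Pt.{w})] (h : ∀ q, Q q → ¬ a ≤ q) :
    LimAt X Q a ↔ IsZero ((D.eval a).obj X) := by
  have : IsEmpty {q : U // Q q ∧ a ≤ q} := ⟨fun q => h _ q.2.1 q.2.2⟩
  have hu (Z : D.Diag Pt.{w}) := (nonempty_unique_of_isEmpty
    ((D.res (Functor.star.{w} {q : U // Q q ∧ a ≤ q})).obj Z)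
    ((D.res (Subtype.mono_coe fun q => Q q ∧ a ≤ q).functor).obj X)).some
  refine ⟨fun hl => isZero_of_bijective_to fun Z => ?_, fun hz Z => ?_⟩
  · have := hu Z
    exact ⟨(Equiv.ofBijective _ (hl Z)).unique⟩
  · have := hu Z
    have := hz.unique_from ((D.res (𝟭 Pt.{w})).obj Z) |>.some
    exact ⟨fun _ _ _ => Subsingleton.elim _ _, fun g => ⟨default, Subsingleton.elim _ _⟩⟩

/-- The colimit of the empty diagram is the zero object. -/
theorem colAt_iff_isZero [HasZeroObject (D.Diag Pt.{w})] (h : ∀ q, Q q → ¬ q ≤ a) :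
    ColAt X Q a ↔ IsZero ((D.eval a).obj X) := by
  have : IsEmpty {q : U // Q q ∧ q ≤ a} := ⟨fun q => h _ q.2.1 q.2.2⟩
  have hu (Z : D.Diag Pt.{w}) := (nonempty_unique_of_isEmpty
    ((D.res (Subtype.mono_coe fun q => Q q ∧ q ≤ a).functor).obj X)
    ((D.res (Functor.star.{w} {q : U // Q q ∧ q ≤ a})).obj Z)).some
  refine ⟨fun hl => isZero_of_bijective_from fun Z => ?_, fun hz Z => ?_⟩
  · have := hu Z
    exact ⟨(Equiv.ofBijective _ (hl Z)).unique⟩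
  · have := hu Z
    have := hz.unique_to ((D.res (𝟭 Pt.{w})).obj Z) |>.some
    exact ⟨fun _ _ _ => Subsingleton.elim _ _, fun g => ⟨default, Subsingleton.elim _ _⟩⟩

end Preorder

/-! ### Cartesian and cocartesian squares -/

section Square

variable {D : Prederivator.{w, v, u}} [D.IsDerivator]
variable {J V : Type w} [SmallCategory J] [SmallCategory V]

instance (x y : Square.{w}) : Subsingleton (x ⟶ y) :=
  inferInstanceAs (Subsingleton ((x.1 ⟶ y.1) × (x.2 ⟶ y.2)))

instance (P : ObjectProperty Square.{w}) (x y : P.FullSubcategory) : Subsingleton (x ⟶ y) :=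
  ⟨fun _ _ => ObjectProperty.hom_ext _ (Subsingleton.elim _ _)⟩

theorem arr1_ne_arr0 : (arr1 : Arr.{w}) ≠ arr0 := fun h =>
  absurd (congrArg ULift.down h : (1 : Fin 2) = 0) (by decide)

theorem square_cases (x : Square.{w}) : x = (arr0, arr0) ∨ x = (arr1, arr0) ∨ x = (arr0, arr1) ∨
    x = (arr1, arr1) := by
  obtain ⟨⟨x⟩, ⟨y⟩⟩ := x
  fin_cases x <;> fin_cases y <;> simp [arr0, arr1, AsSmall.up]

/-- A square is cartesian if and only if its initial vertex is the limit over the other three. -/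
theorem isCartesian_iff_isLim (X : D.Diag Square.{w}) :
    D.IsCartesian X ↔ IsLim X (sliceRight lrInc.{w} (arr0, arr0)) := by
  refine (essImage_ran_iff _ X).trans ((isRan_id_iff_isLim _ X).trans ⟨fun h => h _, fun h b => ?_⟩)
  by_cases hb : b = (arr0, arr0)
  · rw [hb]
    exact h
  · exact isLim_sliceRight_of_iso lrInc.{w} (j := ⟨b, hb⟩) (Iso.refl _) X

/-- A square is cocartesian if and only if its final vertex is the colimit over the other three. -/
theorem isCocartesian_iff_isColim (X : D.Diag Square.{w}) :
    D.IsCocartesian X ↔ IsColim X (sliceLeft ulInc.{w} (arr1, arr1)) := by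
  refine (essImage_lan_iff _ X).trans ((isLan_id_iff_isColim _ X).trans ⟨fun h => h _, fun h b => ?_⟩)
  by_cases hb : b = (arr1, arr1)
  · rw [hb]
    exact h
  · exact isColim_sliceLeft_of_iso ulInc.{w} (j := ⟨b, hb⟩) (Iso.refl _) X

variable {U : Type w} [Preorder U]

/-- The vertices of the square with top row `a, b` and bottom row `c, d`. The first coordinate is
the horizontal one. -/
def sqObj (a b c d : U) : Fin 2 → Fin 2 → U := ![![a, c], ![b, d]]

variable {a b c d : U}

theorem sqObj_mono (hab : a ≤ b) (hac : a ≤ c) (hbd : b ≤ d) (hcd : c ≤ d) {i j i' j' : Fin 2}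
    (hi : i ≤ i') (hj : j ≤ j') : sqObj a b c d i j ≤ sqObj a b c d i' j' := by
  have had := hab.trans hbd
  fin_cases i <;> fin_cases i' <;> fin_cases j <;> fin_cases j' <;>
    simp_all [sqObj]

/-- The square in a preorder with top row `a ≤ b` and bottom row `c ≤ d`. -/
def sq (hab : a ≤ b) (hac : a ≤ c) (hbd : b ≤ d) (hcd : c ≤ d) : Square.{w} ⥤ U where
  obj x := sqObj a b c d (ULift.down x.1) (ULift.down x.2)
  map f := homOfLE (sqObj_mono hab hac hbd hcd (leOfHom (ULift.down f.1))
    (leOfHom (ULift.down f.2)))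

/-- The morphism of the square given by inequalities. -/
def squareHom {x y : Square.{w}} (h₁ : (ULift.down x.1 : Fin 2) ≤ ULift.down y.1)
    (h₂ : (ULift.down x.2 : Fin 2) ≤ ULift.down y.2) : x ⟶ y :=
  Prod.mkHom (ULift.up (homOfLE h₁)) (ULift.up (homOfLE h₂))

/-- The lower right corner of a square is a full subposet when `b` and `c` are incomparable. -/
theorem nonempty_hom_lrcorner (hab : a ≤ b) (hac : a ≤ c) (hbd : b ≤ d) (hcd : c ≤ d)
    (hbc : ¬ b ≤ c) (hcb : ¬ c ≤ b) {x y : Square.{w}} (hx : x ≠ (arr0, arr0))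
    (hy : y ≠ (arr0, arr0)) (h : (sq hab hac hbd hcd).obj x ≤ (sq hab hac hbd hcd).obj y) :
    Nonempty (x ⟶ y) := by
  have hdb : ¬ d ≤ b := fun h => hcb (hcd.trans h)
  have hdc : ¬ d ≤ c := fun h => hbc (hbd.trans h)
  rcases square_cases x with rfl | rfl | rfl | rfl <;>
    rcases square_cases y with rfl | rfl | rfl | rfl <;>
    first
      | exact absurd rfl hx
      | exact absurd rfl hy
      | exact absurd h hbc
      | exact absurd h hcb
      | exact absurd h hdb
      | exact absurd h hdc
      | exact ⟨squareHom (by decide) (by decide)⟩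

/-- The upper left corner of a square is a full subposet when `b` and `c` are incomparable. -/
theorem nonempty_hom_ulcorner (hab : a ≤ b) (hac : a ≤ c) (hbd : b ≤ d) (hcd : c ≤ d)
    (hbc : ¬ b ≤ c) (hcb : ¬ c ≤ b) {x y : Square.{w}} (hx : x ≠ (arr1, arr1))
    (hy : y ≠ (arr1, arr1)) (h : (sq hab hac hbd hcd).obj x ≤ (sq hab hac hbd hcd).obj y) :
    Nonempty (x ⟶ y) := by
  have hba : ¬ b ≤ a := fun h => hbc (h.trans hac)
  have hca : ¬ c ≤ a := fun h => hcb (h.trans hab)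
  rcases square_cases x with rfl | rfl | rfl | rfl <;>
    rcases square_cases y with rfl | rfl | rfl | rfl <;>
    first
      | exact absurd rfl hx
      | exact absurd rfl hy
      | exact absurd h hbc
      | exact absurd h hcb
      | exact absurd h hba
      | exact absurd h hca
      | exact ⟨squareHom (by decide) (by decide)⟩

/-- A square of values of a diagram on a preorder is cartesian if and only if the value at its
least vertex is the limit over the other three. -/
theorem isCartesian_sq_iff (hab : a ≤ b) (hac : a ≤ c) (hbd : b ≤ d) (hcd : c ≤ d)
    (hbc : ¬ b ≤ c) (hcb : ¬ c ≤ b) (X : D.Diag U) :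
    D.IsCartesian ((D.res (sq hab hac hbd hcd)).obj X) ↔
      LimAt X (fun q => q = b ∨ q = c ∨ q = d) a := by
  rw [isCartesian_iff_isLim]
  let u := sq hab hac hbd hcd
  let S := StructuredArrow ((arr0, arr0) : Square.{w}) lrInc.{w}
  have hS (x : S) : a ≤ u.obj x.right.obj := leOfHom (u.map x.hom)
  refine (isLim_res_iff u X _ (b' := a) (c' := StructuredArrow.proj _ lrInc.{w} ⋙ lrInc ⋙ u)
    (natOfLE hS) (Iso.refl _) (Iso.refl _) (fun _ => Subsingleton.elim _ _)).trans ?_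
  have hQ (x : Square.{w}) (hx : x ≠ (arr0, arr0)) :
      u.obj x = b ∨ u.obj x = c ∨ u.obj x = d := by
    rcases square_cases x with rfl | rfl | rfl | rfl
    exacts [absurd rfl hx, Or.inl rfl, Or.inr (Or.inl rfl), Or.inr (Or.inr rfl)]
  let F : S ⥤ {q : U // (q = b ∨ q = c ∨ q = d) ∧ a ≤ q} :=
    { obj := fun x => ⟨u.obj x.right.obj, hQ _ x.right.property, hS x⟩
      map := fun f => homOfLE (leOfHom (u.map f.right.hom)) }
  have : Quiver.IsThin S := inferInstanceAs (Quiver.IsThin (StructuredArrow _ lrInc.{w}))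
  have : F.Faithful := ⟨fun _ => Subsingleton.elim _ _⟩
  have : F.Full := ⟨fun {x y} f => ⟨StructuredArrow.homMk (ObjectProperty.homMk
    (nonempty_hom_lrcorner hab hac hbd hcd hbc hcb x.right.property y.right.property
      (leOfHom f)).some) (Subsingleton.elim _ _), Subsingleton.elim _ _⟩⟩
  have : F.EssSurj := ⟨by
    rintro ⟨q, rfl | rfl | rfl, hq⟩
    · exact ⟨StructuredArrow.mk (Y := (⟨(arr1, arr0), by simp [arr1_ne_arr0]⟩ : Lrcorner.{w}))
        (squareHom (by decide) (by decide)), ⟨Iso.refl _⟩⟩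
    · exact ⟨StructuredArrow.mk (Y := (⟨(arr0, arr1), by simp [arr1_ne_arr0]⟩ : Lrcorner.{w}))
        (squareHom (by decide) (by decide)), ⟨Iso.refl _⟩⟩
    · exact ⟨StructuredArrow.mk (Y := (⟨(arr1, arr1), by simp [arr1_ne_arr0]⟩ : Lrcorner.{w}))
        (squareHom (by decide) (by decide)), ⟨Iso.refl _⟩⟩⟩
  have : F.IsEquivalence := {}
  exact (isLim_comp_leftAdjoint (i := F) F.asEquivalence.toAdjunction X (b := a)
    (c := (Subtype.mono_coe _).functor) (natOfLE fun q => q.2.2)).symm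

/-- A square of values of a diagram on a preorder is cocartesian if and only if the value at its
greatest vertex is the colimit over the other three. -/
theorem isCocartesian_sq_iff (hab : a ≤ b) (hac : a ≤ c) (hbd : b ≤ d) (hcd : c ≤ d)
    (hbc : ¬ b ≤ c) (hcb : ¬ c ≤ b) (X : D.Diag U) :
    D.IsCocartesian ((D.res (sq hab hac hbd hcd)).obj X) ↔
      ColAt X (fun q => q = a ∨ q = b ∨ q = c) d := by
  rw [isCocartesian_iff_isColim]
  let u := sq hab hac hbd hcd
  let S := CostructuredArrow ulInc.{w} ((arr1, arr1) : Square.{w})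
  have hS (x : S) : u.obj x.left.obj ≤ d := leOfHom (u.map x.hom)
  refine (isColim_res_iff u X _ (b' := d) (c' := CostructuredArrow.proj ulInc.{w} _ ⋙ ulInc ⋙ u)
    (natOfLE hS) (Iso.refl _) (Iso.refl _) (fun _ => Subsingleton.elim _ _)).trans ?_
  have hQ (x : Square.{w}) (hx : x ≠ (arr1, arr1)) :
      u.obj x = a ∨ u.obj x = b ∨ u.obj x = c := by
    rcases square_cases x with rfl | rfl | rfl | rfl
    exacts [Or.inl rfl, Or.inr (Or.inl rfl), Or.inr (Or.inr rfl), absurd rfl hx]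
  let F : S ⥤ {q : U // (q = a ∨ q = b ∨ q = c) ∧ q ≤ d} :=
    { obj := fun x => ⟨u.obj x.left.obj, hQ _ x.left.property, hS x⟩
      map := fun f => homOfLE (leOfHom (u.map f.left.hom)) }
  have : Quiver.IsThin S := inferInstanceAs (Quiver.IsThin (CostructuredArrow ulInc.{w} _))
  have : F.Faithful := ⟨fun _ => Subsingleton.elim _ _⟩
  have : F.Full := ⟨fun {x y} f => ⟨CostructuredArrow.homMk (ObjectProperty.homMk
    (nonempty_hom_ulcorner hab hac hbd hcd hbc hcb x.left.property y.left.property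
      (leOfHom f)).some) (Subsingleton.elim _ _), Subsingleton.elim _ _⟩⟩
  have : F.EssSurj := ⟨by
    rintro ⟨q, rfl | rfl | rfl, hq⟩
    · exact ⟨CostructuredArrow.mk (Y := (⟨(arr0, arr0), by simp [arr1_ne_arr0.symm]⟩ : Ulcorner.{w}))
        (squareHom (by decide) (by decide)), ⟨Iso.refl _⟩⟩
    · exact ⟨CostructuredArrow.mk (Y := (⟨(arr1, arr0), by simp [arr1_ne_arr0.symm]⟩ : Ulcorner.{w}))
        (squareHom (by decide) (by decide)), ⟨Iso.refl _⟩⟩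
    · exact ⟨CostructuredArrow.mk (Y := (⟨(arr0, arr1), by simp [arr1_ne_arr0.symm]⟩ : Ulcorner.{w}))
        (squareHom (by decide) (by decide)), ⟨Iso.refl _⟩⟩⟩
  have : F.IsEquivalence := {}
  exact (isColim_comp_rightAdjoint (i := F) F.asEquivalence.symm.toAdjunction X (b := d)
    (c := (Subtype.mono_coe _).functor) (natOfLE fun q => q.2.2)).symm

end Square

/-! ### Bicartesian squares in stable derivators -/

section BiCart

variable {D : Prederivator.{w, v, u}} [D.IsDerivator]
variable {U V : Type w} [Preorder U] [Preorder V]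

/-- The values of `X` at `a, b, c, d` form a cocartesian square with top row `a, b` and bottom
row `c, d`. In a stable derivator such squares are bicartesian. -/
def BiCart (X : D.Diag U) (a b c d : U) : Prop :=
  ∃ (hab : a ≤ b) (hac : a ≤ c) (hbd : b ≤ d) (hcd : c ≤ d),
    D.IsCocartesian ((D.res (sq hab hac hbd hcd)).obj X)

theorem isCocartesian_of_iso {X Y : D.Diag Square.{w}} (e : X ≅ Y) (h : D.IsCocartesian X) :
    D.IsCocartesian Y :=
  (D.lan ulInc).essImage.prop_of_iso e h

theorem biCart_of_iso {X Y : D.Diag U} {a b c d : U} (e : X ≅ Y) (h : BiCart X a b c d) :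
    BiCart Y a b c d := by
  obtain ⟨h1, h2, h3, h4, h⟩ := h
  exact ⟨h1, h2, h3, h4, isCocartesian_of_iso ((D.res _).mapIso e) h⟩

theorem biCart_res_iff {f : V → U} (hf : Monotone f) (X : D.Diag U) {a b c d : V}
    (hab : a ≤ b) (hac : a ≤ c) (hbd : b ≤ d) (hcd : c ≤ d) :
    BiCart ((D.res hf.functor).obj X) a b c d ↔ BiCart X (f a) (f b) (f c) (f d) := by
  let e : sq hab hac hbd hcd ⋙ hf.functor ≅ sq (hf hab) (hf hac) (hf hbd) (hf hcd) :=
    { hom := natOfLE fun x => by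
        rcases square_cases x with rfl | rfl | rfl | rfl <;> exact le_rfl
      inv := natOfLE fun x => by
        rcases square_cases x with rfl | rfl | rfl | rfl <;> exact le_rfl
      hom_inv_id := Subsingleton.elim _ _
      inv_hom_id := Subsingleton.elim _ _ }
  let e' : (D.res (sq hab hac hbd hcd)).obj ((D.res hf.functor).obj X) ≅
      (D.res (sq (hf hab) (hf hac) (hf hbd) (hf hcd))).obj X :=
    (rebase _ _ X).symm ≪≫ D.res₂Iso e X
  exact ⟨fun ⟨_, _, _, _, h⟩ => ⟨_, _, _, _, isCocartesian_of_iso e' h⟩,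
    fun ⟨_, _, _, _, h⟩ => ⟨_, _, _, _, isCocartesian_of_iso e'.symm h⟩⟩

theorem biCart_iff_colAt {a b c d : U} (hab : a ≤ b) (hac : a ≤ c) (hbd : b ≤ d) (hcd : c ≤ d)
    (hbc : ¬ b ≤ c) (hcb : ¬ c ≤ b) (X : D.Diag U) :
    BiCart X a b c d ↔ ColAt X (fun q => q = a ∨ q = b ∨ q = c) d :=
  Iff.trans ⟨fun ⟨_, _, _, _, h⟩ => h, fun h => ⟨_, _, _, _, h⟩⟩
    (isCocartesian_sq_iff hab hac hbd hcd hbc hcb X)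

end BiCart

section Stable

variable {D : Prederivator.{w, v, u}} [D.IsStable] {U : Type w} [Preorder U]

/-- Stability: the bicartesian squares, which are cocartesian by definition, are also described by
a limit. -/
theorem biCart_iff_limAt {a b c d : U} (hab : a ≤ b) (hac : a ≤ c) (hbd : b ≤ d)
    (hcd : c ≤ d) (hbc : ¬ b ≤ c) (hcb : ¬ c ≤ b) (X : D.Diag U) :
    BiCart X a b c d ↔ LimAt X (fun q => q = b ∨ q = c ∨ q = d) a :=
  Iff.trans ⟨fun ⟨_, _, _, _, h⟩ => (IsStable.cartesian_iff_cocartesian _).2 h,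
    fun h => ⟨hab, hac, hbd, hcd, (IsStable.cartesian_iff_cocartesian _).1 h⟩⟩
    (isCartesian_sq_iff hab hac hbd hcd hbc hcb X)

/-- The rectangle with two rows and three columns. -/
abbrev Rect := ULift.{w} (Fin 2 × Fin 3)

/-- The elements of the rectangle. -/
abbrev rect (i : Fin 2) (j : Fin 3) : Rect.{w} := ⟨(i, j)⟩

theorem Rect.forall {p : Rect.{w} → Prop} : (∀ q, p q) ↔ ∀ i j, p (rect i j) :=
  ⟨fun h _ _ => h _, fun h q => h q.1.1 q.1.2⟩

theorem Rect.exists {p : Rect.{w} → Prop} : (∃ q, p q) ↔ ∃ i j, p (rect i j) :=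
  ⟨fun ⟨q, h⟩ => ⟨q.1.1, q.1.2, h⟩, fun ⟨_, _, h⟩ => ⟨_, h⟩⟩

theorem Rect.le_iff {i i' : Fin 2} {j j' : Fin 3} : rect.{w} i j ≤ rect i' j' ↔ i ≤ i' ∧ j ≤ j' :=
  Iff.rfl

theorem Rect.eq_iff {i i' : Fin 2} {j j' : Fin 3} : rect.{w} i j = rect i' j' ↔ i = i' ∧ j = j' := by
  simp [rect]

instance (x y : Rect.{w}) : Decidable (x ≤ y) :=
  decidable_of_iff (x.down ≤ y.down) Iff.rfl

set_option synthInstance.maxSize 1000 in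
/-- If the right square of a rectangle is cartesian, then the value at the upper middle vertex is a
limit and may be omitted in the limit over all other vertices, which describes the left square as
well as the whole rectangle. -/
theorem biCart_rect_right (X : D.Diag Rect.{w})
    (h : BiCart X (rect 0 1) (rect 0 2) (rect 1 1) (rect 1 2)) :
    BiCart X (rect 0 0) (rect 0 1) (rect 1 0) (rect 1 1) ↔
      BiCart X (rect 0 0) (rect 0 2) (rect 1 0) (rect 1 2) := by
  rw [biCart_iff_limAt (by decide) (by decide) (by decide) (by decide) (by decide) (by decide)] at h ⊢
  rw [biCart_iff_limAt (by decide) (by decide) (by decide) (by decide) (by decide) (by decide)]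
  have h1 := limAt_iff_of_greatest (X := X) (a := rect 0 0) (Q := fun q => q ≠ rect 0 0)
    (Q₀ := fun q => q = rect 0 1 ∨ q = rect 1 0 ∨ q = rect 1 1)
    (by simp only [Rect.forall, Rect.eq_iff, Rect.le_iff, ne_eq]; decide)
    (by simp only [Rect.forall, Rect.exists, Rect.eq_iff, Rect.le_iff, ne_eq]; decide)
  have h2 := limAt_iff_of_greatest (X := X) (a := rect 0 0)
    (Q := fun q => q ≠ rect 0 0 ∧ q ≠ rect 0 1)
    (Q₀ := fun q => q = rect 0 2 ∨ q = rect 1 0 ∨ q = rect 1 2)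
    (by simp only [Rect.forall, Rect.eq_iff, Rect.le_iff, ne_eq]; decide)
    (by simp only [Rect.forall, Rect.exists, Rect.eq_iff, Rect.le_iff, ne_eq]; decide)
  have h3 := limAt_iff_of_limAt (X := X) (a := rect 0 0) (Q := fun q => q ≠ rect 0 0)
    (Q₀ := fun q => q ≠ rect 0 0 ∧ q ≠ rect 0 1) (fun q hq _ => hq.1) (fun q hq _ hq' => by
      obtain rfl : q = rect 0 1 := by
        by_contra hne
        exact hq' ⟨hq, hne⟩
      refine (limAt_congr ?_).1 h
      simp only [Rect.forall, Rect.eq_iff, Rect.le_iff, ne_eq]; decide)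
  rw [← h1, h3, h2]

set_option synthInstance.maxSize 1000 in
/-- If the left square of a rectangle is cocartesian, then the right square is cocartesian if and
only if the whole rectangle is: the dual of `biCart_rect_right`. -/
theorem biCart_rect_left (X : D.Diag Rect.{w})
    (h : BiCart X (rect 0 0) (rect 0 1) (rect 1 0) (rect 1 1)) :
    BiCart X (rect 0 1) (rect 0 2) (rect 1 1) (rect 1 2) ↔
      BiCart X (rect 0 0) (rect 0 2) (rect 1 0) (rect 1 2) := by
  rw [biCart_iff_colAt (by decide) (by decide) (by decide) (by decide) (by decide) (by decide)] at h ⊢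
  rw [biCart_iff_colAt (by decide) (by decide) (by decide) (by decide) (by decide) (by decide)]
  have h1 := colAt_iff_of_least (X := X) (a := rect 1 2) (Q := fun q => q ≠ rect 1 2)
    (Q₀ := fun q => q = rect 0 1 ∨ q = rect 0 2 ∨ q = rect 1 1)
    (by simp only [Rect.forall, Rect.eq_iff, Rect.le_iff, ne_eq]; decide)
    (by simp only [Rect.forall, Rect.exists, Rect.eq_iff, Rect.le_iff, ne_eq]; decide)
  have h2 := colAt_iff_of_least (X := X) (a := rect 1 2)
    (Q := fun q => q ≠ rect 1 2 ∧ q ≠ rect 1 1)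
    (Q₀ := fun q => q = rect 0 0 ∨ q = rect 0 2 ∨ q = rect 1 0)
    (by simp only [Rect.forall, Rect.eq_iff, Rect.le_iff, ne_eq]; decide)
    (by simp only [Rect.forall, Rect.exists, Rect.eq_iff, Rect.le_iff, ne_eq]; decide)
  have h3 := colAt_iff_of_colAt (X := X) (a := rect 1 2) (Q := fun q => q ≠ rect 1 2)
    (Q₀ := fun q => q ≠ rect 1 2 ∧ q ≠ rect 1 1) (fun q hq _ => hq.1) (fun q hq _ hq' => by
      obtain rfl : q = rect 1 1 := by
        by_contra hne
        exact hq' ⟨hq, hne⟩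
      refine (colAt_congr ?_).1 h
      simp only [Rect.forall, Rect.eq_iff, Rect.le_iff, ne_eq]; decide)
  rw [← h1, h3, h2]

section Paste

variable {a b c a' b' c' : U}

/-- The map on the rectangle with first row `a, b, c` and second row `a', b', c'`. -/
def rectObj (a b c a' b' c' : U) (q : Rect.{w}) : U := ![![a, b, c], ![a', b', c']] q.1.1 q.1.2

theorem rectObj_mono (hab : a ≤ b) (hbc : b ≤ c) (hab' : a' ≤ b') (hbc' : b' ≤ c') (haa : a ≤ a')
    (hbb : b ≤ b') (hcc : c ≤ c') : Monotone (rectObj a b c a' b' c') := by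
  have h1 := hab.trans hbc
  have h2 := hab'.trans hbc'
  have h3 := haa.trans hab'
  have h4 := haa.trans h2
  have h5 := hbb.trans hbc'
  rintro ⟨i, j⟩ ⟨i', j'⟩ h
  obtain ⟨hi, hj⟩ := Rect.le_iff.1 h
  fin_cases i <;> fin_cases i' <;> fin_cases j <;> fin_cases j' <;> simp_all [rectObj]

/-- If the right square of a rectangle is bicartesian, then the left square is bicartesian if and
only if the whole rectangle is. -/
theorem biCart_paste_right (hab : a ≤ b) (haa : a ≤ a') (hab' : a' ≤ b') {X : D.Diag U}
    (h : BiCart X b c b' c') : BiCart X a b a' b' ↔ BiCart X a c a' c' := by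
  obtain ⟨h1, h2, h3, h4, -⟩ := id h
  have hf := rectObj_mono hab h1 hab' h4 haa h2 h3
  have e1 := biCart_res_iff hf X (a := rect 0 1) (b := rect 0 2) (c := rect 1 1) (d := rect 1 2)
    (by decide) (by decide) (by decide) (by decide)
  have e2 := biCart_res_iff hf X (a := rect 0 0) (b := rect 0 1) (c := rect 1 0) (d := rect 1 1)
    (by decide) (by decide) (by decide) (by decide)
  have e3 := biCart_res_iff hf X (a := rect 0 0) (b := rect 0 2) (c := rect 1 0) (d := rect 1 2)
    (by decide) (by decide) (by decide) (by decide)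
  exact e2.symm.trans ((biCart_rect_right _ (e1.2 h)).trans e3)

/-- If the left square of a rectangle is bicartesian, then the right square is bicartesian if and
only if the whole rectangle is. -/
theorem biCart_paste_left (hbc : b ≤ c) (hcc : c ≤ c') (hbc' : b' ≤ c') {X : D.Diag U}
    (h : BiCart X a b a' b') : BiCart X b c b' c' ↔ BiCart X a c a' c' := by
  obtain ⟨h1, h2, h3, h4, -⟩ := id h
  have hf := rectObj_mono h1 hbc h4 hbc' h2 h3 hcc
  have e1 := biCart_res_iff hf X (a := rect 0 1) (b := rect 0 2) (c := rect 1 1) (d := rect 1 2)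
    (by decide) (by decide) (by decide) (by decide)
  have e2 := biCart_res_iff hf X (a := rect 0 0) (b := rect 0 1) (c := rect 1 0) (d := rect 1 1)
    (by decide) (by decide) (by decide) (by decide)
  have e3 := biCart_res_iff hf X (a := rect 0 0) (b := rect 0 2) (c := rect 1 0) (d := rect 1 2)
    (by decide) (by decide) (by decide) (by decide)
  exact e1.symm.trans ((biCart_rect_left _ (e2.2 h)).trans e3)

/-- The transpose of a bicartesian square is bicartesian. -/
theorem biCart_transpose {d : U} (hbc : ¬ b ≤ c) (hcb : ¬ c ≤ b) {X : D.Diag U}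
    (h : BiCart X a b c d) : BiCart X a c b d := by
  obtain ⟨h1, h2, h3, h4, -⟩ := id h
  rw [biCart_iff_colAt h1 h2 h3 h4 hbc hcb] at h
  rw [biCart_iff_colAt h2 h1 h4 h3 hcb hbc]
  refine (colAt_congr fun q _ => ?_).1 h
  tauto

end Paste

end Stable
end Prederivator

/-! ### A poset which contains a source and a sink -/

/-- The elements of the poset on which the source and the sink are compared. The elements `src` and
`p k` form the source, and `q k` and `c ∅` form the sink. The elements `c T` form a cube, and the
values at `zero`, `mid` and `o k` are going to vanish. -/
inductive Vert (n : ℕ) : Type w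
  | src
  | zero
  | mid
  | p (k : Fin n)
  | q (k : Fin n)
  | o (k : Fin n)
  | c (T : Finset (Fin n))

namespace Vert

variable {n : ℕ}

/-- The predicate with given restrictions to the families of elements. -/
def pred (src zero mid : Prop) (p q o : Fin n → Prop) (c : Finset (Fin n) → Prop) :
    Vert.{w} n → Prop
  | .src => src
  | .zero => zero
  | .mid => mid
  | .p k => p k
  | .q k => q k
  | .o k => o k
  | .c T => c T

section

variable {s z m : Prop} {p q o : Fin n → Prop} {c : Finset (Fin n) → Prop}

@[simp] theorem pred_src : pred.{w} s z m p q o c .src ↔ s := Iff.rfl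
@[simp] theorem pred_zero : pred.{w} s z m p q o c .zero ↔ z := Iff.rfl
@[simp] theorem pred_mid : pred.{w} s z m p q o c .mid ↔ m := Iff.rfl
@[simp] theorem pred_p {k : Fin n} : pred.{w} s z m p q o c (.p k) ↔ p k := Iff.rfl
@[simp] theorem pred_q {k : Fin n} : pred.{w} s z m p q o c (.q k) ↔ q k := Iff.rfl
@[simp] theorem pred_o {k : Fin n} : pred.{w} s z m p q o c (.o k) ↔ o k := Iff.rfl
@[simp] theorem pred_c {T : Finset (Fin n)} : pred.{w} s z m p q o c (.c T) ↔ c T := Iff.rfl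

end

/-- The subsets which contain all, or all but one, of the elements. -/
def Large (T : Finset (Fin n)) : Prop := T = Finset.univ ∨ ∃ k, {k}ᶜ ⊆ T

/-- The elements above a given one. The order is generated by the sides of the squares `Quad`, the
inclusions `c S ≤ c T` for `S ⊆ T`, and the relations `q k ≤ p k` and `o k ≤ mid`. -/
def up : Vert.{w} n → Vert.{w} n → Prop
  | .src => pred True True True (fun _ => True) (fun _ => False) (fun _ => False) Large
  | .zero => pred False True False (fun _ => False) (fun _ => False) (fun _ => False) Large
  | .mid => pred False False True (fun _ => False) (fun _ => False) (fun _ => False)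
      (fun T => T = Finset.univ)
  | .p k => pred False False True (fun j => k = j) (fun _ => False) (fun _ => False)
      (fun T => {k}ᶜ ⊆ T)
  | .q k => pred False False True (fun j => k = j) (fun j => k = j) (fun j => k = j)
      (fun _ => True)
  | .o k => pred False False True (fun _ => False) (fun _ => False) (fun j => k = j)
      (fun T => k ∈ T)
  | .c S => pred False False False (fun _ => False) (fun _ => False) (fun _ => False)
      (fun T => S ⊆ T)

theorem Large.mono {S T : Finset (Fin n)} (h : Large S) (hST : S ⊆ T) : Large T := by
  rcases h with rfl | ⟨k, hk⟩
  · exact Or.inl (Finset.univ_subset_iff.1 hST)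
  · exact Or.inr ⟨k, hk.trans hST⟩

theorem large_univ : Large (Finset.univ : Finset (Fin n)) := Or.inl rfl

theorem large_compl (k : Fin n) : Large ({k}ᶜ : Finset (Fin n)) := Or.inr ⟨k, subset_rfl⟩

instance : Preorder (Vert.{w} n) where
  le := up
  le_refl a := by cases a <;> simp [up]
  le_trans a b c hab hbc := by
    cases a <;> cases b <;> simp only [up, pred_src, pred_zero, pred_mid, pred_p, pred_q, pred_o,
      pred_c] at hab <;> try exact hab.elim
    all_goals
      cases c <;> simp only [up, pred_src, pred_zero, pred_mid, pred_p, pred_q, pred_o,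
        pred_c] at hbc ⊢ <;> first
        | exact hbc.elim
        | trivial
        | exact hbc
        | exact hab
        | exact hab.trans hbc
        | exact hab.mono hbc
        | (subst hbc; exact large_univ)
        | exact Or.inr ⟨_, hbc⟩
        | (subst hbc; exact Finset.subset_univ _)
        | (subst hbc; exact Finset.mem_univ _)
        | (subst hab; exact hbc)
        | (subst hab; exact Finset.univ_subset_iff.1 hbc)
        | exact hbc hab

theorem le_def (a b : Vert.{w} n) : a ≤ b ↔ up a b := Iff.rfl

/-- The elements at which the diagrams are required to vanish. -/
inductive Vanish : Vert.{w} n → Prop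
  | zero : Vanish .zero
  | mid : Vanish .mid
  | o (k : Fin n) : Vanish (.o k)

/-- The squares, with top row the first two and bottom row the last two elements, which are required
to be bicartesian. Together with the vanishing conditions, `total` makes `c univ` the suspension of
`src`, `upper` makes `c {k}ᶜ` the cofibre of `src ⟶ p k`, `right` makes `p k` the fibre of
`c {k}ᶜ ⟶ c univ`, and `cube` makes `q k` the fibre of every edge of the cube in direction `k`. -/
inductive Quad : Vert.{w} n → Vert.{w} n → Vert.{w} n → Vert.{w} n → Prop
  | total : Quad .src .zero .mid (.c Finset.univ)
  | upper (k : Fin n) : Quad .src (.p k) .zero (.c {k}ᶜ)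
  | right (k : Fin n) : Quad (.p k) (.c {k}ᶜ) .mid (.c Finset.univ)
  | cube (k : Fin n) (T : Finset (Fin n)) (hk : k ∉ T) : Quad (.q k) (.c T) (.o k) (.c (insert k T))

theorem forall_iff {r : Vert.{w} n → Prop} : (∀ a, r a) ↔ r .src ∧ r .zero ∧ r .mid ∧
    (∀ k, r (.p k)) ∧ (∀ k, r (.q k)) ∧ (∀ k, r (.o k)) ∧ ∀ T, r (.c T) :=
  ⟨fun h => ⟨h _, h _, h _, fun _ => h _, fun _ => h _, fun _ => h _, fun _ => h _⟩,
    fun ⟨h1, h2, h3, h4, h5, h6, h7⟩ a => by cases a <;> simp_all⟩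

end Vert

local notation "ff" => fun _ => False
local notation "tt" => fun _ => True

namespace Prederivator

open Vert

variable {D : Prederivator.{w, v, u}} [D.IsStable] {n : ℕ}

/-- The conditions on the values of a diagram at the elements which satisfy `P`: only the squares
all of whose vertices satisfy `P` are considered. -/
structure CondOn (P : Vert.{w} n → Prop) (X : D.Diag (Vert.{w} n)) : Prop where
  zero (a : Vert.{w} n) (ha : Vanish a) (h : P a) : IsZero ((D.eval a).obj X)
  sq (a b c d : Vert.{w} n) (hsq : Quad a b c d) (ha : P a) (hb : P b) (hc : P c) (hd : P d) :
    BiCart X a b c d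

instance : HasZeroObject (D.Diag Pt.{w}) := IsStable.hasZeroObject

variable {X : D.Diag (Vert.{w} n)}

theorem condOn_pred_iff {s z m : Prop} {p q o : Fin n → Prop} {c : Finset (Fin n) → Prop} :
    CondOn (pred s z m p q o c) X ↔ (z → IsZero ((D.eval .zero).obj X)) ∧
      (m → IsZero ((D.eval .mid).obj X)) ∧ (∀ k, o k → IsZero ((D.eval (.o k)).obj X)) ∧
      (s → z → m → c Finset.univ → BiCart X .src .zero .mid (.c Finset.univ)) ∧
      (∀ k, s → p k → z → c {k}ᶜ → BiCart X .src (.p k) .zero (.c {k}ᶜ)) ∧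
      (∀ k, p k → c {k}ᶜ → m → c Finset.univ → BiCart X (.p k) (.c {k}ᶜ) .mid (.c Finset.univ)) ∧
      ∀ k T, k ∉ T → q k → c T → o k → c (insert k T) →
        BiCart X (.q k) (.c T) (.o k) (.c (insert k T)) := by
  constructor
  · rintro ⟨h1, h2⟩
    exact ⟨fun h => h1 _ .zero h, fun h => h1 _ .mid h, fun k h => h1 _ (.o k) h,
      fun a b c d => h2 _ _ _ _ .total a b c d, fun k a b c d => h2 _ _ _ _ (.upper k) a b c d,
      fun k a b c d => h2 _ _ _ _ (.right k) a b c d,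
      fun k T hT a b c d => h2 _ _ _ _ (.cube k T hT) a b c d⟩
  · rintro ⟨h1, h2, h3, h4, h5, h6, h7⟩
    constructor
    · rintro _ (_ | _ | k) h
      exacts [h1 h, h2 h, h3 k h]
    · rintro _ _ _ _ (_ | k | k | ⟨k, T, hT⟩) a b c d
      exacts [h4 a b c d, h5 k a b c d, h6 k a b c d, h7 k T hT a b c d]

/-- The subsets which contain all elements from `i` on, or all elements but one. -/
def Wide (i : ℕ) (T : Finset (Fin n)) : Prop := (∀ j : Fin n, i ≤ j → j ∈ T) ∨ ∃ k, T = {k}ᶜ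

theorem wide_zero_iff {T : Finset (Fin n)} : Wide 0 T ↔ T = Finset.univ ∨ ∃ k, T = {k}ᶜ := by
  simp [Wide, Finset.eq_univ_iff_forall]

theorem compl_ne_univ (k : Fin n) : ({k}ᶜ : Finset (Fin n)) ≠ Finset.univ := by
  simp [Finset.eq_univ_iff_forall]

theorem compl_subset_iff {k : Fin n} {T : Finset (Fin n)} :
    {k}ᶜ ⊆ T ↔ T = {k}ᶜ ∨ T = Finset.univ := by
  constructor
  · intro h
    by_cases hk : k ∈ T
    · right
      ext j
      by_cases hj : j = k
      · simp [hj, hk]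
      · simp [h (show j ∈ ({k}ᶜ : Finset (Fin n)) by simpa using hj)]
    · left
      ext j
      simp only [Finset.mem_compl, Finset.mem_singleton]
      refine ⟨fun hj e => hk (e ▸ hj), fun hj => h (by simpa using hj)⟩
  · rintro (rfl | rfl)
    · exact subset_rfl
    · exact Finset.subset_univ _

theorem insert_compl (k : Fin n) : insert k ({k}ᶜ : Finset (Fin n)) = Finset.univ := by
  ext j; simp

theorem large_iff {T : Finset (Fin n)} : Large T ↔ T = Finset.univ ∨ ∃ k, T = {k}ᶜ := by
  simp only [Large, compl_subset_iff]
  constructor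
  · rintro (h | ⟨k, h | h⟩)
    exacts [.inl h, .inr ⟨k, h⟩, .inl h]
  · rintro (h | ⟨k, h⟩)
    exacts [.inl h, .inr ⟨k, .inl h⟩]

/-! ### Extending from the source to the poset -/

/-- At `zero` and `mid`, above which the source has no elements, a right Kan extension has the value
zero. -/
theorem condOn_zero_mid :
    CondOn (pred True True True tt ff ff ff) X ↔ ∀ d, pred True True True tt ff ff ff d →
      ¬ pred True False False tt ff ff ff d → LimAt X (pred True False False tt ff ff ff) d := by
  have h1 : LimAt X (pred True False False tt ff ff ff) .zero ↔ IsZero ((D.eval .zero).obj X) :=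
    limAt_iff_isZero (by simp [forall_iff, le_def, up])
  have h2 : LimAt X (pred True False False tt ff ff ff) .mid ↔ IsZero ((D.eval .mid).obj X) :=
    limAt_iff_isZero (by simp [forall_iff, le_def, up])
  rw [condOn_pred_iff]
  simp [forall_iff, h1, h2]

/-- In the left Kan extension to `c univ`, the elements `src`, `zero` and `mid` are final among the
ones below. -/
theorem condOn_top (h : CondOn (pred True True True tt ff ff ff) X) :
    CondOn (pred True True True tt ff ff (· = Finset.univ)) X ↔
      ∀ d, pred True True True tt ff ff (· = Finset.univ) d →
      ¬ pred True True True tt ff ff ff d → ColAt X (pred True True True tt ff ff ff) d := by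
  have h1 : ColAt X (pred True True True tt ff ff ff) (.c Finset.univ) ↔
      BiCart X .src .zero .mid (.c Finset.univ) := by
    rw [biCart_iff_colAt] <;> try (solve | simp [le_def, up, large_univ])
    refine colAt_iff_of_least ?_ ?_
    · simp [le_def, up]
    · simp only [forall_iff]
      refine ⟨fun _ _ => ⟨.src, ?_⟩, fun _ _ => ⟨.zero, ?_⟩, fun _ _ => ⟨.mid, ?_⟩,
        fun k _ _ => ⟨.mid, ?_⟩, ?_⟩ <;> simp [le_def, up, large_univ]
  rw [condOn_pred_iff] at h ⊢
  simp_all [forall_iff]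

/-- In the left Kan extension to the `c {k}ᶜ`, the elements below are `src`, `p k` and `zero`. That
the square `right` is bicartesian as well is then automatic. -/
theorem condOn_upper (h : CondOn (pred True True True tt ff ff (· = Finset.univ)) X) :
    CondOn (pred True True True tt ff ff (Wide 0)) X ↔
      ∀ d, pred True True True tt ff ff (Wide 0) d →
      ¬ pred True True True tt ff ff (· = Finset.univ) d →
        ColAt X (pred True True True tt ff ff (· = Finset.univ)) d := by
  have h1 (k) : ColAt X (pred True True True tt ff ff (· = Finset.univ)) (.c {k}ᶜ) ↔
      BiCart X .src (.p k) .zero (.c {k}ᶜ) := by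
    rw [biCart_iff_colAt] <;> try (solve | simp [le_def, up, large_compl])
    refine colAt_congr ?_
    simp [forall_iff, le_def, up]
    rintro T hT rfl
    simp at hT
  have h4 : BiCart X .src .zero .mid (.c Finset.univ) :=
    (condOn_pred_iff.1 h).2.2.2.1 trivial trivial trivial rfl
  refine Iff.trans (b := ∀ k, BiCart X .src (.p k) .zero (.c {k}ᶜ)) ?_ ?_
  · rw [condOn_pred_iff] at h ⊢
    constructor
    · rintro ⟨-, -, -, -, h5, -⟩ k
      exact h5 k trivial trivial trivial (.inr ⟨k, rfl⟩)
    · intro h5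
      refine ⟨h.1, h.2.1, h.2.2.1, fun _ _ _ _ => h4, fun k _ _ _ _ => h5 k, fun k _ _ _ _ => ?_,
        fun _ _ _ h => h.elim⟩
      -- The columns of the rectangle are `src, zero`, `p k, c {k}ᶜ` and `mid, c univ`.
      refine biCart_transpose ?_ ?_ ((biCart_paste_left ?_ ?_ ?_ (h5 k)).2
        (biCart_transpose ?_ ?_ h4)) <;> simp [le_def, up]
  · simp only [forall_iff, pred_c, wide_zero_iff, ← h1]
    constructor
    · intro h2
      simp only [pred_src, pred_zero, pred_mid, pred_p, pred_q, pred_o, not_true, false_imp_iff,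
        imp_true_iff, true_and]
      rintro T (rfl | ⟨k, rfl⟩) hT
      exacts [absurd rfl hT, h2 k]
    · intro h2 k
      exact h2.2.2.2.2.2.2 _ (.inr ⟨k, rfl⟩) (compl_ne_univ k)

/-- There are no elements yet below the `o k`, so that a left Kan extension vanishes there. -/
theorem condOn_o (h : CondOn (pred True True True tt ff ff (Wide 0)) X) :
    CondOn (pred True True True tt ff tt (Wide 0)) X ↔
      ∀ d, pred True True True tt ff tt (Wide 0) d →
      ¬ pred True True True tt ff ff (Wide 0) d →
        ColAt X (pred True True True tt ff ff (Wide 0)) d := by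
  have h1 (k) : ColAt X (pred True True True tt ff ff (Wide 0)) (.o k) ↔
      IsZero ((D.eval (.o k)).obj X) :=
    colAt_iff_isZero (by simp [forall_iff, le_def, up])
  rw [condOn_pred_iff] at h ⊢
  simp only [forall_iff]
  simp_all

/-- By the square `right`, the value at `p k` is the limit over the greater elements, so that `p k`
may be omitted in the computation of limits. -/
theorem limAt_p {Q : Vert.{w} n → Prop} {k : Fin n} (hp : ¬ Q (.p k)) (h1 : Q (.c {k}ᶜ))
    (h2 : Q .mid) (h3 : Q (.c Finset.univ))
    (h : BiCart X (.p k) (.c {k}ᶜ) .mid (.c Finset.univ)) : LimAt X Q (.p k) := by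
  rw [biCart_iff_limAt] at h <;> try (solve | simp [le_def, up])
  refine (limAt_congr ?_).1 h
  simp only [forall_iff, le_def, up, pred_src, pred_zero, pred_mid, pred_p, pred_q, pred_o, pred_c,
    compl_subset_iff]
  simp only [false_imp_iff, implies_true, h2, true_and, reduceCtorEq, c.injEq, false_or, or_false,
    or_true, forall_eq', hp]
  rintro T (rfl | rfl)
  · simp [h1]
  · simp [h3]

/-- In the right Kan extension to the `q k`, the element `p k` above may be omitted by `limAt_p`,
and among the others `c {k}ᶜ`, `o k` and `c univ` are initial. -/
theorem condOn_q (h : CondOn (pred True True True tt ff tt (Wide 0)) X) :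
    CondOn (pred True True True tt tt tt (Wide 0)) X ↔
      ∀ d, pred True True True tt tt tt (Wide 0) d →
      ¬ pred True True True tt ff tt (Wide 0) d →
        LimAt X (pred True True True tt ff tt (Wide 0)) d := by
  have h1 (k) : LimAt X (pred True True True tt ff tt (Wide 0)) (.q k) ↔
      BiCart X (.q k) (.c {k}ᶜ) (.o k) (.c Finset.univ) := by
    rw [biCart_iff_limAt] <;> try (solve | simp [le_def, up])
    rw [limAt_iff_of_limAt (Q₀ := pred False False True ff ff tt (Wide 0))]
    · refine limAt_iff_of_greatest ?_ ?_
      · simp [wide_zero_iff]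
      · simp only [forall_iff, pred_c, wide_zero_iff]
        refine ⟨?_, ?_, fun _ _ => ⟨.o k, ?_⟩, ?_, ?_, ?_, ?_⟩
        · simp
        · simp
        · simp [le_def, up]
        · simp
        · simp
        · rintro j - hj
          obtain rfl : k = j := hj
          exact ⟨.o k, by simp [le_def, up]⟩
        · rintro T (rfl | ⟨j, rfl⟩) -
          · exact ⟨.c Finset.univ, by simp [le_def, up]⟩
          · by_cases hj : j = k
            · subst hj
              exact ⟨.c {j}ᶜ, by simp [le_def, up]⟩
            · exact ⟨.o k, by simp [le_def, up, Ne.symm hj, hj]⟩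
    · simp [forall_iff]
      exact fun _ h _ => h
    · simp [forall_iff, le_def, up]
      refine ⟨?_, fun T h h' => absurd h h'⟩
      refine limAt_p ?_ ?_ ?_ ?_ ((condOn_pred_iff.1 h).2.2.2.2.2.1 k trivial ?_ trivial ?_) <;>
        simp [wide_zero_iff]
  -- The only square `cube` at this stage is the one for `{k}ᶜ`.
  have h2 : ∀ k (T : Finset (Fin n)), k ∉ T → Wide 0 T → Wide 0 (insert k T) → T = {k}ᶜ := by
    simp only [wide_zero_iff]
    rintro k T hk (rfl | ⟨j, rfl⟩) -
    · simp at hk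
    · simp at hk
      rw [hk]
  refine Iff.trans (b := ∀ k, BiCart X (.q k) (.c {k}ᶜ) (.o k) (.c Finset.univ)) ?_ ?_
  · rw [condOn_pred_iff] at h ⊢
    constructor
    · rintro ⟨-, -, -, -, -, -, h5⟩ k
      have := h5 k {k}ᶜ (by simp) trivial (wide_zero_iff.2 (.inr ⟨k, rfl⟩)) trivial
        (wide_zero_iff.2 (.inl (insert_compl k)))
      rwa [insert_compl] at this
    · intro h5
      refine ⟨h.1, h.2.1, h.2.2.1, h.2.2.2.1, h.2.2.2.2.1, h.2.2.2.2.2.1, ?_⟩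
      rintro k T hT - h6 - h7
      obtain rfl := h2 k T hT h6 h7
      rw [insert_compl]
      exact h5 k
  · simp only [← h1, forall_iff]
    simp
    tauto

theorem Wide.succ {i : ℕ} {T : Finset (Fin n)} (h : Wide i T) : Wide (i + 1) T :=
  h.imp (fun h j hj => h j (by omega)) id

theorem wide_of_mem {i : Fin n} {T : Finset (Fin n)} (h : Wide (i + 1) T) (hi : i ∈ T) :
    Wide i T := by
  refine h.imp (fun h j hj => ?_) id
  by_cases hij : i = j
  · exact hij ▸ hi
  · exact h j (by have := Fin.val_ne_of_ne hij; omega)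

/-- One stage in the extension over the cube: a right Kan extension to the `c T` for which `T`
contains all elements greater than `i`, but not `i`, and `T ≠ {i}ᶜ`. Its value at `c T` is
determined by the square `c T`, `c (insert i T)`, `c {i}ᶜ`, `c univ`. Pasting this square with the
square `cube` for `i` and `{i}ᶜ`, which is already known to be bicartesian, turns it into the square
`cube` for `i` and `T`. The squares in the other directions `k` follow by pasting. -/
theorem condOn_wide (i : Fin n) (h : CondOn (pred True True True tt tt tt (Wide i)) X) :
    CondOn (pred True True True tt tt tt (Wide (i + 1))) X ↔
      ∀ d, pred True True True tt tt tt (Wide (i + 1)) d →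
      ¬ pred True True True tt tt tt (Wide i) d →
        LimAt X (pred True True True tt tt tt (Wide i)) d := by
  have hi : Wide (i : ℕ) ({i}ᶜ : Finset (Fin n)) := .inr ⟨i, rfl⟩
  have hu : Wide (i : ℕ) (Finset.univ : Finset (Fin n)) := .inl fun _ _ => Finset.mem_univ _
  have h0 (T) (h1 : Wide (i + 1) T) (h2 : ¬ Wide i T) :
      (∀ j : Fin n, (i : ℕ) + 1 ≤ j → j ∈ T) ∧ i ∉ T ∧ T ≠ {i}ᶜ :=
    ⟨h1.resolve_right fun h => h2 (.inr h), fun h => h2 (wide_of_mem h1 h), fun h => h2 (h ▸ hi)⟩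
  have hw (T) (h1 : ∀ j : Fin n, (i : ℕ) + 1 ≤ j → j ∈ T) : Wide i (insert i T) := by
    refine .inl fun j hj => Finset.mem_insert.2 ?_
    by_cases hij : j = i
    · exact .inl hij
    · exact .inr (h1 j (by have := Fin.val_ne_of_ne hij; omega))
  obtain ⟨hz1, hz2, hz3, hs1, hs2, hs3, hs4⟩ := condOn_pred_iff.1 h
  have hc : BiCart X (.q i) (.c {i}ᶜ) (.o i) (.c Finset.univ) := by
    have := hs4 i {i}ᶜ (by simp) trivial hi trivial (by rwa [insert_compl])
    rwa [insert_compl] at this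
  have h1 (T) (h1 : Wide (i + 1) T) (h2 : ¬ Wide i T) :
      LimAt X (pred True True True tt tt tt (Wide i)) (.c T) ↔
        BiCart X (.q i) (.c T) (.o i) (.c (insert i T)) := by
    obtain ⟨h3, h4, h5⟩ := h0 T h1 h2
    have hT : T ⊆ {i}ᶜ := by simpa using h4
    have hne : insert i T ≠ Finset.univ := by
      intro he
      refine h5 (hT.antisymm fun j hj => ?_)
      exact Finset.mem_of_mem_insert_of_ne (he.symm ▸ Finset.mem_univ j) (by simpa using hj)
    have hsub : ¬ {i}ᶜ ⊆ insert i T := by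
      rw [compl_subset_iff, not_or]
      exact ⟨fun he => by simpa using (he ▸ Finset.mem_insert_self i T : i ∈ ({i}ᶜ : Finset (Fin n))), hne⟩
    have h6 : BiCart X (.c T) (.c (insert i T)) (.c {i}ᶜ) (.c Finset.univ) ↔
        LimAt X (pred True True True tt tt tt (Wide i)) (.c T) := by
      rw [biCart_iff_limAt] <;> try (solve | simp [le_def, up, hsub, h4])
      refine (limAt_iff_of_greatest ?_ ?_).symm
      · rintro _ (rfl | rfl | rfl) -
        exacts [hw T h3, hi, hu]
      · simp only [forall_iff]
        refine ⟨?_, ?_, ?_, ?_, ?_, ?_, ?_⟩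
        iterate 6 simp [le_def, up]
        rintro T' h7 (h8 : T ⊆ T')
        by_cases hT'u : T' = Finset.univ
        · subst hT'u
          exact ⟨.c Finset.univ, by simp [le_def, up]⟩
        by_cases hiT' : i ∈ T'
        · refine ⟨.c (insert i T), ?_⟩
          simp [le_def, up, Finset.insert_subset_iff, hiT', h8, compl_subset_iff, hT'u]
          rintro - rfl
          simp at hiT'
        · obtain rfl : T' = {i}ᶜ := by
            rcases h7 with h7 | ⟨k, rfl⟩
            · exact absurd (h7 i le_rfl) hiT'
            · simp at hiT'
              rw [hiT']
          refine ⟨.c {i}ᶜ, ?_⟩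
          simp [le_def, up, h4]
    rw [← h6]
    -- The columns of the rectangle are `q i, o i`, `c T, c (insert i T)` and `c {i}ᶜ, c univ`.
    constructor
    · intro h7
      refine (biCart_paste_right ?_ ?_ ?_ (biCart_transpose ?_ ?_ h7)).2 hc <;>
        simp [le_def, up, hsub, h4]
    · intro h7
      refine biCart_transpose ?_ ?_ ((biCart_paste_left ?_ ?_ ?_ h7).2 hc) <;>
        simp [le_def, up, hsub, h4]
  refine Iff.trans (b := ∀ T, i ∉ T → Wide (i + 1) T →
    BiCart X (.q i) (.c T) (.o i) (.c (insert i T))) ?_ ?_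
  · rw [condOn_pred_iff]
    constructor
    · rintro ⟨-, -, -, -, -, -, h5⟩ T hT hT'
      refine h5 i T hT trivial hT' trivial ?_
      by_cases h6 : Wide i T
      · rcases h6 with h6 | ⟨k, rfl⟩
        · exact absurd (h6 i le_rfl) hT
        · simp at hT
          subst hT
          rw [insert_compl]
          exact hu.succ
      · exact (hw T (h0 T hT' h6).1).succ
    · intro h5
      refine ⟨hz1, hz2, hz3, fun _ _ _ _ => hs1 trivial trivial trivial hu,
        fun k _ _ _ _ => hs2 k trivial trivial trivial (.inr ⟨k, rfl⟩),
        fun k _ _ _ _ => hs3 k trivial (.inr ⟨k, rfl⟩) trivial hu, ?_⟩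
      rintro k S hkS - hS - hkS'
      by_cases hki : k = i
      · subst hki
        exact h5 S hkS hS
      by_cases hiS : i ∈ S
      · exact hs4 k S hkS trivial (wide_of_mem hS hiS) trivial
          (wide_of_mem hkS' (Finset.mem_insert_of_mem hiS))
      · have hiS' : i ∉ insert k S := by simp [hiS, Ne.symm hki]
        have hki' : k ∉ insert i S := by simp [hkS, hki]
        have e1 := h5 S hiS hS
        have e2 := h5 _ hiS' hkS'
        -- Both squares `cube` in direction `i` have the left column `q i, o i`, so that their
        -- difference, a face of the cube, is bicartesian; pasted with the square for `insert i S`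
        -- in direction `k`, which is known, it gives the square for `S`.
        have e3 : BiCart X (.c S) (.c (insert k S)) (.c (insert i S)) (.c (insert i (insert k S))) := by
          refine (biCart_paste_left ?_ ?_ ?_ e1).2 e2 <;> simp [le_def, up]
        have hS1 : ∀ j : Fin n, (i : ℕ) + 1 ≤ j → j ∈ S := by
          rcases hS with hS | ⟨j, rfl⟩
          · exact hS
          · simp at hiS hkS
            exact absurd (hkS.trans hiS.symm) hki
        have e4 := hs4 k (insert i S) hki' trivial (hw S hS1) trivial (by
          rw [Finset.insert_comm]
          exact hw _ fun j hj => Finset.mem_insert_of_mem (hS1 j hj))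
        rw [Finset.insert_comm] at e4
        refine (biCart_paste_right ?_ ?_ ?_ (biCart_transpose ?_ ?_ e3)).2 e4 <;>
          simp [le_def, up, Finset.insert_subset_iff, hkS, hiS, hki, Ne.symm hki]
  · constructor
    · intro h2
      simp only [forall_iff, pred_src, pred_zero, pred_mid, pred_p, pred_q, pred_o, not_true,
        false_imp_iff, imp_true_iff, true_and]
      exact fun T hT hT' => (h1 T hT hT').2 (h2 T (h0 T hT hT').2.1 hT)
    · intro h2 T hT hT'
      by_cases h3 : Wide i T
      · obtain rfl : T = {i}ᶜ := by
          rcases h3 with h3 | ⟨k, rfl⟩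
          · exact absurd (h3 i le_rfl) hT
          · simp at hT
            rw [hT]
        rwa [insert_compl]
      · exact (h1 T hT' h3).1 (h2 _ hT' h3)

/-! ### Extending from the sink to the poset -/

/-- The subsets all of whose elements are smaller than `i`. -/
def Below (i : ℕ) (T : Finset (Fin n)) : Prop := ∀ j ∈ T, (j : ℕ) < i

theorem below_zero_iff {T : Finset (Fin n)} : Below 0 T ↔ T = ∅ := by
  simp [Below, Finset.eq_empty_iff_forall_notMem]

/-- The elements above `o k` are not yet present, so that a right Kan extension vanishes there. -/
theorem condOn_below_zero :
    CondOn (pred False False False ff tt tt (Below 0)) X ↔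
      ∀ d, pred False False False ff tt tt (Below 0) d →
      ¬ pred False False False ff tt ff (Below 0) d →
        LimAt X (pred False False False ff tt ff (Below 0)) d := by
  have h1 (k) : LimAt X (pred False False False ff tt ff (Below 0)) (.o k) ↔
      IsZero ((D.eval (.o k)).obj X) := by
    refine limAt_iff_isZero ?_
    simp [forall_iff, le_def, up, below_zero_iff]
  rw [condOn_pred_iff]
  simp only [forall_iff, pred_c, below_zero_iff]
  simp [h1]

/-- One stage in the extension over the cube: a left Kan extension to the `c T` for which `i` is the
greatest element of `T`. Among the elements below `c (insert i T)`, the elements `q i`, `c T` and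
`o i` are final, so that the extension is described by the squares `cube` for `i`. The squares in
the other directions `k` follow by pasting. -/
theorem condOn_below (i : Fin n) (h : CondOn (pred False False False ff tt tt (Below i)) X) :
    CondOn (pred False False False ff tt tt (Below (i + 1))) X ↔
      ∀ d, pred False False False ff tt tt (Below (i + 1)) d →
      ¬ pred False False False ff tt tt (Below i) d →
        ColAt X (pred False False False ff tt tt (Below i)) d := by
  have h0 (T : Finset (Fin n)) (hT : Below (i + 1) T) (hi : i ∉ T) : Below i T := fun j hj => by
    have h1 := hT j hj
    have h2 : (j : ℕ) ≠ i := fun h => hi (Fin.ext h ▸ hj)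
    omega
  have hs (T : Finset (Fin n)) (hT : Below i T) : Below (i + 1) (insert i T) := fun j hj => by
    rcases Finset.mem_insert.1 hj with rfl | hj
    · omega
    · exact (hT j hj).trans (Nat.lt_succ_self _)
  have hm (T : Finset (Fin n)) (hT : Below i T) : i ∉ T := fun h => (hT i h).false
  obtain ⟨-, -, hz, -, -, -, hs4⟩ := condOn_pred_iff.1 h
  have h1 (T) (hT : Below i T) :
      ColAt X (pred False False False ff tt tt (Below i)) (.c (insert i T)) ↔
        BiCart X (.q i) (.c T) (.o i) (.c (insert i T)) := by
    have hiT := hm T hT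
    rw [biCart_iff_colAt] <;> try (solve | simp [le_def, up, hiT])
    refine colAt_iff_of_least ?_ ?_
    · rintro _ (rfl | rfl | rfl) -
      exacts [trivial, hT, trivial]
    · simp only [forall_iff]
      refine ⟨?_, ?_, ?_, ?_, fun j _ _ => ?_, fun j _ hj => ?_, ?_⟩
      iterate 4 simp
      · by_cases hij : j = i
        · subst hij
          exact ⟨.q j, by simp [le_def, up]⟩
        · exact ⟨.c T, by simp [le_def, up, hij]⟩
      · by_cases hij : j = i
        · subst hij
          exact ⟨.o j, by simp [le_def, up, hiT]⟩
        · replace hj : j ∈ T := (Finset.mem_insert.1 hj).resolve_left hij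
          exact ⟨.c T, by simp [le_def, up, hij, hj]⟩
      · rintro T' hT' (hTT' : T' ⊆ insert i T)
        have : T' ⊆ T := fun j hj => (Finset.mem_insert.1 (hTT' hj)).resolve_left
          fun h => hm T' hT' (h ▸ hj)
        exact ⟨.c T, by simp [le_def, up, this]⟩
  refine Iff.trans (b := ∀ T, Below i T → BiCart X (.q i) (.c T) (.o i) (.c (insert i T))) ?_ ?_
  · rw [condOn_pred_iff]
    constructor
    · rintro ⟨-, -, -, -, -, -, h5⟩ T hT
      exact h5 i T (hm T hT) trivial (fun j hj => (hT j hj).trans (Nat.lt_succ_self _)) trivial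
        (hs T hT)
    · intro h5
      refine ⟨False.elim, False.elim, hz, False.elim, fun _ => False.elim, fun _ => False.elim, ?_⟩
      rintro k S hkS - hS - hkS'
      by_cases hki : k = i
      · subst hki
        exact h5 S (h0 S hS hkS)
      by_cases hiS : i ∈ S
      · obtain ⟨S, hiS', rfl⟩ : ∃ S', i ∉ S' ∧ insert i S' = S :=
          ⟨S.erase i, Finset.notMem_erase _ _, Finset.insert_erase hiS⟩
        have hkS2 : k ∉ S := fun h => hkS (Finset.mem_insert_of_mem h)
        rw [Finset.insert_comm] at hkS' ⊢
        have hb : Below i (insert k S) := h0 _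
          (fun j hj => hkS' j (Finset.mem_insert_of_mem hj)) (by simp [hiS', Ne.symm hki])
        have hb' : Below i S := fun j hj => hb j (Finset.mem_insert_of_mem hj)
        -- The face of the cube in directions `i` and `k` is the difference of two squares in
        -- direction `i`; pasted with the known square for `S` it gives the one for `insert i S`.
        have e3 : BiCart X (.c S) (.c (insert k S)) (.c (insert i S))
            (.c (insert i (insert k S))) := by
          refine (biCart_paste_left ?_ ?_ ?_ (h5 S hb')).2 (h5 _ hb) <;> simp [le_def, up]
        refine (biCart_paste_right ?_ ?_ ?_ (biCart_transpose ?_ ?_ e3)).1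
          (hs4 k S hkS2 trivial hb' trivial hb) <;>
          simp [le_def, up, Finset.insert_subset_iff, hkS2, hiS', hki, Ne.symm hki]
      · exact hs4 k S hkS trivial (h0 S hS hiS) trivial (h0 _ hkS' (by simp [hiS, Ne.symm hki]))
  · refine (forall₂_congr fun T hT => (h1 T hT).symm).trans ?_
    constructor
    · intro h2
      simp only [forall_iff, pred_src, pred_zero, pred_mid, pred_p, pred_q, pred_o, not_true,
        false_imp_iff, imp_true_iff, true_and]
      intro T hT hT'
      have hiT : i ∈ T := by
        by_contra hi
        exact hT' (h0 T hT hi)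
      rw [← Finset.insert_erase hiT]
      exact h2 _ (h0 _ (fun j hj => hT j (Finset.mem_of_mem_erase hj)) (Finset.notMem_erase _ _))
    · intro h2 T hT
      exact h2 _ (hs T hT) fun h => hm _ h (Finset.mem_insert_self _ _)

/-- In the left Kan extension to `mid`, the elements `o k` are final among the ones below, and the
values there vanish; the colimit over them is therefore a colimit over the empty diagram. -/
theorem condOn_mid (h : CondOn (pred False False False ff tt tt tt) X) :
    CondOn (pred False False True ff tt tt tt) X ↔
      ∀ d, pred False False True ff tt tt tt d → ¬ pred False False False ff tt tt tt d →
        ColAt X (pred False False False ff tt tt tt) d := by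
  obtain ⟨-, -, hz, -, -, -, hs4⟩ := condOn_pred_iff.1 h
  have h1 : ColAt X (pred False False False ff tt tt tt) .mid ↔ IsZero ((D.eval .mid).obj X) := by
    rw [colAt_iff_of_least (Q₀ := pred False False False ff ff tt ff),
      colAt_iff_of_colAt (Q₀ := ff), colAt_iff_isZero]
    · simp
    · simp
    · simp only [forall_iff]
      simp
      exact fun k _ => (colAt_iff_isZero (by simp)).2 (hz k trivial)
    · simp [forall_iff]
    · simp only [forall_iff]
      refine ⟨?_, ?_, ?_, ?_, fun k _ _ => ⟨.o k, ?_⟩, fun k _ _ => ⟨.o k, ?_⟩, ?_⟩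
      iterate 4 simp
      all_goals simp [le_def, up]
  rw [condOn_pred_iff]
  simp only [forall_iff]
  simp [h1]
  exact fun _ => ⟨fun k => hz k trivial, fun k T hT => hs4 k T hT trivial trivial trivial trivial⟩

/-- In the left Kan extension to the `p k`, the only element below is `q k`, so that `q k ⟶ p k`
becomes an isomorphism. As the values at `o k` and `mid` vanish, this means that the square `q k`,
`p k`, `o k`, `mid` is bicartesian, and by pasting with the square `cube` for `{k}ᶜ` that the square
`right` is. -/
theorem condOn_p (h : CondOn (pred False False True ff tt tt tt) X) :
    CondOn (pred False False True tt tt tt tt) X ↔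
      ∀ d, pred False False True tt tt tt tt d → ¬ pred False False True ff tt tt tt d →
        ColAt X (pred False False True ff tt tt tt) d := by
  obtain ⟨-, hz', hz, -, -, -, hs4⟩ := condOn_pred_iff.1 h
  have hc (k) : BiCart X (.q k) (.c {k}ᶜ) (.o k) (.c Finset.univ) := by
    have := hs4 k {k}ᶜ (by simp) trivial trivial trivial trivial
    rwa [insert_compl] at this
  have h1 (k) : ColAt X (pred False False True ff tt tt tt) (.p k) ↔
      BiCart X (.p k) (.c {k}ᶜ) .mid (.c Finset.univ) := by
    have e1 : ColAt X (pred False False True ff tt tt tt) (.p k) ↔ ColAt X (· = .q k) (.p k) := by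
      refine colAt_congr ?_
      simp [forall_iff, le_def, up]
    have e2 : LimAt X (fun a => a = .p k ∨ a = .o k ∨ a = .mid) (.q k) ↔
        LimAt X (· = .p k) (.q k) := by
      refine limAt_iff_of_limAt (fun _ h _ => .inl h) ?_
      rintro _ (rfl | rfl | rfl) - h'
      · exact absurd rfl h'
      · exact (limAt_iff_isZero (by simp [le_def, up])).2 (hz k trivial)
      · exact (limAt_iff_isZero (by simp [le_def, up])).2 (hz' trivial)
    rw [e1, colAt_singleton_iff (by simp [le_def, up]), ← limAt_singleton_iff, ← e2,
      ← biCart_iff_limAt] <;> try (solve | simp [le_def, up])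
    -- The columns of the rectangle are `q k, o k`, `p k, mid` and `c {k}ᶜ, c univ`.
    constructor
    · intro h
      refine (biCart_paste_left ?_ ?_ ?_ h).2 (hc k) <;> simp [le_def, up]
    · intro h
      refine (biCart_paste_right ?_ ?_ ?_ h).2 (hc k) <;> simp [le_def, up]
  rw [condOn_pred_iff]
  simp only [forall_iff]
  simp [h1]
  exact ⟨fun h => h.2.2.1, fun h => ⟨hz' trivial, fun k => hz k trivial, h,
    fun k T hT => hs4 k T hT trivial trivial trivial trivial⟩⟩

/-- There are no elements yet below `zero`, so that a left Kan extension vanishes there. -/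
theorem condOn_zero (h : CondOn (pred False False True tt tt tt tt) X) :
    CondOn (pred False True True tt tt tt tt) X ↔
      ∀ d, pred False True True tt tt tt tt d → ¬ pred False False True tt tt tt tt d →
        ColAt X (pred False False True tt tt tt tt) d := by
  have h1 : ColAt X (pred False False True tt tt tt tt) .zero ↔ IsZero ((D.eval .zero).obj X) :=
    colAt_iff_isZero (by simp [forall_iff, le_def, up])
  rw [condOn_pred_iff] at h ⊢
  simp only [forall_iff]
  simp_all

/-- In the right Kan extension to `src`, the elements `p k` may be omitted by `limAt_p`, and among
the others `zero`, `mid` and `c univ` are initial. The squares `upper` follow by cancelling the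
squares `right`. -/
theorem condOn_src (h : CondOn (pred False True True tt tt tt tt) X) :
    CondOn (pred True True True tt tt tt tt) X ↔
      ∀ d, pred True True True tt tt tt tt d → ¬ pred False True True tt tt tt tt d →
        LimAt X (pred False True True tt tt tt tt) d := by
  obtain ⟨hz1, hz2, hz3, -, -, hs3, hs4⟩ := condOn_pred_iff.1 h
  replace hs3 := fun k => hs3 k trivial trivial trivial trivial
  have h1 : LimAt X (pred False True True tt tt tt tt) .src ↔
      BiCart X .src .zero .mid (.c Finset.univ) := by
    rw [biCart_iff_limAt] <;> try (solve | simp [le_def, up, large_univ])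
    rw [limAt_iff_of_limAt (Q₀ := pred False True True ff tt tt tt)]
    · refine limAt_iff_of_greatest ?_ ?_
      · simp
      · simp only [forall_iff]
        refine ⟨?_, fun _ _ => ⟨.zero, ?_⟩, fun _ _ => ⟨.mid, ?_⟩, ?_, ?_, ?_, ?_⟩
        iterate 6 simp [le_def, up]
        rintro T - (hT : Large T)
        rcases large_iff.1 hT with rfl | ⟨k, rfl⟩
        · exact ⟨.c Finset.univ, by simp [le_def, up, large_univ]⟩
        · exact ⟨.zero, by simp [le_def, up, large_compl]⟩
    · simp [forall_iff]
    · simp only [forall_iff]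
      simp
      exact fun k _ => limAt_p (by simp) (by simp) (by simp) (by simp) (hs3 k)
  rw [condOn_pred_iff]
  simp only [forall_iff]
  simp [h1]
  constructor
  · exact fun h => h.2.2.2.1
  · intro h2
    refine ⟨hz1 trivial, hz2 trivial, fun k => hz3 k trivial, h2, fun k => ?_, hs3,
      fun k T hT => hs4 k T hT trivial trivial trivial trivial⟩
    -- The columns of the rectangle are `src, zero`, `p k, c {k}ᶜ` and `mid, c univ`.
    refine (biCart_paste_right ?_ ?_ ?_ (biCart_transpose ?_ ?_ (hs3 k))).2
      (biCart_transpose ?_ ?_ h2) <;> simp [le_def, up, large_compl]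

end Prederivator

/-! ### The model of the free oriented gluing -/

/-- The objects of the free oriented gluing of `B` and `C` along new morphisms `s k ⟶ y k`. The
pushout is described explicitly because the comma categories in it have to be computed. -/
inductive Glue {n : ℕ} {B C : Type w} (s : Fin n → B) (y : Fin n → C) : Type w
  | left (b : B)
  | right (c : C)

namespace Glue

variable {n : ℕ} {B C : Type w} [SmallCategory B] [SmallCategory C]
variable {s : Fin n → B} {y : Fin n → C}

/-- The morphisms of the free oriented gluing: a morphism from the left to the right passes through
exactly one of the new morphisms. -/
def Hom : Glue s y → Glue s y → Type w
  | left b, left b' => b ⟶ b'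
  | left b, right c => Σ k, (b ⟶ s k) × (y k ⟶ c)
  | right _, left _ => PEmpty
  | right c, right c' => c ⟶ c'

instance : SmallCategory (Glue s y) where
  Hom := Hom
  id
    | left b => 𝟙 b
    | right c => 𝟙 c
  comp {x y z} f g :=
    match x, y, z, f, g with
    | left _, left _, left _, f, g => CategoryStruct.comp (obj := B) f g
    | left _, left _, right _, f, g => ⟨g.1, CategoryStruct.comp (obj := B) f g.2.1, g.2.2⟩
    | left _, right _, right _, f, g => ⟨f.1, f.2.1, CategoryStruct.comp (obj := C) f.2.2 g⟩
    | right _, right _, right _, f, g => CategoryStruct.comp (obj := C) f g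
  id_comp {x y} f := by
    cases x <;> cases y
    · exact Category.id_comp (obj := B) f
    · exact congrArg (fun t => (⟨f.1, t, f.2.2⟩ : Σ k, (_ ⟶ s k) × (y k ⟶ _))) (Category.id_comp _)
    · exact f.elim
    · exact Category.id_comp (obj := C) f
  comp_id {x y} f := by
    cases x <;> cases y
    · exact Category.comp_id (obj := B) f
    · exact congrArg (fun t => (⟨f.1, f.2.1, t⟩ : Σ k, (_ ⟶ s k) × (y k ⟶ _))) (Category.comp_id _)
    · exact f.elim
    · exact Category.comp_id (obj := C) f
  assoc {x y z t} f g h := by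
    cases x <;> cases y <;> try exact f.elim
    all_goals cases z <;> try exact g.elim
    all_goals cases t <;> try exact h.elim
    · exact Category.assoc (obj := B) f g h
    · exact congrArg (fun t => (⟨h.1, t, h.2.2⟩ : Σ k, (_ ⟶ s k) × (y k ⟶ _)))
        (Category.assoc (obj := B) f g h.2.1)
    · rfl
    · exact congrArg (fun t => (⟨f.1, f.2.1, t⟩ : Σ k, (_ ⟶ s k) × (y k ⟶ _)))
        (Category.assoc (obj := C) f.2.2 g h)
    · exact Category.assoc (obj := C) f g h

variable (s y)

/-- The inclusion of the left side. -/
def inl : B ⥤ Glue s y where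
  obj := left
  map f := f

/-- The inclusion of the right side. -/
def inr : C ⥤ Glue s y where
  obj := right
  map f := f

variable {s y}

/-- The morphism from the left to the right through the `k`-th new morphism. -/
def arm {b : B} {c : C} (k : Fin n) (f : b ⟶ s k) (g : y k ⟶ c) :
    (left b : Glue s y) ⟶ right c := ⟨k, f, g⟩

theorem arm_eq {b : B} {c : C} (k : Fin n) (f : b ⟶ s k) (g : y k ⟶ c) :
    (arm k f g : (left b : Glue s y) ⟶ right c) =
      (inl s y).map f ≫ arm k (𝟙 _) (𝟙 _) ≫ (inr s y).map g :=
  congrArg₂ (fun f g => (⟨k, f, g⟩ : Σ k, (_ ⟶ s k) × (y k ⟶ _))) (Category.comp_id f).symm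
    (Category.id_comp g).symm

variable {Z : Type*} [Category Z]

/-- The functor on the gluing defined by functors on the two sides and images of the new
morphisms. -/
def desc (F : B ⥤ Z) (G : C ⥤ Z) (φ : ∀ k, F.obj (s k) ⟶ G.obj (y k)) : Glue s y ⥤ Z where
  obj
    | left b => F.obj b
    | right c => G.obj c
  map {x y} f :=
    match x, y, f with
    | left _, left _, f => F.map f
    | left _, right _, f => F.map f.2.1 ≫ φ f.1 ≫ G.map f.2.2
    | right _, right _, f => G.map f
  map_id x := by
    cases x
    · exact F.map_id _
    · exact G.map_id _
  map_comp {x y z} f g := by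
    cases x <;> cases y <;> try exact f.elim
    all_goals cases z <;> try exact g.elim
    · exact F.map_comp _ _
    · exact (congrArg (· ≫ _) (F.map_comp _ _)).trans (Category.assoc _ _ _)
    · refine (congrArg (fun t => _ ≫ _ ≫ t) (G.map_comp _ _)).trans ?_
      exact (congrArg (_ ≫ ·) (Category.assoc _ _ _).symm).trans (Category.assoc _ _ _).symm
    · exact G.map_comp _ _

/-- Functors on the gluing agree if they agree on both sides and on the new morphisms. -/
theorem hext {F G : Glue s y ⥤ Z} (hl : inl s y ⋙ F = inl s y ⋙ G)
    (hr : inr s y ⋙ F = inr s y ⋙ G)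
    (h : ∀ k, HEq (F.map (arm k (𝟙 _) (𝟙 _))) (G.map (arm k (𝟙 (s k)) (𝟙 (y k))))) : F = G := by
  have hl' (b) : F.obj (left b) = G.obj (left b) := Functor.congr_obj hl b
  have hr' (c) : F.obj (right c) = G.obj (right c) := Functor.congr_obj hr c
  refine Functor.hext ?_ ?_
  · rintro (b | c)
    exacts [hl' b, hr' c]
  · rintro (b | c) (b' | c') f
    · exact Functor.hcongr_hom hl f
    · obtain ⟨k, f, g⟩ := f
      change HEq (F.map (arm k f g)) (G.map (arm k f g))
      rw [arm_eq]
      refine Functor.map_comp_heq (hl' _) (hl' _) (hr' _) (Functor.hcongr_hom hl f) ?_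
      exact Functor.map_comp_heq (hl' _) (hr' _) (hr' _) (h k) (Functor.hcongr_hom hr g)
    · exact f.elim
    · exact Functor.hcongr_hom hr f

end Glue

section Functors

variable {Z : Type*} [Category Z]

theorem sigma_functor_ext {I : Type*} {A : I → Type*} [∀ i, Category (A i)]
    {F G : (Σ i, A i) ⥤ Z} (h : ∀ i, Sigma.incl i ⋙ F = Sigma.incl i ⋙ G) : F = G := by
  refine Functor.hext ?_ ?_
  · rintro ⟨i, a⟩
    exact Functor.congr_obj (h i) a
  · rintro ⟨i, a⟩ ⟨_, b⟩ ⟨f⟩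
    exact Functor.hcongr_hom (h i) f

theorem sum_functor_ext {A B : Type*} [Category A] [Category B] {F G : A ⊕ B ⥤ Z}
    (h₁ : Sum.inl_ A B ⋙ F = Sum.inl_ A B ⋙ G) (h₂ : Sum.inr_ A B ⋙ F = Sum.inr_ A B ⋙ G) :
    F = G := by
  refine Functor.hext ?_ ?_
  · rintro (a | b)
    exacts [Functor.congr_obj h₁ a, Functor.congr_obj h₂ b]
  · rintro (a | b) (a' | b') f
    · obtain ⟨f⟩ := f
      exact Functor.hcongr_hom h₁ f
    · exact f.elim
    · exact f.elim
    · obtain ⟨f⟩ := f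
      exact Functor.hcongr_hom h₂ f

theorem pt_functor_ext {F G : Pt.{w} ⥤ Z} (h : F.obj ⟨⟨⟩⟩ = G.obj ⟨⟨⟩⟩) : F = G :=
  Discrete.functor_ext (fun _ => h)

/-- The arrow of the category `[1]`. -/
def arrHom : arr0.{w} ⟶ arr1 := AsSmall.up.map (homOfLE (by decide))

theorem arr_functor_ext {F G : Arr.{w} ⥤ Z} (h₀ : F.obj arr0 = G.obj arr0)
    (h₁ : F.obj arr1 = G.obj arr1) (h : HEq (F.map arrHom) (G.map arrHom)) : F = G := by
  have ho (x) : F.obj x = G.obj x := by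
    obtain ⟨x⟩ := x
    fin_cases x
    exacts [h₀, h₁]
  refine Functor.hext ho ?_
  have hid (x) : HEq (F.map (𝟙 x)) (G.map (𝟙 x)) := by
    rw [F.map_id, G.map_id, ho x]
  rintro ⟨x⟩ ⟨y⟩ f
  fin_cases x <;> fin_cases y
  · exact hid arr0
  · exact h
  · exact absurd (leOfHom f.down) (by decide)
  · exact hid arr1

end Functors

namespace Glue

variable {n : ℕ} {B C : Type w} [SmallCategory B] [SmallCategory C]
variable (s : Fin n → B) (y : Fin n → C)

/-- The functor `[1] ⥤ A` which classifies a morphism of `A`. -/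
def ofHom {A : Type w} [SmallCategory A] {a b : A} (f : a ⟶ b) : Arr.{w} ⥤ A :=
  AsSmall.down ⋙ ComposableArrows.mk₁ f

/-- The functor on the sum of the two sides. -/
def sides : B ⊕ C ⥤ Glue s y := (inl s y).sum' (inr s y)

/-- The functor which classifies the new morphisms. -/
def edges : (Σ _ : Fin n, Arr.{w}) ⥤ Glue s y := Sigma.desc fun k => ofHom (arm k (𝟙 _) (𝟙 _))

/-- The square of which the gluing is the pushout commutes. -/
theorem comm : glueEnds n s y ⋙ sides s y = glueEdges n ⋙ edges s y := by
  refine sigma_functor_ext fun k => sum_functor_ext (pt_functor_ext ?_) (pt_functor_ext ?_) <;> rfl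

theorem heq_of_functor_eq {Z : Type*} [Category Z] {F : (Σ _ : Fin n, Arr.{w}) ⥤ Z}
    {G : (Σ _ : Fin n, Arr.{w}) ⥤ Z} (h : F = G) (k : Fin n) :
    HEq (F.map (Sigma.SigmaHom.mk (i := k) arrHom)) (G.map (Sigma.SigmaHom.mk (i := k) arrHom)) :=
  Functor.hcongr_hom h _

theorem functor_ext {Z : Type*} [Category Z] {F G : Glue s y ⥤ Z}
    (h₁ : sides s y ⋙ F = sides s y ⋙ G) (h₂ : edges s y ⋙ F = edges s y ⋙ G) : F = G := by
  refine hext ?_ ?_ fun k => ?_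
  · exact congrArg (Sum.inl_ B C ⋙ ·) h₁
  · exact congrArg (Sum.inr_ B C ⋙ ·) h₁
  · exact heq_of_functor_eq h₂ k

/-- Conjugation with identities along equalities of objects does not change a morphism. -/
theorem heq_of_conj {Z : Type*} [Category Z] {a a' b b' : Z} (p : a = a') (q : b' = b)
    (f : a' ⟶ b') {i : a ⟶ a} {j : b ⟶ b} (hi : i = 𝟙 a) (hj : j = 𝟙 b) :
    HEq (i ≫ (eqToHom p ≫ f ≫ eqToHom q) ≫ j) f := by
  subst p q hi hj
  simp

theorem exists_functor {Z : Type*} [Category Z] (I : B ⊕ C ⥤ Z) (J : (Σ _ : Fin n, Arr.{w}) ⥤ Z)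
    (h : glueEnds n s y ⋙ I = glueEdges n ⋙ J) :
    ∃ F : Glue s y ⥤ Z, sides s y ⋙ F = I ∧ edges s y ⋙ F = J := by
  have h₀ (k) : I.obj (.inl (s k)) = J.obj ⟨k, arr0⟩ := Functor.congr_obj h ⟨k, .inl ⟨⟨⟩⟩⟩
  have h₁ (k) : J.obj ⟨k, arr1⟩ = I.obj (.inr (y k)) := (Functor.congr_obj h ⟨k, .inr ⟨⟨⟩⟩⟩).symm
  refine ⟨desc (Sum.inl_ B C ⋙ I) (Sum.inr_ B C ⋙ I) fun k =>
    eqToHom (h₀ k) ≫ J.map (Sigma.SigmaHom.mk arrHom) ≫ eqToHom (h₁ k), ?_, ?_⟩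
  · exact sum_functor_ext rfl rfl
  · refine sigma_functor_ext fun k => arr_functor_ext (h₀ k) (h₁ k).symm ?_
    exact heq_of_conj (h₀ k) (h₁ k) _ ((Sum.inl_ B C ⋙ I).map_id _) ((Sum.inr_ B C ⋙ I).map_id _)

/-- The model is a pushout. -/
theorem isFreeGluing : IsFreeGluing n s y (sides s y) (edges s y) := by
  have w : (glueEnds n s y).toCatHom ≫ (sides s y).toCatHom =
      (glueEdges.{w} n).toCatHom ≫ (edges s y).toCatHom := congrArg Functor.toCatHom (comm s y)
  have H (Z : PushoutCocone (glueEnds n s y).toCatHom (glueEdges.{w} n).toCatHom) :=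
    exists_functor s y Z.inl.toFunctor Z.inr.toFunctor (congrArg Cat.Hom.toFunctor Z.condition)
  refine ⟨⟨w⟩, ⟨PushoutCocone.IsColimit.mk w (fun Z => (H Z).choose.toCatHom) (fun Z => ?_)
    (fun Z => ?_) (fun Z m h₁ h₂ => ?_)⟩⟩
  · exact congrArg Functor.toCatHom (H Z).choose_spec.1
  · exact congrArg Functor.toCatHom (H Z).choose_spec.2
  · refine congrArg Functor.toCatHom (a₁ := m.toFunctor) (functor_ext s y ?_ ?_)
    · exact (congrArg Cat.Hom.toFunctor h₁).trans (H Z).choose_spec.1.symm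
    · exact (congrArg Cat.Hom.toFunctor h₂).trans (H Z).choose_spec.2.symm

variable {s y} in
/-- A free oriented gluing is equivalent to the model. -/
theorem exists_equivalence {A : Type w} [SmallCategory A] {i : B ⊕ C ⥤ A}
    {β : (Σ _ : Fin n, Arr.{w}) ⥤ A} (h : IsFreeGluing n s y i β) : Nonempty (A ≌ Glue s y) :=
  ⟨Cat.equivOfIso (h.isoIsPushout _ _ (isFreeGluing s y))⟩

end Glue

/-! ### Extending diagrams along parts of a gluing -/

namespace Glue

variable {n : ℕ} {U C : Type w} [Preorder U] [SmallCategory C] {s : Fin n → U} {y : Fin n → C}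

variable (s y) in
/-- The objects of the gluing which lie on the right or satisfy `P`. -/
def part (P : U → Prop) : ObjectProperty (Glue s y)
  | left a => P a
  | right _ => True

theorem part_mono {P P' : U → Prop} (h : P ≤ P') : part s y P ≤ part s y P'
  | left a => h a
  | right _ => id

variable (s y) in
/-- The inclusion of the elements of `U` which satisfy `P`. -/
def inlOn (P : U → Prop) : {a // P a} ⥤ (part s y P).FullSubcategory :=
  ObjectProperty.lift _ ((Subtype.mono_coe P).functor ⋙ inl s y) fun a => a.2

theorem subsingleton_hom (a b : U) : Subsingleton ((left a : Glue s y) ⟶ left b) :=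
  inferInstanceAs (Subsingleton (a ⟶ b))

variable {P P' : U → Prop} (h : P ≤ P') {d : U} (hd : P' d)

/-- The elements of `U` above `d` among the objects of the gluing under `d`. -/
def above : {a : U // P a ∧ d ≤ a} ⥤ StructuredArrow
    (⟨left d, hd⟩ : (part s y P').FullSubcategory) (ObjectProperty.ιOfLE (part_mono h)) where
  obj a := StructuredArrow.mk (Y := (⟨left a.1, a.2.1⟩ : (part s y P).FullSubcategory))
    (ObjectProperty.homMk ((inl s y).map (homOfLE a.2.2)))
  map f := StructuredArrow.homMk (ObjectProperty.homMk ((inl s y).map (homOfLE (leOfHom f))))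
    (ObjectProperty.hom_ext _ ((subsingleton_hom _ _).elim _ _))

/-- The elements of `U` below `d` among the objects of the gluing over `d`. -/
def below : {a : U // P a ∧ a ≤ d} ⥤ CostructuredArrow
    (ObjectProperty.ιOfLE (part_mono h)) (⟨left d, hd⟩ : (part s y P').FullSubcategory) where
  obj a := CostructuredArrow.mk (Y := (⟨left a.1, a.2.1⟩ : (part s y P).FullSubcategory))
    (ObjectProperty.homMk ((inl s y).map (homOfLE a.2.2)))
  map f := CostructuredArrow.homMk (ObjectProperty.homMk ((inl s y).map (homOfLE (leOfHom f))))
    (ObjectProperty.hom_ext _ ((subsingleton_hom _ _).elim _ _))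

/-- A morphism from the left to the right determines the new morphism through which it passes. -/
theorem le_of_comp_eq {a : U} {c : C} {k : Fin n} {f : d ⟶ s k} {g : y k ⟶ c} (i : d ⟶ a)
    {t : (left a : Glue s y) ⟶ right c} (ht : (inl s y).map i ≫ t = arm k f g) : a ≤ s k := by
  obtain ⟨k', f', g'⟩ := t
  replace ht : (⟨k', i ≫ f', g'⟩ : Σ k, (d ⟶ s k) × (y k ⟶ c)) = ⟨k, f, g⟩ := ht
  obtain ⟨rfl, -⟩ := Sigma.mk.inj_iff.1 ht
  exact leOfHom f'

/-- When the left side is a preorder, its morphisms are epimorphisms in the gluing. -/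
theorem hom_ext_of_comp {a : U} {c : C} (i : d ⟶ a) {t t' : (left a : Glue s y) ⟶ right c}
    (ht : (inl s y).map i ≫ t = (inl s y).map i ≫ t') : t = t' := by
  obtain ⟨k, f, g⟩ := t
  obtain ⟨k', f', g'⟩ := t'
  replace ht : (⟨k, i ≫ f, g⟩ : Σ k, (d ⟶ s k) × (y k ⟶ c)) = ⟨k', i ≫ f', g'⟩ := ht
  obtain ⟨rfl, ht⟩ := Sigma.mk.inj_iff.1 ht
  obtain rfl : g = g' := congrArg (fun t => t.2) (eq_of_heq ht)
  obtain rfl : f = f' := Subsingleton.elim _ _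
  rfl

/-- The elements of `U` are coreflective among the objects of the part under `d`: an object of `C`
under `d`, by a morphism which passes through the `k`-th new morphism, has the coreflection
`s k`. -/
theorem exists_above_adj (hp : ∀ k, d ≤ s k → P (s k)) :
    ∃ r, Nonempty (above (s := s) (y := y) h hd ⊣ r) := by
  have H (x : StructuredArrow (⟨left d, hd⟩ : (part s y P').FullSubcategory)
      (ObjectProperty.ιOfLE (part_mono h))) : ∃ m : {a : U // P a ∧ d ≤ a}, ∀ a,
        Subsingleton ((above (s := s) (y := y) h hd).obj a ⟶ x) ∧
          (Nonempty ((above (s := s) (y := y) h hd).obj a ⟶ x) ↔ a ≤ m) := by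
    obtain ⟨⟨⟨⟩⟩, ⟨b | c, hb⟩, f⟩ := x
    · refine ⟨⟨b, hb, leOfHom f.hom⟩, fun a => ⟨⟨fun g g' => ?_⟩, fun ⟨g⟩ => leOfHom g.right.hom,
        fun hab => ⟨StructuredArrow.homMk (ObjectProperty.homMk ((inl s y).map (homOfLE hab)))
          (ObjectProperty.hom_ext _ ((subsingleton_hom _ _).elim _ _))⟩⟩⟩
      exact StructuredArrow.hom_ext _ _
        (ObjectProperty.hom_ext _ ((subsingleton_hom _ _).elim _ _))
    · obtain ⟨⟨k, f, g⟩⟩ := f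
      refine ⟨⟨s k, hp k (leOfHom f), leOfHom f⟩, fun a => ⟨⟨fun t t' => ?_⟩, fun ⟨t⟩ => ?_,
        fun hab => ⟨StructuredArrow.homMk (ObjectProperty.homMk (arm k (homOfLE hab) g)) ?_⟩⟩⟩
      · refine StructuredArrow.hom_ext _ _ (ObjectProperty.hom_ext _ ?_)
        have h1 := congrArg (fun t => t.hom) ((StructuredArrow.w t).trans (StructuredArrow.w t').symm)
        exact hom_ext_of_comp _ h1
      · have h1 := congrArg (fun t => t.hom) (StructuredArrow.w t)
        exact le_of_comp_eq _ h1
      · refine ObjectProperty.hom_ext _ ?_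
        exact congrArg (fun t => (⟨k, t, g⟩ : Σ k, (_ ⟶ s k) × (y k ⟶ _))) (Subsingleton.elim _ _)
  choose m hm using H
  refine ⟨_, ⟨Adjunction.adjunctionOfEquivRight (fun a x =>
    { toFun := fun t => homOfLE ((hm x a).2.1 ⟨t⟩)
      invFun := fun t => ((hm x a).2.2 (leOfHom t)).some
      left_inv := fun _ => (hm x a).1.elim _ _
      right_inv := fun _ => Subsingleton.elim _ _ }) (fun _ _ _ _ _ => Subsingleton.elim _ _)⟩⟩

/-- The elements of `U` are reflective among the objects of the part over `d`, as there are no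
morphisms from `C` to `U`; in fact they are all of these objects. -/
theorem exists_below_adj : ∃ l, Nonempty (l ⊣ below (s := s) (y := y) h hd) := by
  have H (x : CostructuredArrow (ObjectProperty.ιOfLE (part_mono h))
      (⟨left d, hd⟩ : (part s y P').FullSubcategory)) : ∃ m : {a : U // P a ∧ a ≤ d}, ∀ a,
        Subsingleton (x ⟶ (below (s := s) (y := y) h hd).obj a) ∧
          (Nonempty (x ⟶ (below (s := s) (y := y) h hd).obj a) ↔ m ≤ a) := by
    obtain ⟨⟨b | c, hb⟩, ⟨⟨⟩⟩, f⟩ := x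
    · refine ⟨⟨b, hb, leOfHom f.hom⟩, fun a => ⟨⟨fun g g' => ?_⟩, fun ⟨g⟩ => leOfHom g.left.hom,
        fun hab => ⟨CostructuredArrow.homMk (ObjectProperty.homMk ((inl s y).map (homOfLE hab)))
          (ObjectProperty.hom_ext _ ((subsingleton_hom _ _).elim _ _))⟩⟩⟩
      exact CostructuredArrow.hom_ext _ _
        (ObjectProperty.hom_ext _ ((subsingleton_hom _ _).elim _ _))
    · exact f.hom.elim
  choose m hm using H
  refine ⟨_, ⟨Adjunction.adjunctionOfEquivLeft (fun x a =>
    { toFun := fun t => ((hm x a).2.2 (leOfHom t)).some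
      invFun := fun t => homOfLE ((hm x a).2.1 ⟨t⟩)
      left_inv := fun _ => Subsingleton.elim _ _
      right_inv := fun _ => (hm x a).1.elim _ _ }) (fun _ _ _ _ _ => (hm _ _).1.elim _ _)⟩⟩

end Glue

namespace Prederivator

variable {D : Prederivator.{w, v, u}} {J K : Type w} [SmallCategory J] [SmallCategory K]

theorem isLim_iff_of_iso {X Y : D.Diag K} (e : X ≅ Y) {b : K} {c : J ⥤ K}
    (α : Functor.star.{w} J ⋙ pt b ⟶ c) : IsLim X α ↔ IsLim Y α :=
  isRan_congr ((D.res (pt b)).mapIso e.symm) ((D.res c).mapIso e) (by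
    refine Eq.trans ?_ (congrArg (· ≫ _) (pull_map _ e.inv).symm)
    refine Eq.trans ?_ (congrArg (_ ≫ ·) (res₂_naturality α e.hom))
    refine Eq.symm ((Category.assoc _ _ _).symm.trans ?_)
    rw [← Functor.map_comp, e.inv_hom_id, CategoryTheory.Functor.map_id]
    exact Category.id_comp _)

theorem isColim_iff_of_iso {X Y : D.Diag K} (e : X ≅ Y) {b : K} {c : J ⥤ K}
    (α : c ⟶ Functor.star.{w} J ⋙ pt b) : IsColim X α ↔ IsColim Y α :=
  isLan_congr ((D.res (pt b)).mapIso e) ((D.res c).mapIso e.symm) (by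
    refine Eq.trans ?_ (congrArg (fun t => _ ≫ _ ≫ t) (pull_map _ e.hom).symm)
    refine Eq.trans ?_ (congrArg (_ ≫ ·) (res₂_naturality α e.hom))
    refine Eq.symm ((Category.assoc _ _ _).symm.trans ?_)
    rw [Functor.mapIso_hom, Iso.symm_hom, ← Functor.map_comp, e.inv_hom_id, CategoryTheory.Functor.map_id]
    exact Category.id_comp _)

open Glue

variable {n : ℕ} {U C : Type w} [Preorder U] [SmallCategory C] {s : Fin n → U} {y : Fin n → C}
variable {P P' : U → Prop} (h : P ≤ P') {d : U} (hd : P' d)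

/-- The pointwise condition for right Kan extensions from one part of the gluing to another is a
limit over elements of `U` only, by `exists_above_adj`. The diagram `X` extends the restriction of
`Y` to all of `U`. -/
theorem isLim_part_iff (hp : ∀ k, d ≤ s k → P (s k)) (Y : D.Diag (part s y P').FullSubcategory)
    (X : D.Diag U)
    (e : (D.res (Subtype.mono_coe P').functor).obj X ≅ (D.res (inlOn s y P')).obj Y) :
    IsLim Y (sliceRight (ObjectProperty.ιOfLE (part_mono h)) ⟨left d, hd⟩) ↔ LimAt X P d := by
  obtain ⟨r, ⟨adj⟩⟩ := exists_above_adj (s := s) (y := y) h hd hp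
  rw [isLim_comp_leftAdjoint adj]
  let c : {a : U // P a ∧ d ≤ a} ⥤ {a // P' a} :=
    Monotone.functor (f := fun a => ⟨a.1, h _ a.2.1⟩) fun _ _ h => h
  let α : Functor.star.{w} _ ⋙ pt (⟨d, hd⟩ : {a // P' a}) ⟶ c := natOfLE fun a => a.2.2
  refine (isLim_res_iff (inlOn s y P') Y α _ (Iso.refl _) (Iso.refl _) fun j => ?_).symm.trans
    ((isLim_iff_of_iso e α).symm.trans
      (isLim_res_iff (Subtype.mono_coe P').functor X α _ (Iso.refl _) (Iso.refl _)
        fun j => Subsingleton.elim _ _))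
  exact ObjectProperty.hom_ext _ ((subsingleton_hom _ _).elim _ _)

/-- The pointwise condition for left Kan extensions from one part of the gluing to another is a
colimit over elements of `U` only, by `exists_below_adj`. -/
theorem isColim_part_iff (Y : D.Diag (part s y P').FullSubcategory) (X : D.Diag U)
    (e : (D.res (Subtype.mono_coe P').functor).obj X ≅ (D.res (inlOn s y P')).obj Y) :
    IsColim Y (sliceLeft (ObjectProperty.ιOfLE (part_mono h)) ⟨left d, hd⟩) ↔ ColAt X P d := by
  obtain ⟨r, ⟨adj⟩⟩ := exists_below_adj (s := s) (y := y) h hd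
  rw [isColim_comp_rightAdjoint adj]
  let c : {a : U // P a ∧ a ≤ d} ⥤ {a // P' a} :=
    Monotone.functor (f := fun a => ⟨a.1, h _ a.2.1⟩) fun _ _ h => h
  let α : c ⟶ Functor.star.{w} _ ⋙ pt (⟨d, hd⟩ : {a // P' a}) := natOfLE fun a => a.2.2
  refine (isColim_res_iff (inlOn s y P') Y α _ (Iso.refl _) (Iso.refl _) fun j => ?_).symm.trans
    ((isColim_iff_of_iso e α).symm.trans
      (isColim_res_iff (Subtype.mono_coe P').functor X α _ (Iso.refl _) (Iso.refl _)
        fun j => Subsingleton.elim _ _))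
  exact ObjectProperty.hom_ext _ ((subsingleton_hom _ _).elim _ _)

end Prederivator

/-! ### Conditions on parts of the gluing and their extension -/

namespace Prederivator

open Glue Vert

variable {D : Prederivator.{w, v, u}} [D.IsStable] {n : ℕ} {C : Type w} [SmallCategory C]
variable {y : Fin n → C} {P P' P'' : Vert.{w} n → Prop}

/-- The conditions on a diagram on the elements which satisfy `P`. In contrast to `CondOn`, the
diagram is defined only on these elements. -/
structure CondSub (P : Vert.{w} n → Prop) (X : D.Diag {a // P a}) : Prop where
  zero (a : {a // P a}) (ha : Vanish a.1) : IsZero ((D.eval a).obj X)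
  sq (a b c d : {a // P a}) (h : Quad a.1 b.1 c.1 d.1) : BiCart X a b c d

theorem _root_.Vert.Quad.le {a b c d : Vert.{w} n} (h : Quad a b c d) : a ≤ b ∧ a ≤ c ∧ b ≤ d ∧ c ≤ d := by
  cases h <;> simp [le_def, up, large_univ, large_compl]

theorem condSub_of_iso {X Y : D.Diag {a // P a}} (e : X ≅ Y) (h : CondSub P X) : CondSub P Y :=
  ⟨fun a ha => (h.zero a ha).of_iso ((D.eval a).mapIso e.symm),
    fun a b c d hq => biCart_of_iso e (h.sq a b c d hq)⟩

theorem condSub_res_iff (X : D.Diag (Vert.{w} n)) :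
    CondSub P ((D.res (Subtype.mono_coe P).functor).obj X) ↔ CondOn P X := by
  have e (a : {a // P a}) : (D.eval a).obj ((D.res (Subtype.mono_coe P).functor).obj X) ≅
      (D.eval a.1).obj X := eqToIso (D.res_comp_obj _ _ X).symm
  constructor
  · rintro ⟨h1, h2⟩
    refine ⟨fun a ha h => (h1 ⟨a, h⟩ ha).of_iso (e ⟨a, h⟩).symm, fun a b c d hq ha hb hc hd => ?_⟩
    have hle := hq.le
    exact (biCart_res_iff (Subtype.mono_coe P) X (a := ⟨a, ha⟩) (b := ⟨b, hb⟩) (c := ⟨c, hc⟩)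
      (d := ⟨d, hd⟩) hle.1 hle.2.1 hle.2.2.1 hle.2.2.2).1 (h2 _ _ _ _ hq)
  · rintro ⟨h1, h2⟩
    refine ⟨fun a ha => (h1 a.1 ha a.2).of_iso (e a), fun a b c d hq => ?_⟩
    have hle := hq.le
    exact (biCart_res_iff (Subtype.mono_coe P) X hle.1 hle.2.1 hle.2.2.1 hle.2.2.2).2
      (h2 _ _ _ _ hq a.2 b.2 c.2 d.2)

/-- The conditions on a diagram on a part of the gluing. -/
def condPart (y : Fin n → C) (P : Vert.{w} n → Prop) :
    ObjectProperty (D.Diag (part Vert.p y P).FullSubcategory) :=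
  fun X => CondSub P ((D.res (inlOn Vert.p y P)).obj X)

instance : (condPart (D := D) y P).IsClosedUnderIsomorphisms :=
  ⟨fun e h => condSub_of_iso ((D.res _).mapIso e) h⟩

theorem CondOn.mono {X : D.Diag (Vert.{w} n)} (h : P ≤ P') (hX : CondOn P' X) : CondOn P X :=
  ⟨fun a ha hP => hX.zero a ha (h a hP), fun a b c d hq ha hb hc hd =>
    hX.sq a b c d hq (h _ ha) (h _ hb) (h _ hc) (h _ hd)⟩

/-- A coherent diagram on a part of the gluing is the restriction on the left side of a coherent
diagram on all of the left side. -/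
theorem exists_extension (Y : D.Diag (part Vert.p y P').FullSubcategory) :
    ∃ X : D.Diag (Vert.{w} n), Nonempty ((D.res (Subtype.mono_coe P').functor).obj X ≅
      (D.res (inlOn Vert.p y P')).obj Y) := by
  have : (Subtype.mono_coe P').functor.Full := ⟨fun f => ⟨homOfLE (leOfHom f), Subsingleton.elim _ _⟩⟩
  have : (Subtype.mono_coe P').functor.Faithful := ⟨fun _ => Subsingleton.elim _ _⟩
  obtain ⟨X, hX, -⟩ := exists_isRan (Subtype.mono_coe P').functor ((D.res (inlOn Vert.p y P')).obj Y)
  exact ⟨X, hX⟩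

/-- The conditions on a diagram on a part of the gluing may be checked on a diagram on `Vert n`. -/
theorem condPart_iff {Y : D.Diag (part Vert.p y P').FullSubcategory} {X : D.Diag (Vert.{w} n)}
    (e : (D.res (Subtype.mono_coe P').functor).obj X ≅ (D.res (inlOn Vert.p y P')).obj Y) :
    condPart y P' Y ↔ CondOn P' X := by
  rw [← condSub_res_iff]
  exact ⟨condSub_of_iso e.symm, condSub_of_iso e⟩

theorem condPart_res_iff (h : P ≤ P') {Y : D.Diag (part Vert.p y P').FullSubcategory}
    {X : D.Diag (Vert.{w} n)}
    (e : (D.res (Subtype.mono_coe P').functor).obj X ≅ (D.res (inlOn Vert.p y P')).obj Y) :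
    condPart y P ((D.res (ObjectProperty.ιOfLE (part_mono h))).obj Y) ↔ CondOn P X := by
  let f : {a // P a} ⥤ {a // P' a} := Monotone.functor (f := fun a => ⟨a.1, h _ a.2⟩) fun _ _ h => h
  refine condPart_iff (?_ : _ ≅ _)
  exact eqToIso (D.res_comp_obj f (Subtype.mono_coe P').functor X) ≪≫ (D.res f).mapIso e ≪≫
    eqToIso (D.res_comp_obj f (inlOn Vert.p y P') Y).symm ≪≫
    eqToIso (D.res_comp_obj (inlOn Vert.p y P) (ObjectProperty.ιOfLE (part_mono h)) Y)

variable (D y) in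
/-- Restriction from the part `P'` of the gluing to the part `P` is an equivalence between the
diagrams which satisfy the conditions. -/
def Step (P P' : Vert.{w} n → Prop) : Prop :=
  ∃ h : P ≤ P', RestrictsTo (D := D) (ObjectProperty.ιOfLE (part_mono h)) (condPart y P')
    (condPart y P)

theorem Step.trans (h₁ : Step D y P P') (h₂ : Step D y P' P'') : Step D y P P'' :=
  ⟨h₁.1.trans h₂.1, h₂.2.comp h₁.2⟩

/-- The new objects of a part all lie on the left. -/
theorem not_essImage (h : P ≤ P') {d : (part Vert.p y P').FullSubcategory}
    (hd : ¬ (ObjectProperty.ιOfLE (part_mono (s := Vert.p) (y := y) h)).essImage d) :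
    ∃ (a : Vert.{w} n) (ha : P' a), ¬ P a ∧ d = ⟨left a, ha⟩ := by
  obtain ⟨a | c, ha⟩ := d
  · refine ⟨a, ha, fun h' => hd ?_, rfl⟩
    exact (ObjectProperty.ιOfLE (part_mono (s := Vert.p) (y := y) h)).obj_mem_essImage ⟨left a, h'⟩
  · exact absurd ((ObjectProperty.ιOfLE (part_mono (s := Vert.p) (y := y) h)).obj_mem_essImage
      ⟨right c, trivial⟩) hd

/-- A stage of the extension which is a right Kan extension. The limits do not involve `C` provided
that the elements `p k` above new elements are already present. -/
theorem Step.of_limAt (h : P ≤ P') (hp : ∀ d, P' d → ¬ P d → ∀ k, d ≤ .p k → P (.p k))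
    (H : ∀ X : D.Diag (Vert.{w} n), CondOn P X →
      (CondOn P' X ↔ ∀ d, P' d → ¬ P d → LimAt X P d)) : Step D y P P' := by
  refine ⟨h, RestrictsTo.of_isLim _ fun Y => ?_⟩
  obtain ⟨X, ⟨e⟩⟩ := exists_extension Y
  rw [condPart_iff e, condPart_res_iff h e]
  constructor
  · intro hX
    refine ⟨hX.mono h, fun b hb => ?_⟩
    obtain ⟨d, hd, hd', rfl⟩ := not_essImage h hb
    exact (isLim_part_iff h hd (hp d hd hd') Y X e).2 ((H X (hX.mono h)).1 hX d hd hd')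
  · rintro ⟨hX, hY⟩
    refine (H X hX).2 fun d hd hd' => (isLim_part_iff h hd (hp d hd hd') Y X e).1 ?_
    by_cases hb : (ObjectProperty.ιOfLE (part_mono (s := Vert.p) (y := y) h)).essImage ⟨left d, hd⟩
    · exact isLim_sliceRight_of_iso _ (Functor.essImage.getIso hb).symm _
    · exact hY _ hb

/-- A stage of the extension which is a left Kan extension. -/
theorem Step.of_colAt (h : P ≤ P') (H : ∀ X : D.Diag (Vert.{w} n), CondOn P X →
      (CondOn P' X ↔ ∀ d, P' d → ¬ P d → ColAt X P d)) : Step D y P P' := by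
  refine ⟨h, RestrictsTo.of_isColim _ fun Y => ?_⟩
  obtain ⟨X, ⟨e⟩⟩ := exists_extension Y
  rw [condPart_iff e, condPart_res_iff h e]
  constructor
  · intro hX
    refine ⟨hX.mono h, fun b hb => ?_⟩
    obtain ⟨d, hd, hd', rfl⟩ := not_essImage h hb
    exact (isColim_part_iff h hd Y X e).2 ((H X (hX.mono h)).1 hX d hd hd')
  · rintro ⟨hX, hY⟩
    refine (H X hX).2 fun d hd hd' => (isColim_part_iff h hd Y X e).1 ?_
    by_cases hb : (ObjectProperty.ιOfLE (part_mono (s := Vert.p) (y := y) h)).essImage ⟨left d, hd⟩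
    · exact isColim_sliceLeft_of_iso _ (Functor.essImage.getIso hb) _
    · exact hY _ hb

theorem pred_le_pred {s z m s' z' m' : Prop} {p q o p' q' o' : Fin n → Prop}
    {c c' : Finset (Fin n) → Prop} (h1 : s → s') (h2 : z → z') (h3 : m → m')
    (h4 : ∀ k, p k → p' k) (h5 : ∀ k, q k → q' k) (h6 : ∀ k, o k → o' k) (h7 : ∀ T, c T → c' T) :
    pred.{w} s z m p q o c ≤ pred s' z' m' p' q' o' c' :=
  fun a => by cases a <;> simp_all

theorem pred_true : pred.{w} True True True tt tt tt tt = (tt : Vert.{w} n → Prop) :=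
  funext fun a => by cases a <;> rfl

theorem wide_top : (Wide n : Finset (Fin n) → Prop) = tt :=
  funext fun _ => eq_true (.inl fun j hj => absurd j.2 (not_lt.2 hj))

theorem below_top : (Below n : Finset (Fin n) → Prop) = tt :=
  funext fun _ => eq_true fun j _ => j.2

theorem step_refl (P : Vert.{w} n → Prop) : Step D y P P :=
  Step.of_limAt le_rfl (fun _ h h' => absurd h h') fun _ hX =>
    ⟨fun _ _ h h' => absurd h h', fun _ => hX⟩

theorem step_wide (i : ℕ) (hi : i ≤ n) : Step D y (pred True True True tt tt tt (Wide 0))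
    (pred True True True tt tt tt (Wide i)) := by
  induction i with
  | zero => exact step_refl _
  | succ i ih =>
    refine (ih (by omega)).trans (Step.of_limAt ?_ ?_ fun X hX => condOn_wide ⟨i, hi⟩ hX)
    · exact pred_le_pred id id id (fun _ => id) (fun _ => id) (fun _ => id) fun _ => Wide.succ
    · exact fun _ _ _ _ _ => trivial

theorem step_below (i : ℕ) (hi : i ≤ n) : Step D y (pred False False False ff tt tt (Below 0))
    (pred False False False ff tt tt (Below i)) := by
  induction i with
  | zero => exact step_refl _
  | succ i ih =>
    refine (ih (by omega)).trans (Step.of_colAt ?_ fun X hX => condOn_below ⟨i, hi⟩ hX)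
    exact pred_le_pred id id id (fun _ => id) (fun _ => id) (fun _ => id)
      fun _ h j hj => (h j hj).trans (Nat.lt_succ_self _)

variable (D y) in
/-- The diagrams on the whole gluing which satisfy the conditions are determined by their
restriction to the source and `C`, which is arbitrary. -/
theorem step_source : Step D y (pred True False False tt ff ff ff) tt := by
  have h1 : Step D y (pred True False False tt ff ff ff) (pred True True True tt ff ff ff) :=
    Step.of_limAt (pred_le_pred (by simp) (by simp) (by simp) (by simp) (by simp) (by simp)
      (by simp)) (fun _ _ _ _ _ => trivial) fun X _ => condOn_zero_mid
  have h2 : Step D y (pred True True True tt ff ff ff)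
      (pred True True True tt ff ff (· = Finset.univ)) :=
    Step.of_colAt (pred_le_pred (by simp) (by simp) (by simp) (by simp) (by simp) (by simp)
      (by simp)) fun X hX => condOn_top hX
  have h3 : Step D y (pred True True True tt ff ff (· = Finset.univ))
      (pred True True True tt ff ff (Wide 0)) :=
    Step.of_colAt (pred_le_pred (by simp) (by simp) (by simp) (by simp) (by simp) (by simp)
      (fun T hT => wide_zero_iff.2 (.inl hT))) fun X hX => condOn_upper hX
  have h4 : Step D y (pred True True True tt ff ff (Wide 0))
      (pred True True True tt ff tt (Wide 0)) :=
    Step.of_colAt (pred_le_pred (by simp) (by simp) (by simp) (by simp) (by simp) (by simp)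
      (by simp)) fun X hX => condOn_o hX
  have h5 : Step D y (pred True True True tt ff tt (Wide 0))
      (pred True True True tt tt tt (Wide 0)) :=
    Step.of_limAt (pred_le_pred (by simp) (by simp) (by simp) (by simp) (by simp) (by simp)
      (by simp)) (fun _ _ _ _ _ => trivial) fun X hX => condOn_q hX
  have h6 := step_wide (D := D) (y := y) n le_rfl
  rw [wide_top, pred_true] at h6
  exact ((((h1.trans h2).trans h3).trans h4).trans h5).trans h6

variable (D y) in
/-- The diagrams on the whole gluing which satisfy the conditions are determined by their
restriction to the sink and `C`, which is arbitrary. -/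
theorem step_sink : Step D y (pred False False False ff tt ff (Below 0)) tt := by
  have h1 : Step D y (pred False False False ff tt ff (Below 0))
      (pred False False False ff tt tt (Below 0)) :=
    Step.of_limAt (pred_le_pred (by simp) (by simp) (by simp) (by simp) (by simp) (by simp)
      (by simp)) (by simp [forall_iff, le_def, up])
      fun X _ => condOn_below_zero
  have h2 := step_below (D := D) (y := y) n le_rfl
  rw [below_top] at h2
  have h3 : Step D y (pred False False False ff tt tt tt) (pred False False True ff tt tt tt) :=
    Step.of_colAt (pred_le_pred (by simp) (by simp) (by simp) (by simp) (by simp) (by simp)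
      (by simp)) fun X hX => condOn_mid hX
  have h4 : Step D y (pred False False True ff tt tt tt) (pred False False True tt tt tt tt) :=
    Step.of_colAt (pred_le_pred (by simp) (by simp) (by simp) (by simp) (by simp) (by simp)
      (by simp)) fun X hX => condOn_p hX
  have h5 : Step D y (pred False False True tt tt tt tt) (pred False True True tt tt tt tt) :=
    Step.of_colAt (pred_le_pred (by simp) (by simp) (by simp) (by simp) (by simp) (by simp)
      (by simp)) fun X hX => condOn_zero hX
  have h6 : Step D y (pred False True True tt tt tt tt) (pred True True True tt tt tt tt) :=
    Step.of_limAt (pred_le_pred (by simp) (by simp) (by simp) (by simp) (by simp) (by simp)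
      (by simp)) (fun _ _ _ _ _ => trivial) fun X hX => condOn_src hX
  rw [pred_true] at h6
  exact ((((h1.trans h2).trans h3).trans h4).trans h5).trans h6

end Prederivator

/-! ### The source and the sink as parts of the gluing -/

namespace Glue

section Compare

variable {n : ℕ} {B U C : Type w} [SmallCategory B] [Preorder U] [SmallCategory C]
variable {s : Fin n → B} {s' : Fin n → U} (y : Fin n → C) (F : B ⥤ U)
  (hs : ∀ k, F.obj (s k) ≤ s' k)

/-- The functor between gluings induced by a functor on the left sides. -/
def mapLeft : Glue s y ⥤ Glue s' y :=
  desc (F ⋙ inl s' y) (inr s' y) fun k => arm k (homOfLE (hs k)) (𝟙 _)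

theorem mapLeft_faithful [Quiver.IsThin B] : (mapLeft y F hs).Faithful where
  map_injective {x x'} f f' h := by
    cases x <;> cases x'
    · exact Subsingleton.elim (α := _ ⟶ (_ : B)) f f'
    · obtain ⟨k, f, g⟩ := f
      obtain ⟨k', f', g'⟩ := f'
      replace h : (⟨k, _, 𝟙 _ ≫ g⟩ : Σ k, (_ ⟶ s' k) × (y k ⟶ _)) = ⟨k', _, 𝟙 _ ≫ g'⟩ := h
      obtain ⟨rfl, h⟩ := Sigma.mk.inj_iff.1 h
      obtain rfl : g = g' := by simpa using congrArg (fun t => t.2) (eq_of_heq h)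
      obtain rfl : f = f' := Subsingleton.elim _ _
      rfl
    · exact f.elim
    · exact h

/-- The functor is full if the preorder relations between images in `U`, and those between images
and the elements at which the new morphisms start, come from morphisms in `B`. As the `k`-th new
morphism of `Glue s y` may be sent to a composite, `F (s k)` may be smaller than `s' k`. -/
theorem mapLeft_full (h₁ : ∀ b b', F.obj b ≤ F.obj b' → Nonempty (b ⟶ b'))
    (h₂ : ∀ b k, F.obj b ≤ s' k → Nonempty (b ⟶ s k)) : (mapLeft y F hs).Full where
  map_surjective {x x'} f := by
    cases x <;> cases x'
    · exact ⟨(inl s y).map (h₁ _ _ (leOfHom f)).some, (subsingleton_hom _ _).elim _ _⟩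
    · obtain ⟨k, f, g⟩ := f
      refine ⟨arm k (h₂ _ _ (leOfHom f)).some g, ?_⟩
      exact congrArg₂ (fun f g => (⟨k, f, g⟩ : Σ k, (_ ⟶ s' k) × (y k ⟶ _))) (Subsingleton.elim _ _)
        (Category.id_comp _)
    · exact f.elim
    · exact ⟨(inr s y).map f, rfl⟩

variable {P : U → Prop} (hP : ∀ b, P (F.obj b))

/-- The functor `mapLeft` with values in a part of the gluing. -/
def mapPart : Glue s y ⥤ (part s' y P).FullSubcategory :=
  ObjectProperty.lift _ (mapLeft y F hs) fun x => match x with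
    | left b => hP b
    | right _ => trivial

theorem mapPart_isEquivalence [Quiver.IsThin B]
    (h₁ : ∀ b b', F.obj b ≤ F.obj b' → Nonempty (b ⟶ b'))
    (h₂ : ∀ b k, F.obj b ≤ s' k → Nonempty (b ⟶ s k)) (h₃ : ∀ a, P a → ∃ b, F.obj b = a) :
    (mapPart y F hs hP).IsEquivalence := by
  have := mapLeft_faithful y F hs
  have := mapLeft_full y F hs h₁ h₂
  have h4 : (mapPart y F hs hP).Full := inferInstanceAs (ObjectProperty.lift _ _ _).Full
  have h5 : (mapPart y F hs hP).Faithful := inferInstanceAs (ObjectProperty.lift _ _ _).Faithful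
  have h6 : (mapPart y F hs hP).EssSurj := ⟨by
    rintro ⟨a | c, ha⟩
    · obtain ⟨b, rfl⟩ := h₃ a ha
      exact ⟨left b, ⟨Iso.refl _⟩⟩
    · exact ⟨right c, ⟨Iso.refl _⟩⟩⟩
  exact {}

end Compare

end Glue

namespace Prederivator

open Glue Vert

section

variable {n : ℕ}

instance (I : Type*) : Quiver.IsThin (Σ _ : I, Pt.{w}) := by
  rintro ⟨i, a⟩ ⟨j, b⟩
  refine ⟨?_⟩
  rintro ⟨f⟩ ⟨g⟩
  exact congrArg _ (Subsingleton.elim f g)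

instance : Quiver.IsThin (SourceCat.{w} n) := by
  rintro (a | _) (b | _)
  · exact inferInstanceAs (Subsingleton (a ⟶ b))
  · exact ⟨fun f => PEmpty.elim f⟩
  · exact ⟨fun _ _ => rfl⟩
  · exact ⟨fun _ _ => rfl⟩

instance : Quiver.IsThin (SinkCat.{w} n) := by
  rintro (a | _) (b | _)
  · exact inferInstanceAs (Subsingleton (a ⟶ b))
  · exact ⟨fun _ _ => rfl⟩
  · exact ⟨fun f => PEmpty.elim f⟩
  · exact ⟨fun _ _ => rfl⟩

/-- The elements which form the source. -/
def sourceFunctor : SourceCat.{w} n ⥤ Vert.{w} n :=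
  WithInitial.lift (Sigma.desc fun k => pt (.p k)) (Z := .src) (fun x => homOfLE (by simp [le_def, up]))
    (fun _ _ _ => Subsingleton.elim _ _)

/-- The elements which form the sink. -/
def sinkFunctor : SinkCat.{w} n ⥤ Vert.{w} n :=
  WithTerminal.lift (Sigma.desc fun k => pt (.q k)) (Z := .c ∅) (fun x => homOfLE (by simp [le_def, up]))
    (fun _ _ _ => Subsingleton.elim _ _)

theorem exists_sourceFunctor_obj (a : Vert.{w} n)
    (ha : pred True False False (fun _ => True) (fun _ => False) (fun _ => False)
      (fun _ => False) a) : ∃ b, sourceFunctor.{w}.obj b = a := by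
  cases a <;> simp at ha
  · exact ⟨.star, rfl⟩
  · exact ⟨.of ⟨_, ⟨⟨⟩⟩⟩, rfl⟩

theorem exists_sinkFunctor_obj (a : Vert.{w} n)
    (ha : pred False False False (fun _ => False) (fun _ => True) (fun _ => False)
      (Below 0) a) : ∃ b, sinkFunctor.{w}.obj b = a := by
  cases a <;> simp [below_zero_iff] at ha
  · exact ⟨.of ⟨_, ⟨⟨⟩⟩⟩, rfl⟩
  · exact ⟨.star, congrArg _ ha.symm⟩

variable {C : Type w} [SmallCategory C] (y : Fin n → C)

/-- The gluing of the source with `C` as a part of the large gluing. -/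
def sourcePart : Glue (sourceInc.{w} n) y ⥤ (part Vert.p y (pred True False False (fun _ => True)
    (fun _ => False) (fun _ => False) (fun _ => False))).FullSubcategory :=
  mapPart y (s := sourceInc n) sourceFunctor (fun _ => le_rfl) fun
    | .star => trivial
    | .of _ => trivial

/-- The gluing of the sink with `C` as a part of the large gluing. -/
def sinkPart : Glue (sinkInc.{w} n) y ⥤ (part Vert.p y (pred False False False (fun _ => False)
    (fun _ => True) (fun _ => False) (Below 0))).FullSubcategory :=
  mapPart y (s := sinkInc n) sinkFunctor (s' := Vert.p) (fun k => show Vert.q k ≤ .p k by simp [le_def, up]) fun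
    | .star => below_zero_iff.2 rfl
    | .of _ => trivial

instance : (sourcePart.{w} y).IsEquivalence := by
  refine mapPart_isEquivalence _ _ _ _ ?_ ?_ exists_sourceFunctor_obj
  · rintro (⟨i, ⟨⟨⟩⟩⟩ | _) (⟨j, ⟨⟨⟩⟩⟩ | _) h
    · obtain rfl : i = j := h
      exact ⟨𝟙 _⟩
    · exact h.elim
    · exact ⟨PUnit.unit⟩
    · exact ⟨PUnit.unit⟩
  · rintro (⟨i, ⟨⟨⟩⟩⟩ | _) j h
    · obtain rfl : i = j := h
      exact ⟨𝟙 _⟩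
    · exact ⟨PUnit.unit⟩

instance : (sinkPart.{w} y).IsEquivalence := by
  refine mapPart_isEquivalence _ _ _ _ ?_ ?_ exists_sinkFunctor_obj
  · rintro (⟨i, ⟨⟨⟩⟩⟩ | _) (⟨j, ⟨⟨⟩⟩⟩ | _) h
    · obtain rfl : i = j := h
      exact ⟨𝟙 _⟩
    · exact ⟨PUnit.unit⟩
    · exact h.elim
    · exact ⟨PUnit.unit⟩
  · rintro (⟨i, ⟨⟨⟩⟩⟩ | _) j h
    · obtain rfl : i = j := h
      exact ⟨𝟙 _⟩
    · exact h.elim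

end

section

variable {D : Prederivator.{w, v, u}}

/-- Restriction along an equivalence is a Kan extension without new objects. -/
theorem RestrictsTo.of_isEquivalence [D.IsDerivator] {K L : Type w} [SmallCategory K]
    [SmallCategory L] (p : L ⥤ K) [p.IsEquivalence] {T : ObjectProperty (D.Diag K)}
    {T' : ObjectProperty (D.Diag L)} [T'.IsClosedUnderIsomorphisms]
    (h : ∀ Y, T Y ↔ T' ((D.res p).obj Y)) : RestrictsTo p T T' :=
  .of_isLim p fun Y => (h Y).trans
    ⟨fun h => ⟨h, fun b hb => absurd (Functor.EssSurj.mem_essImage p b) hb⟩, And.left⟩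

variable {n : ℕ} {C : Type w} [SmallCategory C] (y : Fin n → C)

variable (D) in
/-- The conditions on a diagram on the gluing of `Vert n` and `C`. -/
def cond [D.IsStable] : ObjectProperty (D.Diag (Glue (Vert.p.{w} (n := n)) y)) :=
  fun X => CondOn (fun _ => True) ((D.res (inl Vert.p y)).obj X)

variable {y} {P : Vert.{w} n → Prop}

/-- If the conditions are vacuous on a part of the gluing, and diagrams extend from this part, then
the diagrams on the gluing which satisfy the conditions are equivalent to all diagrams on a category
equivalent to this part. -/
theorem restrictsTo_of_step [D.IsStable] {A : Type w} [SmallCategory A]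
    (e : A ⥤ (part Vert.p y P).FullSubcategory) [e.IsEquivalence]
    (hP : ∀ X : D.Diag (Vert.{w} n), CondOn P X) (h : Step D y P fun _ => True) :
    RestrictsTo (D := D) (e ⋙ (part Vert.p y P).ι) (cond D y) (fun _ => True) := by
  obtain ⟨hle, h⟩ := h
  let i := (part (Vert.p.{w} (n := n)) y fun _ => True).ι
  have : i.EssSurj := ⟨fun x => ⟨⟨x, by cases x <;> trivial⟩, ⟨Iso.refl _⟩⟩⟩
  have : i.IsEquivalence := {}
  have h1 : RestrictsTo (D := D) i (cond D y) (condPart y fun _ => True) :=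
    .of_isEquivalence i fun Y => by
      unfold cond condPart
      rw [← condSub_res_iff]
      have e : (D.res (Subtype.mono_coe fun _ : Vert.{w} n => True).functor).obj
          ((D.res (inl Vert.p y)).obj Y) ≅
          (D.res (inlOn Vert.p y fun _ => True)).obj ((D.res i).obj Y) :=
        eqToIso (D.res_comp_obj (Subtype.mono_coe fun _ : Vert.{w} n => True).functor
          (inl Vert.p y) Y).symm ≪≫ eqToIso (D.res_comp_obj (inlOn Vert.p y fun _ => True) i Y)
      exact ⟨condSub_of_iso e, condSub_of_iso e.symm⟩
  have h2 : RestrictsTo (D := D) e (condPart y P) (fun _ => True) := by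
    have : ObjectProperty.IsClosedUnderIsomorphisms (fun _ : D.Diag A => True) :=
      ⟨fun _ _ => trivial⟩
    refine .of_isEquivalence e fun Y => ?_
    obtain ⟨X, ⟨e⟩⟩ := exists_extension Y
    exact ⟨fun _ => trivial, fun _ => (condPart_iff e).2 (hP X)⟩
  exact (h1.comp h).comp h2

theorem restrictsTo_source [D.IsStable] {A : Type w} [SmallCategory A]
    (e : A ≌ Glue (sourceInc.{w} n) y) :
    RestrictsTo (D := D) ((e.functor ⋙ sourcePart y) ⋙ (part Vert.p y _).ι) (cond D y)
      (fun _ => True) :=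
  restrictsTo_of_step _ (fun X => condOn_pred_iff.2 (by simp)) (step_source D y)

theorem restrictsTo_sink [D.IsStable] {A : Type w} [SmallCategory A]
    (e : A ≌ Glue (sinkInc.{w} n) y) :
    RestrictsTo (D := D) ((e.functor ⋙ sinkPart y) ⋙ (part Vert.p y _).ι) (cond D y)
      (fun _ => True) :=
  restrictsTo_of_step _ (fun X => condOn_pred_iff.2 (by simp)) (step_sink D y)

end

end Prederivator

/-! ### Exact morphisms preserve the conditions -/

namespace StableDerivator

open Glue Vert

section

variable {D E : StableDerivator.{w, v, u}} (F : D ⟶ E)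

theorem isZero_map {X : D.toPrederivator.Diag Pt.{w}} (h : IsZero X) :
    IsZero ((component F.hom _).obj X) := by
  obtain ⟨h1⟩ := F.exact.initial X ⟨h.isInitial⟩
  exact (isZero_zero _).of_iso (h1.uniqueUpToIso (isZero_zero _).isInitial)

theorem isZero_eval_map {K : Type w} [SmallCategory K] {X : D.toPrederivator.Diag K} {a : K}
    (h : IsZero ((D.toPrederivator.eval a).obj X)) :
    IsZero ((E.toPrederivator.eval a).obj ((component F.hom K).obj X)) :=
  (isZero_map F h).of_iso (natIso F.hom (pt a).toCatHom.op X).symm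

theorem biCart_map {U : Type w} [Preorder U] {X : D.toPrederivator.Diag U} {a b c d : U}
    (h : BiCart X a b c d) : BiCart ((component F.hom U).obj X) a b c d := by
  obtain ⟨h1, h2, h3, h4, h⟩ := h
  exact ⟨h1, h2, h3, h4, isCocartesian_of_iso
    (natIso F.hom (sq h1 h2 h3 h4).toCatHom.op X) (F.exact.cocartesian _ h)⟩

theorem condOn_map {n : ℕ} {P : Vert.{w} n → Prop} {X : D.toPrederivator.Diag (Vert.{w} n)}
    (h : CondOn P X) : CondOn P ((component F.hom _).obj X) :=
  ⟨fun a ha hP => isZero_eval_map F (h.zero a ha hP),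
    fun a b c d hq ha hb hc hd => biCart_map F (h.sq a b c d hq ha hb hc hd)⟩

end

theorem condOn_of_iso {D : Prederivator.{w, v, u}} [D.IsStable] {n : ℕ} {P : Vert.{w} n → Prop}
    {X Y : D.Diag (Vert.{w} n)} (e : X ≅ Y) (h : CondOn P X) : CondOn P Y :=
  ⟨fun a ha hP => (h.zero a ha hP).of_iso ((D.eval a).mapIso e.symm),
    fun a b c d hq ha hb hc hd => biCart_of_iso e (h.sq a b c d hq ha hb hc hd)⟩

/-- The conditions on diagrams on the gluing, for all stable derivators. -/
def gluingConditions {n : ℕ} {C : Type w} [SmallCategory C] (y : Fin n → C) :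
    Conditions.{w, v, u} (Glue (Vert.p.{w} (n := n)) y) where
  prop D := cond D.toPrederivator y
  iso D := ⟨fun e h => condOn_of_iso ((D.toPrederivator.res _).mapIso e) h⟩
  map F X h := condOn_of_iso (natIso F.hom (inl Vert.p y).toCatHom.op X) (condOn_map F h)

end StableDerivator

/-! ### The strong stable equivalence -/

namespace CategoryTheory.Bicategory.Equivalence

universe w₁ v₁ u₁

variable {ℬ : Type u₁} [Bicategory.{w₁, v₁} ℬ] {a b c : ℬ}

/-- The inverse of an equivalence. -/
noncomputable def inverse (e : Bicategory.Equivalence a b) : Bicategory.Equivalence b a :=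
  mkOfAdjointifyCounit e.counit.symm e.unit.symm

/-- The composite of two equivalences. -/
noncomputable def comp (e : Bicategory.Equivalence a b) (e' : Bicategory.Equivalence b c) :
    Bicategory.Equivalence a c :=
  mkOfAdjointifyCounit (f := e.hom ≫ e'.hom) (g := e'.inv ≫ e.inv)
    (e.unit ≪≫ whiskerLeftIso e.hom ((λ_ e.inv).symm ≪≫ whiskerRightIso e'.unit e.inv ≪≫
      α_ _ _ _) ≪≫ (α_ _ _ _).symm)
    (α_ _ _ _ ≪≫ whiskerLeftIso e'.inv ((α_ _ _ _).symm ≪≫ whiskerRightIso e.counit e'.hom ≪≫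
      λ_ e'.hom) ≪≫ e'.counit)

end CategoryTheory.Bicategory.Equivalence

namespace CategoryTheory.Pseudofunctor.StrongTrans

universe w₁ w₂ v₁ v₂ u₁ u₂

variable {ℬ : Type u₁} [Bicategory.{w₁, v₁} ℬ] {𝒞 : Type u₂} [Bicategory.{w₂, v₂} 𝒞]
variable {F G : Pseudofunctor ℬ 𝒞}

/-- The component of an isomorphism of strong transformations. -/
def isoApp {η θ : F ⟶ G} (i : η ≅ θ) (b : ℬ) : η.app b ≅ θ.app b where
  hom := (Hom.as i.hom).app b
  inv := (Hom.as i.inv).app b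
  hom_inv_id := congrArg (fun t => (Hom.as t).app b) i.hom_inv_id
  inv_hom_id := congrArg (fun t => (Hom.as t).app b) i.inv_hom_id

/-- The component of an equivalence of pseudofunctors. -/
noncomputable def equivalenceApp (e : Bicategory.Equivalence F G) (b : ℬ) :
    Bicategory.Equivalence (F.obj b) (G.obj b) :=
  .mkOfAdjointifyCounit (f := e.hom.app b) (g := e.inv.app b) (isoApp e.unit b) (isoApp e.counit b)

end CategoryTheory.Pseudofunctor.StrongTrans

/-- A functor which is an equivalence is an equivalence in the 2-category of categories. -/
theorem exists_catEquivalence {X Y : Cat.{v, u}} (F : X ⟶ Y) (h : F.toFunctor.IsEquivalence) :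
    ∃ e : Bicategory.Equivalence X Y, e.hom = F :=
  ⟨Bicategory.Equivalence.mkOfAdjointifyCounit (f := F) (g := F.toFunctor.inv.toCatHom)
    (Cat.Hom.isoMk F.toFunctor.asEquivalence.unitIso)
    (Cat.Hom.isoMk F.toFunctor.asEquivalence.counitIso), rfl⟩

namespace StableDerivator

variable {K L : Type w} [SmallCategory K] [SmallCategory L]

/-- The restrictions which satisfy `RestrictsTo` are componentwise equivalences. -/
theorem isEquivalence_res_app (T : Conditions.{w, v, u} K) (p : L ⥤ K)
    (D : StableDerivator.{w, v, u}) (h : RestrictsTo p (T.prop D) fun _ => True)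
    (A : (Cat.{w, w})ᵒᵖ) :
    (Pseudofunctor.StrongTrans.app (Pseudofunctor.StrongTrans.app (T.res p) D) A).toFunctor.IsEquivalence := by
  let R : ((subProp D.toPrederivator (T.prop D)).prop A).FullSubcategory ⥤
      D.toPrederivator.Diag (L × A.unop) :=
    ((subProp D.toPrederivator (T.prop D)).prop A).ι ⋙ D.toPrederivator.res (p.prod (𝟭 A.unop))
  have h1 (X X') : Function.Bijective fun f : X ⟶ X' => R.map f :=
    (h.bijective A.unop X.obj X'.obj X.property X'.property).comp
      ((subProp D.toPrederivator (T.prop D)).prop A).fullyFaithfulι.homEquiv.bijective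
  have : R.Faithful := ⟨fun {X X'} _ _ hf => (h1 X X').1 hf⟩
  have : R.Full := ⟨fun {X X'} f => (h1 X X').2 f⟩
  have : R.EssSurj := ⟨fun Y => by
    obtain ⟨X, hX, ⟨e⟩⟩ := h.exists_iso A.unop Y fun _ => trivial
    exact ⟨⟨X, hX⟩, ⟨e⟩⟩⟩
  exact ({} : R.IsEquivalence)

theorem exists_equivalence_res_app (T : Conditions.{w, v, u} K) (p : L ⥤ K)
    (D : StableDerivator.{w, v, u}) (h : RestrictsTo p (T.prop D) fun _ => True) :
    ∃ e : Bicategory.Equivalence (T.sub.obj D) (D.toPrederivator.shift L),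
      e.hom = Pseudofunctor.StrongTrans.app (T.res p) D := by
  obtain ⟨e, he⟩ := Pseudofunctor.StrongTrans.exists_equivalence
    (Pseudofunctor.StrongTrans.app (T.res p) D)
    fun A => exists_catEquivalence _ (isEquivalence_res_app T p D h A)
  refine ⟨⟨e.hom, e.inv, e.unit, e.counit, e.left_triangle⟩, he⟩

/-- If the same natural conditions on diagrams of shape `K` make the restrictions along `p` and
along `q` equivalences, then the domains of `p` and `q` are strongly stably equivalent: the
equivalence is the inverse of `p^*` followed by `q^*`. -/
theorem stronglyStablyEquivalent_of_restrictsTo {L' : Type w} [SmallCategory L']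
    (T : Conditions.{w, v, u} K) (p : L ⥤ K) (q : L' ⥤ K)
    (hp : ∀ D : StableDerivator.{w, v, u}, RestrictsTo p (T.prop D) fun _ => True)
    (hq : ∀ D : StableDerivator.{w, v, u}, RestrictsTo q (T.prop D) fun _ => True) :
    StronglyStablyEquivalent.{w, v, u} L L' := by
  obtain ⟨e, -⟩ := Pseudofunctor.StrongTrans.exists_equivalence (T.res p)
    fun D => exists_equivalence_res_app T p D (hp D)
  refine ⟨e.inv ≫ T.res q, fun D => ?_⟩
  obtain ⟨e', he'⟩ := exists_equivalence_res_app T q D (hq D)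
  refine ⟨(Pseudofunctor.StrongTrans.equivalenceApp e D).inverse.comp e', ?_⟩
  exact congrArg (CategoryStruct.comp (obj := Prederivator.{w, v, u}) (e.inv.app D)) he'

end StableDerivator

theorem mainTheorem2 (C : Type w) [SmallCategory C] (n : ℕ) (y : Fin n → C)
    (Dminus Dplus : Type w) [SmallCategory Dminus] [SmallCategory Dplus]
    (iminus : SourceCat.{w} n ⊕ C ⥤ Dminus) (kminus : (Σ _ : Fin n, Arr.{w}) ⥤ Dminus)
    (iplus : SinkCat.{w} n ⊕ C ⥤ Dplus) (kplus : (Σ _ : Fin n, Arr.{w}) ⥤ Dplus)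
    (hminus : IsFreeGluing n (sourceInc n) y iminus kminus)
    (hplus : IsFreeGluing n (sinkInc n) y iplus kplus) :
    StronglyStablyEquivalent.{w, v, u} Dminus Dplus := by
  obtain ⟨e⟩ := Glue.exists_equivalence hminus
  obtain ⟨e'⟩ := Glue.exists_equivalence hplus
  exact StableDerivator.stronglyStablyEquivalent_of_restrictsTo (StableDerivator.gluingConditions y)
    _ _ (fun D => restrictsTo_source e) (fun D => restrictsTo_sink e')
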